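/- **Theorem 1.4.** Write $\widehat f(\xi)=\int_{\mathbb R^d} f(x)e^{-ix\cdot\xi}\,dx$ for the Fourier transform on $\mathbb R^d$ (and similarly on $\mathbb R^{1+d}$, with dual variables $(\tau,\xi)$), extended to tempered distributions. For tempered distributions $u_0,v_0$ on $\mathbb R^d$ whose Fourier transforms are locally integrable functions put $$I_\beta(u_0,v_0)=\int_{\mathbb R^{2d}}|\widehat u_0(\zeta)|^2|\widehat v_0(\eta)|^2|\zeta-\eta|^{4\beta+d-2}\,d\zeta\,d\eta ,\qquad \Upsilon_\beta=\{(u_0,v_0): I_\beta(u_0,v_0)<\infty\}.$$ Let $u=e^{it\Delta}u_0$ and $v=e^{it\Delta}v_0$ be the solutions of $i\partial_t u+\Delta u=0$ with initial data $u_0$ and $v_0$, and let $uv$ be their product (the pointwise product if $u_0,v_0\in L^2$; in general, the limit in the tempered distributions on $\mathbb R^{1+d}$, as $R\to\infty$, of the products of the parts of $u$ and $v$ with frequencies $|\xi|<R$). Let $|\mathfrak D|^\beta$ be the space-time Fourier multiplier with symbol $\big|\tau+\tfrac12|\xi|^2\big|^\beta$, and let $$\mathbf C(d)=\frac{2^{2-4d}\,\pi^{\frac{2-5d}{2}}}{\Gamma(\frac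 d2)} .$$ Let $d\ge 2$ and $\beta>\frac{1-d}{2}$. Then for all $(u_0,v_0)\in\Upsilon_\beta$, $$\big\|\,|\mathfrak D|^\beta(uv)\big\|_{L^2(\mathbb R^{1+d})}^2\le 2^{-2\beta}\,\mathbf C(d)\,I_\beta(u_0,v_0) .$$ The constant $2^{-2\beta}\mathbf C(d)$ is optimal. For nonzero $u_0$ and $v_0$, one has $(u_0,v_0)\in\Upsilon_\beta$ with equality in this estimate if and only if $\widehat u_0$ is a gaussian, that is, $\widehat u_0(\eta)=\exp(a|\eta|^2+b\cdot\eta+c)$ for some $a,c\in\mathbb C$, $b\in\mathbb C^d$ with $\operatorname{Re}a<0$, and $v_0$ is a scalar multiple of $u_0$. -/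

import Mathlib

open MeasureTheory Filter Topology
open scoped SchwartzMap ENNReal

noncomputable section

namespace BilinearSchrodinger

/-- The space `ℝ^d`. -/
abbrev Space (d : ℕ) : Type := EuclideanSpace ℝ (Fin d)

/-- Space-time `ℝ^{1+d}` with its Euclidean structure; a point is `z = (z.fst, z.snd)`, with time
(or temporal frequency) `z.fst` and position (or spatial frequency) `z.snd`. -/
abbrev SpaceTime (d : ℕ) : Type := WithLp 2 (ℝ × Space d)

section Fourier

variable {V : Type*} [NormedAddCommGroup V] [InnerProductSpace ℝ V] [FiniteDimensional ℝ V]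
  [MeasurableSpace V] [BorelSpace V]

/-- The Fourier transform `φ̂(x) = ∫ φ(ξ) exp(-i x·ξ) dξ` on Schwartz functions, obtained from
Mathlib's transform (whose phase is `-2π i x·ξ`) by a dilation. -/
def schwartzHat : 𝓢(V, ℂ) →L[ℂ] 𝓢(V, ℂ) :=
  SchwartzMap.compCLMOfContinuousLinearEquiv ℂ
    (ContinuousLinearEquiv.smulLeft (R₁ := ℝ) (M₁ := V)
      (Units.mk0 ((2 * Real.pi)⁻¹ : ℝ) (by positivity))) ∘L
    FourierTransform.fourierCLM ℂ 𝓢(V, ℂ)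

theorem schwartzHat_apply (φ : 𝓢(V, ℂ)) (x : V) :
    schwartzHat φ x =
      ∫ ξ, φ ξ * Complex.exp (-(Complex.I * ((inner ℝ x ξ : ℝ) : ℂ))) := by
  have h : schwartzHat φ x =
      FourierTransform.fourier (φ : V → ℂ) ((2 * Real.pi)⁻¹ • x) := rfl
  rw [h, Real.fourier_eq']
  refine integral_congr_ae (Eventually.of_forall fun ξ => ?_)
  have hx : -2 * Real.pi * inner ℝ ξ ((2 * Real.pi)⁻¹ • x) = -inner ℝ x ξ := by
    rw [real_inner_smul_right, real_inner_comm]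
    field_simp
  simp only [hx, smul_eq_mul]
  rw [mul_comm]
  congr 2
  push_cast
  ring

/-- The Fourier transform of a tempered distribution: `⟨T̂, φ⟩ = ⟨T, φ̂⟩`. -/
def hat (T : 𝓢'(V, ℂ)) : 𝓢'(V, ℂ) :=
  PointwiseConvergenceCLM.precomp ℂ schwartzHat T

theorem hat_apply (T : 𝓢'(V, ℂ)) (φ : 𝓢(V, ℂ)) : hat T φ = T (schwartzHat φ) := rfl

/-- The tempered distribution `T` is (given by) the locally integrable function `f`. -/
def IsFun (T : 𝓢'(V, ℂ)) (f : V → ℂ) : Prop :=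
  LocallyIntegrable f volume ∧
    ∀ φ : 𝓢(V, ℂ), HasCompactSupport φ → T φ = ∫ x, φ x * f x

end Fourier

variable {d : ℕ}

/-- The part with frequencies `|ξ| < R` of the solution `u = e^{itΔ} u₀` of `i ∂ₜ u + Δ u = 0`,
`u(0) = u₀`, where `f = û₀`:
`(2π)^{-d} ∫_{|ξ| < R} exp(i (x·ξ - t |ξ|²)) û₀(ξ) dξ`. -/
def cutoffSolution (f : Space d → ℂ) (R : ℝ) (z : SpaceTime d) : ℂ :=
  (((2 * Real.pi) ^ d : ℝ) : ℂ)⁻¹ *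
    ∫ ξ in Metric.ball (0 : Space d) R,
      Complex.exp (Complex.I * ((inner ℝ z.snd ξ - z.fst * ‖ξ‖ ^ 2 : ℝ) : ℂ)) * f ξ

/-- `w` is the product `u v` of the solutions `u = e^{itΔ} u₀`, `v = e^{itΔ} v₀` of the free
Schrödinger equation: the limit, in the tempered distributions on space-time, of the pointwise
products of their frequency cutoffs. If `u₀, v₀ ∈ L²`, then the cutoffs converge to `u` and `v` in
`L²` uniformly in time, and `w` is the pointwise product `u(t,x) v(t,x)`. -/
def IsProduct (u₀ v₀ : 𝓢'(Space d, ℂ)) (w : 𝓢'(SpaceTime d, ℂ)) : Prop :=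
  ∃ f g : Space d → ℂ, IsFun (hat u₀) f ∧ IsFun (hat v₀) g ∧
    ∀ φ : 𝓢(SpaceTime d, ℂ),
      Tendsto (fun R : ℝ => ∫ z, φ z * (cutoffSolution f R z * cutoffSolution g R z)) atTop
        (𝓝 (w φ))

/-- `F = |𝔇|^β w`, where `|𝔇|^β` is the space-time Fourier multiplier `|τ + |ξ|²/2|^β`. -/
def IsDispersivePower (β : ℝ) (w F : 𝓢'(SpaceTime d, ℂ)) : Prop :=
  ∃ G : SpaceTime d → ℂ, IsFun (hat w) G ∧
    IsFun (hat F) (fun z => ((|z.fst + ‖z.snd‖ ^ 2 / 2| ^ β : ℝ) : ℂ) * G z)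

/-- `‖ |𝔇|^β (u v) ‖²` in `L²(ℝ^{1+d})`, for the solutions `u, v` with initial data `u₀, v₀`. It is
`∞` unless `|𝔇|^β (u v)` is an `L²` function `F`, which is then unique. -/
def dispersiveNormSq (β : ℝ) (u₀ v₀ : 𝓢'(Space d, ℂ)) : ℝ≥0∞ :=
  ⨅ (w : 𝓢'(SpaceTime d, ℂ)) (F : Lp ℂ 2 (volume : Measure (SpaceTime d)))
    (_ : IsProduct u₀ v₀ w ∧ IsDispersivePower β w (Lp.toTemperedDistribution F)), ‖F‖ₑ ^ 2

/-- `I_β(u₀, v₀) = ∫∫ |û₀(ζ)|² |v̂₀(η)|² |ζ - η|^{4β+d-2} dζ dη`. It is `∞` unless `û₀` and `v̂₀`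
are locally integrable functions (which are unique up to null sets). -/
def energy (β : ℝ) (u₀ v₀ : 𝓢'(Space d, ℂ)) : ℝ≥0∞ :=
  ⨅ (f : Space d → ℂ) (g : Space d → ℂ) (_ : IsFun (hat u₀) f ∧ IsFun (hat v₀) g),
    ∫⁻ p : Space d × Space d,
      ‖f p.1‖ₑ ^ 2 * ‖g p.2‖ₑ ^ 2 * ENNReal.ofReal (‖p.1 - p.2‖ ^ (4 * β + d - 2))

/-- The class `Υ_β` of pairs of initial data with `I_β(u₀, v₀) < ∞`. -/
def Upsilon (d : ℕ) (β : ℝ) : Set (𝓢'(Space d, ℂ) × 𝓢'(Space d, ℂ)) :=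
  {p | energy β p.1 p.2 < ∞}

/-- The class `𝔊` of gaussians `exp(a |η|² + b · η + c)` with `a, c ∈ ℂ`, `b ∈ ℂ^d`, `Re a < 0`. -/
def gaussians (d : ℕ) : Set (Space d → ℂ) :=
  {f | ∃ (a c : ℂ) (b : Fin d → ℂ), a.re < 0 ∧
    f = fun η => Complex.exp (a * ((‖η‖ ^ 2 : ℝ) : ℂ) + ∑ j, b j * ((η j : ℝ) : ℂ) + c)}

/-- The constant `C(d) = 2^{2-4d} π^{(2-5d)/2} / Γ(d/2)`. -/
def carneiroConst (d : ℕ) : ℝ :=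
  (2 : ℝ) ^ (2 - 4 * (d : ℝ)) * Real.pi ^ ((2 - 5 * (d : ℝ)) / 2) / Real.Gamma ((d : ℝ) / 2)

/-- The constant `2^{-2β} C(d)`. -/
def sharpConst (d : ℕ) (β : ℝ) : ℝ≥0∞ :=
  ENNReal.ofReal ((2 : ℝ) ^ (-2 * β) * carneiroConst d)

end BilinearSchrodinger

end

open MeasureTheory Filter Topology
open scoped SchwartzMap ENNReal

set_option linter.unusedSectionVars false

noncomputable section

namespace BilinearSchrodinger

/-! ### Tempered distributions, normalisation of the transform, Plancherel -/

section Fourier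

open scoped FourierTransform ContDiff

variable {V : Type*} [NormedAddCommGroup V] [InnerProductSpace ℝ V] [FiniteDimensional ℝ V]

/-! Write f and g for the Fourier transforms of the data. The space-time transform of uv lives at
the output frequencies z = (τ, ξ) = (-(|ζ|² + |η|²), ζ + η). The pairs (ζ, η) over a given z form a
sphere: ζ + η = ξ is fixed, and ζ - η = rθ with θ a unit vector and r² = -2τ - |ξ|² by the
parallelogram law. In the coordinates (z, θ) the measure dζ dη becomes 2^{-d} r^{d-2} dz dσ(θ)
(`measurePreserving_pairMap`). So the transform of uv at z is (2π)^{1-d} 2^{-d} r^{d-2} times the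
integral of f(ζ)g(η) over the sphere, and the symbol |τ + |ξ|²/2| equals r²/2, constant on the
sphere.

By Plancherel, the left side is a constant times the integral of |∫ fg dσ|² r^{4β+d-2}, while the
energy is the integral of ∫ |fg|² dσ against the same weight and measure. The estimate is therefore
Cauchy-Schwarz against 1 on each sphere. Its defect is a variance, so the estimate is an identity
with a nonnegative remainder (`sharpConst_mul_energy`). Equality holds exactly when f ⊗ g is almost
everywhere a function of the output frequency. Gaussians have this property, and their energy is
finite and nonzero, which gives optimality.

For the converse, exchanging ζ and η gives g = s f, and f ⊗ f is a function of momentum and energy,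
which is the Maxwell-Boltzmann functional equation, but for a merely measurable f. Finite energy
forces f to grow polynomially on average, so f times a gaussian is integrable and satisfies the same
kind of equation. The equation says that f ⊗ f is invariant under the isometries of ℝ^{2d} that fix
ζ + η and turn ζ - η, so it passes to the Fourier transform (`isRectangular_fourier`), which is
continuous. A continuous nonzero solution has no zeros, and its logarithm is additive on orthogonal
vectors, hence quadratic (`IsRectangular.exists_eq_exp`). Fourier uniqueness brings this back to f,
and finiteness of the energy gives the sign of Re a.

The same polynomial growth makes f ⊗ g tempered, so that the products of the frequency cutoffs
converge and the product exists for all data in Υ_β. -/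

theorem exists_schwartz_cutoff (V : Type*) [NormedAddCommGroup V] [InnerProductSpace ℝ V]
    [FiniteDimensional ℝ V] :
    ∃ χ : 𝓢(V, ℂ), HasCompactSupport χ ∧ ∀ x, ‖x‖ < 1 → χ x = 1 := by
  let b : ContDiffBump (0 : V) := ⟨1, 2, one_pos, one_lt_two⟩
  have hs : HasCompactSupport (fun x => ((b x : ℝ) : ℂ)) :=
    b.hasCompactSupport.comp_left (g := fun y : ℝ => (y : ℂ)) Complex.ofReal_zero
  have hc : ContDiff ℝ ∞ (fun x => ((b x : ℝ) : ℂ)) :=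
    Complex.ofRealCLM.contDiff.comp b.contDiff
  refine ⟨hs.toSchwartzMap hc, hs, fun x hx => ?_⟩
  have : b x = 1 := b.one_of_mem_closedBall (by simpa using hx.le)
  simp [this]

/-- Each derivative of χ(ε ·) produces a factor ε ≤ 1, so the bounds do not depend on ε. -/
theorem exists_bound_cutoff_sub_one (χ : 𝓢(V, ℂ)) (i : ℕ) :
    ∃ B : ℝ, 0 ≤ B ∧ ∀ ε : ℝ, 0 < ε → ε ≤ 1 → ∀ x,
      ‖iteratedFDeriv ℝ i (fun x => χ (ε • x) - 1) x‖ ≤ B := by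
  refine ⟨SchwartzMap.seminorm ℝ 0 i χ + 1, by positivity, fun ε h0 h1 x => ?_⟩
  have hχ : ContDiff ℝ i (fun x => χ (ε • x)) :=
    (χ.smooth i).comp (contDiff_const_smul ε)
  have h2 : ‖iteratedFDeriv ℝ i (fun x => χ (ε • x)) x‖ ≤ SchwartzMap.seminorm ℝ 0 i χ := by
    rw [iteratedFDeriv_comp_const_smul ε (χ.smooth i), norm_smul]
    calc _ ≤ 1 * ‖iteratedFDeriv ℝ i χ (ε • x)‖ := by
          gcongr
          rw [norm_pow, Real.norm_of_nonneg h0.le]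
          exact pow_le_one₀ h0.le h1
      _ ≤ _ := by
          rw [one_mul]
          exact SchwartzMap.norm_iteratedFDeriv_le_seminorm ℝ χ i _
  have h3 : ‖iteratedFDeriv ℝ i (fun _ : V => (1 : ℂ)) x‖ ≤ 1 := by
    rcases eq_or_ne i 0 with rfl | hi
    · simp
    · simp [iteratedFDeriv_const_of_ne hi]
  rw [fun_iteratedFDeriv_sub_apply hχ.contDiffAt contDiffAt_const]
  exact (norm_sub_le _ _).trans (add_le_add h2 h3)

/-- The product vanishes where ε|x| < 1. Elsewhere 1 ≤ ε|x|, so one more power of |x| in the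
seminorm of φ pays for the factor ε. -/
theorem exists_bound_cutoff_mul (χ : 𝓢(V, ℂ)) (h1 : ∀ x, ‖x‖ < 1 → χ x = 1)
    (φ : 𝓢(V, ℂ)) (k n : ℕ) :
    ∃ C : ℝ, ∀ ε : ℝ, 0 < ε → ε ≤ 1 → ∀ x,
      ‖x‖ ^ k * ‖iteratedFDeriv ℝ n (fun x => (χ (ε • x) - 1) * φ x) x‖ ≤ C * ε := by
  choose B hB0 hB using exists_bound_cutoff_sub_one χ
  have hC0 : 0 ≤ ∑ i ∈ Finset.range (n + 1),
      (n.choose i : ℝ) * B i * SchwartzMap.seminorm ℝ (k + 1) (n - i) φ :=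
    Finset.sum_nonneg fun i _ => mul_nonneg (mul_nonneg (Nat.cast_nonneg _) (hB0 i))
      (apply_nonneg _ _)
  refine ⟨∑ i ∈ Finset.range (n + 1),
    (n.choose i : ℝ) * B i * SchwartzMap.seminorm ℝ (k + 1) (n - i) φ, fun ε he0 he1 x => ?_⟩
  by_cases hx : ‖ε • x‖ < 1
  · have : (fun x => (χ (ε • x) - 1) * φ x) =ᶠ[𝓝 x] fun _ => 0 := by
      have : ∀ᶠ y in 𝓝 x, ‖ε • y‖ < 1 :=
        (continuous_const_smul ε).norm.continuousAt.eventually_lt continuousAt_const hx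
      filter_upwards [this] with y hy
      simp [h1 _ hy]
    rw [(this.iteratedFDeriv ℝ n).eq_of_nhds]
    have : iteratedFDeriv ℝ n (fun _ : V => (0 : ℂ)) x = 0 := by
      simp [show (fun _ : V => (0 : ℂ)) = 0 from rfl]
    rw [this]
    simp only [norm_zero, mul_zero]
    positivity
  · have hx1 : 1 ≤ ε * ‖x‖ := by
      rw [norm_smul, Real.norm_of_nonneg he0.le] at hx
      exact not_lt.1 hx
    have hxk : ‖x‖ ^ k ≤ ε * ‖x‖ ^ (k + 1) := by
      calc ‖x‖ ^ k ≤ (ε * ‖x‖) * ‖x‖ ^ k := le_mul_of_one_le_left (by positivity) hx1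
        _ = _ := by ring
    have hχ : ContDiff ℝ n (fun x => χ (ε • x) - 1) :=
      ((χ.smooth n).comp (contDiff_const_smul ε)).sub contDiff_const
    calc _ ≤ ‖x‖ ^ k * ∑ i ∈ Finset.range (n + 1), (n.choose i : ℝ) *
            ‖iteratedFDeriv ℝ i (fun x => χ (ε • x) - 1) x‖ * ‖iteratedFDeriv ℝ (n - i) φ x‖ := by
          gcongr
          exact norm_iteratedFDeriv_mul_le hχ (φ.smooth n) x le_rfl
      _ ≤ _ := by
          rw [Finset.mul_sum, Finset.sum_mul]
          refine Finset.sum_le_sum fun i _ => ?_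
          have h2 := SchwartzMap.le_seminorm ℝ (k + 1) (n - i) φ x
          calc _ = (n.choose i : ℝ) * ‖iteratedFDeriv ℝ i (fun x => χ (ε • x) - 1) x‖ *
                (‖x‖ ^ k * ‖iteratedFDeriv ℝ (n - i) φ x‖) := by ring
            _ ≤ (n.choose i : ℝ) * B i *
                (ε * (‖x‖ ^ (k + 1) * ‖iteratedFDeriv ℝ (n - i) φ x‖)) := by
              refine mul_le_mul ?_ ?_ (by positivity)
                (mul_nonneg (Nat.cast_nonneg _) (hB0 i))
              · exact mul_le_mul_of_nonneg_left (hB i ε he0 he1 x) (Nat.cast_nonneg _)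
              · rw [← mul_assoc]
                exact mul_le_mul_of_nonneg_right hxk (norm_nonneg _)
            _ ≤ (n.choose i : ℝ) * B i * (ε * SchwartzMap.seminorm ℝ (k + 1) (n - i) φ) := by
              have := hB0 i
              gcongr
            _ = _ := by ring

/-- A tempered distribution is determined by its values on compactly supported functions. -/
theorem eq_zero_of_forall_hasCompactSupport (T : 𝓢'(V, ℂ))
    (h : ∀ φ : 𝓢(V, ℂ), HasCompactSupport φ → T φ = 0) : T = 0 := by
  obtain ⟨χ, hχ, h1⟩ := exists_schwartz_cutoff V
  ext φ
  have hε : ∀ m : ℕ, (0 : ℝ) < 1 / ((m : ℝ) + 1) := fun m => by positivity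
  have hsupp : ∀ m : ℕ, HasCompactSupport (fun x => χ ((1 / ((m : ℝ) + 1)) • x) * φ x) := fun m =>
    (hχ.comp_smul (hε m).ne').mul_right
  have hdiff : ∀ m : ℕ, ContDiff ℝ ∞ (fun x => χ ((1 / ((m : ℝ) + 1)) • x) * φ x) := fun m =>
    ((χ.smooth ⊤).comp (contDiff_const_smul _)).mul (φ.smooth ⊤)
  let ψ : ℕ → 𝓢(V, ℂ) := fun m => (hsupp m).toSchwartzMap (hdiff m)
  have hlim : Tendsto ψ atTop (𝓝 φ) := by
    rw [(schwartz_withSeminorms ℝ V ℂ).tendsto_nhds]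
    rintro ⟨k, n⟩ δ hδ
    obtain ⟨C, hC⟩ := exists_bound_cutoff_mul χ h1 φ k n
    have hC0 : 0 ≤ C := by
      have := hC 1 one_pos le_rfl 0
      rw [mul_one] at this
      exact le_trans (by positivity) this
    have hl : Tendsto (fun m : ℕ => C * (1 / ((m : ℝ) + 1))) atTop (𝓝 0) := by
      simpa using tendsto_one_div_add_atTop_nhds_zero_nat.const_mul C
    filter_upwards [hl.eventually (gt_mem_nhds hδ)] with m hm
    refine lt_of_le_of_lt (SchwartzMap.seminorm_le_bound ℝ k n _ (by positivity) fun x => ?_) hm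
    have := hC _ (hε m) ((div_le_one (by positivity)).2 (by simp)) x
    convert this using 4
    funext y
    simp [ψ, sub_mul]
  have h2 : Tendsto (fun m => T (ψ m)) atTop (𝓝 (T φ)) := (T.continuous.tendsto φ).comp hlim
  have h3 : ∀ m, T (ψ m) = 0 := fun m => h (ψ m) (hsupp m)
  simp only [h3] at h2
  change T φ = (0 : ℂ)
  exact tendsto_nhds_unique h2 tendsto_const_nhds

variable [MeasurableSpace V] [BorelSpace V]

theorem IsFun.ae_eq {T : 𝓢'(V, ℂ)} {f g : V → ℂ} (hf : IsFun T f) (hg : IsFun T g) :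
    f =ᵐ[volume] g := by
  refine ae_eq_of_integral_contDiff_smul_eq hf.1 hg.1 fun χ hχ hs => ?_
  have hs' : HasCompactSupport (fun x => ((χ x : ℝ) : ℂ)) :=
    hs.comp_left (g := fun y : ℝ => (y : ℂ)) Complex.ofReal_zero
  have hc : ContDiff ℝ ∞ (fun x => ((χ x : ℝ) : ℂ)) := Complex.ofRealCLM.contDiff.comp hχ
  have h1 := hf.2 (hs'.toSchwartzMap hc) hs'
  rw [hg.2 (hs'.toSchwartzMap hc) hs'] at h1
  simpa using h1.symm

theorem IsFun.congr {T : 𝓢'(V, ℂ)} {f g : V → ℂ} (hf : IsFun T f) (h : f =ᵐ[volume] g) :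
    IsFun T g := by
  refine ⟨hf.1.congr h, fun φ hφ => ?_⟩
  rw [hf.2 φ hφ]
  refine integral_congr_ae ?_
  filter_upwards [h] with x hx
  rw [hx]

theorem IsFun.ext {S T : 𝓢'(V, ℂ)} {f : V → ℂ} (hS : IsFun S f) (hT : IsFun T f) : S = T := by
  rw [← sub_eq_zero]
  refine eq_zero_of_forall_hasCompactSupport _ fun φ hφ => ?_
  have : (S - T) φ = S φ - T φ := rfl
  rw [this, hS.2 φ hφ, hT.2 φ hφ, sub_self]

theorem IsFun.const_smul {T : 𝓢'(V, ℂ)} {f : V → ℂ} (hf : IsFun T f) (c : ℂ) :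
    IsFun (c • T) (fun x => c * f x) := by
  refine ⟨hf.1.smul c, fun φ hφ => ?_⟩
  have : (c • T) φ = c * T φ := rfl
  rw [this, hf.2 φ hφ, ← integral_const_mul]
  congr 1
  funext x
  ring

theorem IsFun.exists_stronglyMeasurable {T : 𝓢'(V, ℂ)} {f : V → ℂ} (hf : IsFun T f) :
    ∃ f' : V → ℂ, StronglyMeasurable f' ∧ f =ᵐ[volume] f' ∧ IsFun T f' :=
  ⟨_, hf.1.aestronglyMeasurable.stronglyMeasurable_mk, hf.1.aestronglyMeasurable.ae_eq_mk,
    hf.congr hf.1.aestronglyMeasurable.ae_eq_mk⟩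

/-- The dilation `φ ↦ φ(2π ·)`. -/
def dilation (V : Type*) [NormedAddCommGroup V] [InnerProductSpace ℝ V] :
    𝓢(V, ℂ) →L[ℂ] 𝓢(V, ℂ) :=
  SchwartzMap.compCLMOfContinuousLinearEquiv ℂ
    (ContinuousLinearEquiv.smulLeft (R₁ := ℝ) (M₁ := V)
      (Units.mk0 ((2 * Real.pi) : ℝ) (by positivity)))

theorem dilation_apply (φ : 𝓢(V, ℂ)) (x : V) : dilation V φ x = φ ((2 * Real.pi) • x) := rfl

theorem schwartzHat_eq_fourier (φ : 𝓢(V, ℂ)) (x : V) :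
    schwartzHat φ x = (𝓕 φ) ((2 * Real.pi)⁻¹ • x) := rfl

theorem dilation_schwartzHat (φ : 𝓢(V, ℂ)) : dilation V (schwartzHat φ) = 𝓕 φ := by
  ext x
  rw [dilation_apply, schwartzHat_eq_fourier, smul_smul,
    inv_mul_cancel₀ (by positivity : (2 * Real.pi) ≠ 0), one_smul]

theorem schwartzHat_fourierInv_dilation (φ : 𝓢(V, ℂ)) :
    schwartzHat (𝓕⁻ (dilation V φ)) = φ := by
  ext x
  rw [schwartzHat_eq_fourier, FourierTransform.fourier_fourierInv_eq, dilation_apply, smul_smul,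
    mul_inv_cancel₀ (by positivity : (2 * Real.pi) ≠ 0), one_smul]

theorem hat_injective : Function.Injective (hat : 𝓢'(V, ℂ) → 𝓢'(V, ℂ)) := by
  intro S T h
  ext φ
  have := congrArg (fun U : 𝓢'(V, ℂ) => U (𝓕⁻ (dilation V φ))) h
  simpa only [hat_apply, schwartzHat_fourierInv_dilation] using this

theorem hat_surjective : Function.Surjective (hat : 𝓢'(V, ℂ) → 𝓢'(V, ℂ)) := by
  intro S
  refine ⟨PointwiseConvergenceCLM.precomp ℂ
    (FourierTransform.fourierInvCLM ℂ 𝓢(V, ℂ) ∘L dilation V) S, ?_⟩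
  ext φ
  rw [hat_apply]
  change S (𝓕⁻ (dilation V (schwartzHat φ))) = S φ
  rw [dilation_schwartzHat, FourierTransform.fourierInv_fourier_eq]

theorem hat_smul (c : ℂ) (T : 𝓢'(V, ℂ)) : hat (c • T) = c • hat T := rfl

/-- Fourier inversion in the angular-frequency normalisation. -/
theorem schwartzHat_schwartzHat (φ : 𝓢(V, ℂ)) (x : V) :
    schwartzHat (schwartzHat φ) x = ((2 * Real.pi) ^ Module.finrank ℝ V : ℝ) * φ (-x) := by
  rw [schwartzHat_apply]
  have h := Measure.integral_comp_inv_smul (volume : Measure V)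
    (fun ξ => (𝓕 φ) ξ * Complex.exp (-(Complex.I * ((inner ℝ x ((2 * Real.pi) • ξ) : ℝ) : ℂ))))
    (2 * Real.pi)
  have e : ∀ ξ : V, (2 * Real.pi) • (2 * Real.pi)⁻¹ • ξ = ξ := fun ξ => by
    rw [smul_smul, mul_inv_cancel₀ (by positivity : (2 * Real.pi) ≠ 0), one_smul]
  simp only [e] at h
  simp only [schwartzHat_eq_fourier, h]
  rw [abs_of_pos (by positivity), Complex.real_smul]
  congr 1
  have h2 : φ (-x) = (𝓕⁻ (𝓕 φ)) (-x) := by rw [FourierTransform.fourierInv_fourier_eq]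
  rw [h2, SchwartzMap.fourierInv_coe, Real.fourierInv_eq']
  refine integral_congr_ae (Eventually.of_forall fun ξ => ?_)
  simp only [smul_eq_mul]
  rw [mul_comm]
  congr 2
  rw [inner_smul_right, inner_neg_right, real_inner_comm]
  push_cast
  ring

/-- Moving the dilation inside the transform lets `hat` of an L² function be expressed by the
unitary transform 𝓕 on L². -/
theorem schwartzHat_eq_smul_fourier_dilation (φ : 𝓢(V, ℂ)) :
    schwartzHat φ = (((2 * Real.pi) ^ Module.finrank ℝ V : ℝ) : ℂ) • 𝓕 (dilation V φ) := by
  ext y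
  rw [schwartzHat_apply, _root_.smul_apply, SchwartzMap.fourier_coe, Real.fourier_eq']
  have h := Measure.integral_comp_smul (volume : Measure V)
    (fun ξ => φ ξ * Complex.exp (-(Complex.I * ((inner ℝ y ξ : ℝ) : ℂ)))) (2 * Real.pi)
  rw [abs_of_pos (by positivity)] at h
  have h2 : ∫ v : V, Complex.exp (((-2 * Real.pi * inner ℝ v y : ℝ) : ℂ) * Complex.I) •
      (dilation V φ) v = ∫ v : V, φ ((2 * Real.pi) • v) *
        Complex.exp (-(Complex.I * ((inner ℝ y ((2 * Real.pi) • v) : ℝ) : ℂ))) := by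
    refine integral_congr_ae (Eventually.of_forall fun ξ => ?_)
    simp only [smul_eq_mul, dilation_apply]
    rw [mul_comm]
    congr 2
    rw [inner_smul_right, real_inner_comm]
    push_cast
    ring
  rw [h2, h, Complex.real_smul, smul_eq_mul, ← mul_assoc, ← Complex.ofReal_mul,
    mul_inv_cancel₀ (by positivity), Complex.ofReal_one, one_mul]

theorem hat_toTemperedDistribution_apply (F : Lp ℂ 2 (volume : Measure V)) (φ : 𝓢(V, ℂ)) :
    hat (Lp.toTemperedDistribution F) φ =
      ∫ x, φ x * (𝓕 F : Lp ℂ 2 (volume : Measure V)) ((2 * Real.pi)⁻¹ • x) := by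
  rw [hat_apply, schwartzHat_eq_smul_fourier_dilation, map_smul,
    ← TemperedDistribution.fourier_apply, Lp.fourier_toTemperedDistribution_eq,
    Lp.toTemperedDistribution_apply]
  have h := Measure.integral_comp_smul (volume : Measure V)
    (fun ξ => φ ξ * (𝓕 F : Lp ℂ 2 (volume : Measure V)) ((2 * Real.pi)⁻¹ • ξ)) (2 * Real.pi)
  have e : ∀ ξ : V, (2 * Real.pi)⁻¹ • (2 * Real.pi) • ξ = ξ := fun ξ => by
    rw [smul_smul, inv_mul_cancel₀ (by positivity : (2 * Real.pi) ≠ 0), one_smul]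
  simp only [e] at h
  simp only [dilation_apply, smul_eq_mul, h]
  rw [abs_of_pos (by positivity), Complex.real_smul, ← mul_assoc, ← Complex.ofReal_mul,
    mul_inv_cancel₀ (by positivity), Complex.ofReal_one, one_mul]

theorem memLp_comp_smul {H : V → ℂ} (hH : MemLp H 2 volume) {c : ℝ} (hc : 0 < c) :
    MemLp (fun x => H (c • x)) 2 volume := by
  have hm : (volume : Measure V).map (c • ·) =
      ENNReal.ofReal |(c ^ Module.finrank ℝ V)⁻¹| • volume :=
    Measure.map_addHaar_smul volume hc.ne'
  have h1 : MemLp H 2 ((volume : Measure V).map (c • ·)) := by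
    rw [hm]
    exact hH.smul_measure ENNReal.ofReal_ne_top
  exact h1.comp_of_map (measurable_const_smul c).aemeasurable

theorem lintegral_enorm_sq_comp_smul (H : V → ℂ) {c : ℝ} (hc : 0 < c) :
    ∫⁻ x, ‖H (c • x)‖ₑ ^ 2 =
      ENNReal.ofReal ((c ^ Module.finrank ℝ V)⁻¹) * ∫⁻ x, ‖H x‖ₑ ^ 2 := by
  have hm : (volume : Measure V).map (c • ·) =
      ENNReal.ofReal |(c ^ Module.finrank ℝ V)⁻¹| • volume :=
    Measure.map_addHaar_smul volume hc.ne'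
  have h2 := lintegral_map_equiv (μ := (volume : Measure V)) (fun x => ‖H x‖ₑ ^ 2)
    (Homeomorph.smulOfNeZero c hc.ne').toMeasurableEquiv
  simp only [Homeomorph.toMeasurableEquiv_coe, Homeomorph.smulOfNeZero_apply] at h2
  rw [← h2, hm, lintegral_smul_measure, abs_of_pos (by positivity), smul_eq_mul]

theorem Lp_enorm_sq (F : Lp ℂ 2 (volume : Measure V)) : ‖F‖ₑ ^ 2 = ∫⁻ x, ‖F x‖ₑ ^ 2 := by
  rw [Lp.enorm_def, eLpNorm_eq_lintegral_rpow_enorm_toReal two_ne_zero ENNReal.ofNat_ne_top]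
  simp only [ENNReal.toReal_ofNat, ENNReal.rpow_ofNat]
  rw [← ENNReal.rpow_natCast, ← ENNReal.rpow_mul]
  simp

/-- Plancherel's theorem for a distribution whose Fourier transform is a function. -/
theorem enorm_sq_of_isFun_hat {F : Lp ℂ 2 (volume : Measure V)} {H : V → ℂ}
    (h : IsFun (hat (Lp.toTemperedDistribution F)) H) :
    ‖F‖ₑ ^ 2 =
      ENNReal.ofReal (((2 * Real.pi) ^ Module.finrank ℝ V)⁻¹) * ∫⁻ x, ‖H x‖ₑ ^ 2 := by
  have hp : (0 : ℝ) < (2 * Real.pi)⁻¹ := by positivity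
  have h1 : IsFun (hat (Lp.toTemperedDistribution F))
      (fun x => (𝓕 F : Lp ℂ 2 (volume : Measure V)) ((2 * Real.pi)⁻¹ • x)) :=
    ⟨(memLp_comp_smul (Lp.memLp _) hp).locallyIntegrable one_le_two,
      fun φ _ => hat_toTemperedDistribution_apply F φ⟩
  have h2 : ∫⁻ x, ‖H x‖ₑ ^ 2 =
      ∫⁻ x, ‖(𝓕 F : Lp ℂ 2 (volume : Measure V)) ((2 * Real.pi)⁻¹ • x)‖ₑ ^ 2 := by
    refine lintegral_congr_ae ?_
    filter_upwards [h.ae_eq h1] with x hx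
    rw [hx]
  rw [h2, lintegral_enorm_sq_comp_smul (𝓕 F : Lp ℂ 2 (volume : Measure V)) hp, ← mul_assoc,
    ← ENNReal.ofReal_mul (by positivity), ← Lp_enorm_sq, ← ofReal_norm (𝓕 F),
    Lp.norm_fourier_eq, ofReal_norm, inv_pow, inv_inv,
    inv_mul_cancel₀ (by positivity), ENNReal.ofReal_one, one_mul]

theorem exists_isFun_hat_of_memLp {H : V → ℂ} (hH : MemLp H 2 volume) :
    ∃ F : Lp ℂ 2 (volume : Measure V), IsFun (hat (Lp.toTemperedDistribution F)) H := by
  have hp : (0 : ℝ) < 2 * Real.pi := by positivity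
  let K : Lp ℂ 2 (volume : Measure V) := (memLp_comp_smul hH hp).toLp
  refine ⟨𝓕⁻ K, hH.locallyIntegrable one_le_two, fun φ _ => ?_⟩
  rw [hat_toTemperedDistribution_apply, FourierTransform.fourier_fourierInv_eq]
  -- The L² class K is known only almost everywhere; dilations preserve null sets, so its
  -- representative may be evaluated at the dilated point.
  have hq : Measure.QuasiMeasurePreserving (fun x : V => (2 * Real.pi)⁻¹ • x) volume volume := by
    refine ⟨measurable_const_smul _, ?_⟩
    rw [show (volume : Measure V).map (fun x : V => (2 * Real.pi)⁻¹ • x) = _ from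
      Measure.map_addHaar_smul volume (inv_pos.2 hp).ne']
    exact Measure.AbsolutelyContinuous.rfl.smul_left _
  refine integral_congr_ae ?_
  filter_upwards [hq.ae_eq (memLp_comp_smul hH hp).coeFn_toLp] with x hx
  simp only [Function.comp_apply] at hx
  rw [show (K : V → ℂ) ((2 * Real.pi)⁻¹ • x) = _ from hx, smul_smul, mul_inv_cancel₀ hp.ne', one_smul]

end Fourier

/-! ### Spherical coordinates on pairs of frequencies over the output frequency -/

section Polar

variable {d : ℕ}

/-- The unit sphere of `ℝ^d`. -/
abbrev UnitSphere (d : ℕ) : Type := Metric.sphere (0 : Space d) 1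

/-- The surface measure of the unit sphere. -/
abbrev surface (d : ℕ) : Measure (UnitSphere d) := (volume : Measure (Space d)).toSphere

/-- `|ζ - η|` in terms of `z = (-(|ζ|² + |η|²), ζ + η)`. -/
def radius (z : SpaceTime d) : ℝ := √(-2 * z.fst - ‖z.snd‖ ^ 2)

/-- The case distinction matters for d = 2: the power is then 1 even where the square root is
truncated to 0, a region that contains no output frequency. -/
def radialDensity (z : SpaceTime d) : ℝ := if 0 < radius z then radius z ^ (d - 2) else 0

/-- The pair `(ζ, η)` with `ζ + η = ξ`, `|ζ|² + |η|² = -τ` and direction `θ` of `ζ - η`. -/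
def pairMap (p : SpaceTime d × UnitSphere d) : Space d × Space d :=
  ((2⁻¹ : ℝ) • (p.1.snd + radius p.1 • (p.2 : Space d)),
    (2⁻¹ : ℝ) • (p.1.snd - radius p.1 • (p.2 : Space d)))

/-- The factor 2^{-d} is the Jacobian of (ζ + η, ζ - η); the rest is r^{d-1} dr = r^{d-2} dτ. -/
def phaseMeasure (d : ℕ) : Measure (SpaceTime d) :=
  volume.withDensity fun z => ENNReal.ofReal ((2⁻¹ : ℝ) ^ d * radialDensity z)

/-- The space-time frequency of the product of the waves of frequencies `ζ` and `η`. -/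
def outputFrequency (p : Space d × Space d) : SpaceTime d :=
  WithLp.toLp 2 (-(‖p.1‖ ^ 2 + ‖p.2‖ ^ 2), p.1 + p.2)

theorem continuous_outputFrequency : Continuous (outputFrequency (d := d)) := by
  unfold outputFrequency
  exact (WithLp.prod_continuous_toLp 2 ℝ (Space d)).comp (by fun_prop)

theorem continuous_fst' : Continuous fun z : SpaceTime d => z.fst :=
  continuous_fst.comp (WithLp.prod_continuous_ofLp 2 ℝ (Space d))

theorem continuous_snd' : Continuous fun z : SpaceTime d => z.snd :=
  continuous_snd.comp (WithLp.prod_continuous_ofLp 2 ℝ (Space d))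

theorem continuous_radius : Continuous (radius (d := d)) := by
  unfold radius
  exact ((continuous_fst'.const_mul _).sub (continuous_snd'.norm.pow 2)).sqrt

theorem radius_nonneg (z : SpaceTime d) : 0 ≤ radius z := Real.sqrt_nonneg _

theorem measurable_radialDensity : Measurable (radialDensity (d := d)) :=
  Measurable.ite (measurableSet_lt measurable_const continuous_radius.measurable)
    (continuous_radius.measurable.pow_const _) measurable_const

theorem radialDensity_nonneg (z : SpaceTime d) : 0 ≤ radialDensity z := by
  unfold radialDensity
  split_ifs with h
  · positivity
  · exact le_rfl

theorem continuous_pairMap : Continuous (pairMap (d := d)) := by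
  unfold pairMap
  have h1 : Continuous fun p : SpaceTime d × UnitSphere d => p.1.snd :=
    continuous_snd'.comp continuous_fst
  have h2 : Continuous fun p : SpaceTime d × UnitSphere d => radius p.1 • (p.2 : Space d) :=
    (continuous_radius.comp continuous_fst).smul (continuous_subtype_val.comp continuous_snd)
  exact ((h1.add h2).const_smul (2⁻¹ : ℝ)).prodMk ((h1.sub h2).const_smul (2⁻¹ : ℝ))

theorem radius_sq {z : SpaceTime d} (hz : 0 < radius z) :
    radius z ^ 2 = -2 * z.fst - ‖z.snd‖ ^ 2 :=
  Real.sq_sqrt (Real.sqrt_pos.1 hz).le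

theorem norm_pairMap_sub (p : SpaceTime d × UnitSphere d) :
    ‖(pairMap p).1 - (pairMap p).2‖ = radius p.1 := by
  have : (pairMap p).1 - (pairMap p).2 = radius p.1 • (p.2 : Space d) := by
    simp only [pairMap]
    module
  rw [this, norm_smul, Real.norm_of_nonneg (radius_nonneg _), norm_eq_of_mem_sphere, mul_one]

theorem outputFrequency_pairMap {p : SpaceTime d × UnitSphere d} (hp : 0 < radius p.1) :
    outputFrequency (pairMap p) = p.1 := by
  have h1 : (pairMap p).1 + (pairMap p).2 = p.1.snd := by
    simp only [pairMap]
    module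
  have h2 := parallelogram_law_with_norm ℝ (pairMap p).1 (pairMap p).2
  rw [h1, norm_pairMap_sub] at h2
  have h3 := radius_sq hp
  have h4 : -(‖(pairMap p).1‖ ^ 2 + ‖(pairMap p).2‖ ^ 2) = p.1.fst := by nlinarith
  rw [outputFrequency, h1, h4]
  rfl

/-- Only translations and one dilation are needed: ζ = ω + η, then η = (ξ - ω)/2 with ω fixed. -/
theorem lintegral_sum_diff (K : Space d × Space d → ℝ≥0∞) (hK : Measurable K) :
    ∫⁻ p, K p = ENNReal.ofReal ((2⁻¹ : ℝ) ^ d) *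
      ∫⁻ ξ : Space d, ∫⁻ ω : Space d, K ((2⁻¹ : ℝ) • (ξ + ω), (2⁻¹ : ℝ) • (ξ - ω)) := by
  have hm2 : (volume : Measure (Space d)).map ((2⁻¹ : ℝ) • ·) =
      ENNReal.ofReal ((2 : ℝ) ^ d) • volume := by
    rw [Measure.map_addHaar_smul volume (by norm_num)]
    congr 2
    rw [finrank_euclideanSpace_fin, abs_of_pos (by positivity), inv_pow, inv_inv]
  have hscale : ∀ k : Space d → ℝ≥0∞, Measurable k →
      ∫⁻ y, k y = ENNReal.ofReal ((2⁻¹ : ℝ) ^ d) * ∫⁻ ξ, k ((2⁻¹ : ℝ) • ξ) := by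
    intro k hk
    rw [← lintegral_map hk (measurable_const_smul (2⁻¹ : ℝ)), hm2, lintegral_smul_measure,
      smul_eq_mul, ← mul_assoc, ← ENNReal.ofReal_mul (by positivity), ← mul_pow]
    norm_num
  rw [show (volume : Measure (Space d × Space d)) = volume.prod volume from rfl,
    lintegral_prod_symm' K hK]
  have h1 : ∀ η : Space d, ∫⁻ ζ, K (ζ, η) = ∫⁻ ω, K (ω + η, η) := fun η =>
    (lintegral_add_right_eq_self (fun ζ => K (ζ, η)) η).symm
  simp_rw [h1]
  rw [lintegral_lintegral_swap (by fun_prop)]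
  have h2 : ∀ ω : Space d, ∫⁻ η, K (ω + η, η) =
      ENNReal.ofReal ((2⁻¹ : ℝ) ^ d) * ∫⁻ ξ, K ((2⁻¹ : ℝ) • (ξ + ω), (2⁻¹ : ℝ) • (ξ - ω)) := by
    intro ω
    rw [← lintegral_sub_right_eq_self (fun η => K (ω + η, η)) ((2⁻¹ : ℝ) • ω),
      hscale _ (by fun_prop)]
    congr 2
    funext ξ
    congr 2 <;> module
  simp_rw [h2]
  rw [lintegral_const_mul _ (by fun_prop), lintegral_lintegral_swap (by fun_prop)]

theorem lintegral_polar (hd : 2 ≤ d) (k : Space d → ℝ≥0∞) (hk : Measurable k) :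
    ∫⁻ ω, k ω = ∫⁻ r in Set.Ioi (0 : ℝ), ENNReal.ofReal (r ^ (d - 1)) *
      ∫⁻ θ : UnitSphere d, k (r • (θ : Space d)) ∂surface d := by
  have : Nontrivial (Space d) := by
    have : Nonempty (Fin d) := ⟨⟨0, by omega⟩⟩
    infer_instance
  have h0 : ∫⁻ ω, k ω = ∫⁻ ω : ({0}ᶜ : Set (Space d)), k ω
      ∂((volume : Measure (Space d)).comap (↑)) := by
    rw [lintegral_subtype_comap (measurableSet_singleton _).compl, restrict_compl_singleton]
  have hmp := (volume : Measure (Space d)).measurePreserving_homeomorphUnitSphereProd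
  have h1 := hmp.lintegral_comp_emb (Homeomorph.measurableEmbedding _)
    (fun q : UnitSphere d × Set.Ioi (0 : ℝ) => k ((q.2 : ℝ) • (q.1 : Space d)))
  have h2 : ∀ ω : ({0}ᶜ : Set (Space d)),
      ((homeomorphUnitSphereProd (Space d) ω).2 : ℝ) •
        ((homeomorphUnitSphereProd (Space d) ω).1 : Space d) = ω := by
    intro ω
    simp only [homeomorphUnitSphereProd_apply_snd_coe, homeomorphUnitSphereProd_apply_fst_coe]
    rw [smul_smul, mul_inv_cancel₀ (norm_ne_zero_iff.2 ω.2), one_smul]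
  simp only [h2] at h1
  have hkm : Measurable fun q : UnitSphere d × ℝ => k (q.2 • (q.1 : Space d)) :=
    hk.comp (measurable_snd.smul (measurable_subtype_coe.comp measurable_fst))
  have hkm' : Measurable fun q : UnitSphere d × Set.Ioi (0 : ℝ) =>
      k ((q.2 : ℝ) • (q.1 : Space d)) :=
    hk.comp ((measurable_subtype_coe.comp measurable_snd).smul
      (measurable_subtype_coe.comp measurable_fst))
  rw [h0, h1, lintegral_prod_symm' _ hkm', finrank_euclideanSpace_fin, Measure.volumeIoiPow,
    lintegral_withDensity_eq_lintegral_mul _ (by fun_prop) hkm'.lintegral_prod_left']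
  exact lintegral_subtype_comap measurableSet_Ioi fun r : ℝ => ENNReal.ofReal (r ^ (d - 1)) *
      ∫⁻ θ : UnitSphere d, k (r • (θ : Space d)) ∂surface d

theorem radius_toLp (τ : ℝ) (ξ : Space d) :
    radius (WithLp.toLp 2 (τ, ξ)) = √(-2 * τ - ‖ξ‖ ^ 2) := rfl

/-- The substitution τ = -(|ξ|² + r²)/2, for which |dτ| = r dr, trades the radius for the temporal
frequency. -/
theorem lintegral_radius (hd : 2 ≤ d) (ξ : Space d) (k : ℝ → ℝ≥0∞) :
    ∫⁻ r in Set.Ioi (0 : ℝ), ENNReal.ofReal (r ^ (d - 1)) * k r =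
      ∫⁻ τ : ℝ, ENNReal.ofReal (radialDensity (WithLp.toLp 2 (τ, ξ) : SpaceTime d)) *
        k (radius (WithLp.toLp 2 (τ, ξ) : SpaceTime d)) := by
  let φ : ℝ → ℝ := fun r => -(‖ξ‖ ^ 2 + r ^ 2) / 2
  have hφ : ∀ r ∈ Set.Ioi (0 : ℝ), HasDerivWithinAt φ (-r) (Set.Ioi 0) r := by
    intro r _
    have h : HasDerivAt φ _ r :=
      (((hasDerivAt_pow 2 r).const_add (‖ξ‖ ^ 2)).neg).div_const 2
    have e : -((2 : ℕ) * r ^ (2 - 1)) / 2 = -r := by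
      push_cast
      ring
    rw [e] at h
    exact h.hasDerivWithinAt
  have hinj : Set.InjOn φ (Set.Ioi 0) := by
    intro a ha b hb hab
    have ha' : 0 < a := ha
    have hb' : 0 < b := hb
    have : a ^ 2 = b ^ 2 := by
      simp only [φ] at hab
      linarith
    exact (pow_left_inj₀ ha'.le hb'.le two_ne_zero).1 this
  have hr : ∀ r ∈ Set.Ioi (0 : ℝ), radius (WithLp.toLp 2 (φ r, ξ) : SpaceTime d) = r := by
    intro r hr
    rw [radius_toLp, show -2 * φ r - ‖ξ‖ ^ 2 = r ^ 2 by simp only [φ]; ring,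
      Real.sqrt_sq (le_of_lt hr)]
  have himg : φ '' Set.Ioi 0 = {τ : ℝ | 0 < radius (WithLp.toLp 2 (τ, ξ) : SpaceTime d)} := by
    ext τ
    constructor
    · rintro ⟨r, hr', rfl⟩
      rw [Set.mem_ofPred_eq, hr r hr']
      exact hr'
    · intro hτ
      refine ⟨_, hτ, ?_⟩
      have := radius_sq (d := d) hτ
      simp only [φ, this]
      change -(‖ξ‖ ^ 2 + (-2 * τ - ‖ξ‖ ^ 2)) / 2 = τ
      ring
  have hms : MeasurableSet {τ : ℝ | 0 < radius (WithLp.toLp 2 (τ, ξ) : SpaceTime d)} := by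
    simp only [radius_toLp]
    exact measurableSet_lt measurable_const (by fun_prop)
  have h1 := lintegral_image_eq_lintegral_abs_deriv_mul measurableSet_Ioi hφ hinj
    (fun τ => ENNReal.ofReal (radialDensity (WithLp.toLp 2 (τ, ξ) : SpaceTime d)) *
        k (radius (WithLp.toLp 2 (τ, ξ) : SpaceTime d)))
  rw [himg, ← lintegral_indicator hms] at h1
  have h2 : ∀ τ : ℝ, Set.indicator {τ : ℝ | 0 < radius (WithLp.toLp 2 (τ, ξ) : SpaceTime d)}
      (fun τ => ENNReal.ofReal (radialDensity (WithLp.toLp 2 (τ, ξ) : SpaceTime d)) *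
        k (radius (WithLp.toLp 2 (τ, ξ) : SpaceTime d))) τ =
      ENNReal.ofReal (radialDensity (WithLp.toLp 2 (τ, ξ) : SpaceTime d)) *
        k (radius (WithLp.toLp 2 (τ, ξ) : SpaceTime d)) := by
    intro τ
    by_cases h : 0 < radius (WithLp.toLp 2 (τ, ξ) : SpaceTime d)
    · rw [Set.indicator_of_mem (by exact h)]
    · rw [Set.indicator_of_notMem (by exact h), radialDensity, if_neg h]
      simp
  simp only [h2] at h1
  rw [h1]
  refine setLIntegral_congr_fun measurableSet_Ioi fun r hr' => ?_
  have hr0 : 0 < r := hr'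
  simp only [radialDensity, hr r hr', hr0, if_true, abs_neg, abs_of_pos hr0]
  rw [← mul_assoc, ← ENNReal.ofReal_mul hr0.le, ← pow_succ', show d - 2 + 1 = d - 1 by omega]

theorem lintegral_pairMap (hd : 2 ≤ d) (K : Space d × Space d → ℝ≥0∞) (hK : Measurable K) :
    ∫⁻ p, K p = ∫⁻ q, K (pairMap q) ∂((phaseMeasure d).prod (surface d)) := by
  have hKm : Measurable fun q : SpaceTime d × UnitSphere d => K (pairMap q) :=
    hK.comp continuous_pairMap.measurable
  have hint : Measurable fun z : SpaceTime d => ∫⁻ θ, K (pairMap (z, θ)) ∂surface d :=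
    hKm.lintegral_prod_right'
  have hden : Measurable fun z : SpaceTime d =>
      ENNReal.ofReal ((2⁻¹ : ℝ) ^ d * radialDensity z) :=
    (measurable_radialDensity.const_mul _).ennreal_ofReal
  have : SFinite (phaseMeasure d) := by
    unfold phaseMeasure
    infer_instance
  rw [lintegral_prod _ hKm.aemeasurable, phaseMeasure,
    lintegral_withDensity_eq_lintegral_mul _ hden hint, lintegral_sum_diff K hK]
  have hmp := WithLp.volume_preserving_toLp ℝ (Space d)
  have htot : Measurable fun z : SpaceTime d =>
      ENNReal.ofReal (radialDensity z) * ∫⁻ θ, K (pairMap (z, θ)) ∂surface d :=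
    measurable_radialDensity.ennreal_ofReal.mul hint
  have hfac : ∀ z : SpaceTime d, ((fun z : SpaceTime d =>
      ENNReal.ofReal ((2⁻¹ : ℝ) ^ d * radialDensity z)) *
      fun z => ∫⁻ θ, K (pairMap (z, θ)) ∂surface d) z =
      ENNReal.ofReal ((2⁻¹ : ℝ) ^ d) * (ENNReal.ofReal (radialDensity z) *
        ∫⁻ θ, K (pairMap (z, θ)) ∂surface d) := by
    intro z
    rw [Pi.mul_apply, ENNReal.ofReal_mul (by positivity), mul_assoc]
  simp only [hfac]
  rw [lintegral_const_mul _ htot, ← hmp.lintegral_comp htot,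
    show (volume : Measure (ℝ × Space d)) = volume.prod volume from rfl,
    lintegral_prod_symm' (fun a : ℝ × Space d => ENNReal.ofReal
      (radialDensity (WithLp.toLp 2 a : SpaceTime d)) *
        ∫⁻ θ, K (pairMap (WithLp.toLp 2 a, θ)) ∂surface d) (htot.comp hmp.measurable)]
  congr 1
  refine lintegral_congr fun ξ => ?_
  rw [lintegral_polar hd _ (by fun_prop),
    lintegral_radius hd ξ (fun r => ∫⁻ θ : UnitSphere d,
      K ((2⁻¹ : ℝ) • (ξ + r • (θ : Space d)), (2⁻¹ : ℝ) • (ξ - r • (θ : Space d))) ∂surface d)]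
  rfl

instance : SFinite (phaseMeasure d) := by
  unfold phaseMeasure
  infer_instance

theorem measurePreserving_pairMap (hd : 2 ≤ d) :
    MeasurePreserving (pairMap (d := d)) ((phaseMeasure d).prod (surface d)) volume := by
  refine ⟨continuous_pairMap.measurable, ?_⟩
  ext s hs
  rw [← lintegral_indicator_one hs, ← lintegral_indicator_one hs,
    lintegral_map (measurable_one.indicator hs) continuous_pairMap.measurable,
    lintegral_pairMap hd _ (measurable_one.indicator hs)]

theorem ae_radius_pos : ∀ᵐ z ∂phaseMeasure d, 0 < radius z := by
  have hden : Measurable fun z : SpaceTime d =>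
      ENNReal.ofReal ((2⁻¹ : ℝ) ^ d * radialDensity z) :=
    (measurable_radialDensity.const_mul _).ennreal_ofReal
  rw [phaseMeasure, ae_withDensity_iff hden]
  refine Eventually.of_forall fun z hz => ?_
  by_contra h
  apply hz
  rw [radialDensity, if_neg h]
  simp

/-- The integral over pairs of frequencies, by the frequency of the product. -/
theorem lintegral_eq_lintegral_fiber (hd : 2 ≤ d) (K : Space d × Space d → ℝ≥0∞)
    (hK : Measurable K) (k : SpaceTime d → ℝ≥0∞) (hk : Measurable k) :
    ∫⁻ p, K p * k (outputFrequency p) =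
      ∫⁻ z, (∫⁻ θ, K (pairMap (z, θ)) ∂surface d) * k z ∂phaseMeasure d := by
  have h1 : Measurable fun p => K p * k (outputFrequency p) :=
    hK.mul (hk.comp continuous_outputFrequency.measurable)
  rw [lintegral_pairMap hd _ h1, 
    lintegral_prod (fun q => K (pairMap q) * k (outputFrequency (pairMap q)))
      (h1.comp continuous_pairMap.measurable).aemeasurable]
  refine lintegral_congr_ae ?_
  filter_upwards [ae_radius_pos] with z hz
  have h2 : ∀ θ : UnitSphere d, outputFrequency (pairMap (z, θ)) = z := fun θ =>
    outputFrequency_pairMap (p := (z, θ)) hz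
  simp only [h2]
  have h3 : Measurable fun θ : UnitSphere d => K (pairMap (z, θ)) :=
    hK.comp (continuous_pairMap.comp (Continuous.prodMk_right z)).measurable
  rw [lintegral_mul_const _ h3]

end Polar

/-! ### Polynomial growth of data of finite energy -/

section Growth

variable {d : ℕ}

theorem exists_lintegral_closedBall_pos {g : Space d → ℂ} (hg : Measurable g)
    (h0 : ¬ g =ᵐ[volume] 0) :
    ∃ R : ℝ, 0 < R ∧ ∫⁻ η in Metric.closedBall (0 : Space d) R, ‖g η‖ₑ ^ 2 ≠ 0 := by
  by_contra! h
  apply h0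
  have h1 : ∀ n : ℕ, ∀ᵐ η ∂volume, η ∈ Metric.closedBall (0 : Space d) ((n : ℝ) + 1) →
      ‖g η‖ₑ ^ 2 = 0 := by
    intro n
    have := h ((n : ℝ) + 1) (by positivity)
    rw [lintegral_eq_zero_iff (by fun_prop)] at this
    exact (ae_restrict_iff' measurableSet_closedBall).1 this
  filter_upwards [ae_all_iff.2 h1] with η hη
  obtain ⟨n, hn⟩ := exists_nat_ge ‖η‖
  have := hη n (by rw [mem_closedBall_zero_iff]; linarith)
  simpa using this

/-- Here |ζ - η| lies between 1 and (1 + R)(1 + |ζ|), which bounds its powers from below whatever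
the sign of γ. -/
theorem rpow_neg_two_mul_le {R γ : ℝ} (hR : 0 < R) {m : ℕ} (hm : |γ| ≤ 2 * m)
    {ζ η : Space d} (hη : ‖η‖ ≤ R) (hζ : R + 1 ≤ ‖ζ‖) :
    (((1 + R) * (1 + ‖ζ‖)) ^ (2 * m))⁻¹ ≤ ‖ζ - η‖ ^ γ := by
  have h1 : 1 ≤ ‖ζ - η‖ := by
    have := norm_sub_norm_le ζ η
    linarith
  have h2 : ‖ζ - η‖ ≤ (1 + R) * (1 + ‖ζ‖) := by
    have := norm_sub_le ζ η
    nlinarith [norm_nonneg ζ]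
  have hm' := abs_le.1 hm
  calc (((1 + R) * (1 + ‖ζ‖)) ^ (2 * m))⁻¹ ≤ (‖ζ - η‖ ^ (2 * m))⁻¹ := by gcongr
    _ = ‖ζ - η‖ ^ (-((2 * m : ℕ) : ℝ)) := by
      rw [Real.rpow_neg (by positivity), Real.rpow_natCast]
    _ ≤ ‖ζ - η‖ ^ γ := by
      refine Real.rpow_le_rpow_of_exponent_le h1 ?_
      push_cast
      linarith

/-- Finite interaction with a nonzero function forces polynomial growth on average. -/
theorem integrable_div_of_lintegral_lt_top {f g : Space d → ℂ} (hf : Measurable f)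
    (hg : Measurable g) (hfl : LocallyIntegrable f volume) (h0 : ¬ g =ᵐ[volume] 0)
    {γ : ℝ} {m : ℕ} (hm : |γ| ≤ 2 * m)
    (hE : ∫⁻ ζ, ∫⁻ η, ‖f ζ‖ₑ ^ 2 * ‖g η‖ₑ ^ 2 * ENNReal.ofReal (‖ζ - η‖ ^ γ) < ∞) :
    Integrable fun ζ => f ζ * ((((1 + ‖ζ‖) ^ (m + d + 1))⁻¹ : ℝ) : ℂ) := by
  obtain ⟨R, hR, hA⟩ := exists_lintegral_closedBall_pos hg h0
  set c : ℝ≥0∞ := ∫⁻ η in Metric.closedBall (0 : Space d) R, ‖g η‖ₑ ^ 2 with hc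
  set S : Set (Space d) := {ζ | R + 1 ≤ ‖ζ‖} with hS
  have hSm : MeasurableSet S := measurableSet_le measurable_const measurable_norm
  have hw : ∀ ζ : Space d, (0 : ℝ) < ((1 + R) * (1 + ‖ζ‖)) ^ (2 * m) := fun ζ => by positivity
  -- Restricting η to a ball that carries a positive mass c of |g|² bounds c times this integral by
  -- the energy.
  have hfar : ∫⁻ ζ in S, ‖f ζ‖ₑ ^ 2 *
      ENNReal.ofReal ((((1 + R) * (1 + ‖ζ‖)) ^ (2 * m))⁻¹) < ∞ := by
    refine ENNReal.lt_top_of_mul_ne_top_right (a := c) (ne_of_lt (lt_of_le_of_lt ?_ hE)) hA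
    have hmeas : Measurable fun ζ : Space d => ‖f ζ‖ₑ ^ 2 *
        ENNReal.ofReal ((((1 + R) * (1 + ‖ζ‖)) ^ (2 * m))⁻¹) := by fun_prop
    rw [← lintegral_const_mul _ hmeas]
    refine (setLIntegral_mono' hSm fun ζ hζ => ?_).trans (setLIntegral_le_lintegral S _)
    rw [hc, ← lintegral_mul_const _ (by fun_prop)]
    refine (setLIntegral_mono' measurableSet_closedBall fun η hη => ?_).trans
      (setLIntegral_le_lintegral (Metric.closedBall (0 : Space d) R) _)
    calc ‖g η‖ₑ ^ 2 * (‖f ζ‖ₑ ^ 2 * ENNReal.ofReal ((((1 + R) * (1 + ‖ζ‖)) ^ (2 * m))⁻¹))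
        = ‖f ζ‖ₑ ^ 2 * ‖g η‖ₑ ^ 2 *
          ENNReal.ofReal ((((1 + R) * (1 + ‖ζ‖)) ^ (2 * m))⁻¹) := by ring
      _ ≤ _ := by
        gcongr
        exact rpow_neg_two_mul_le hR hm (by simpa using hη) hζ
  have hmeasC : Measurable fun ζ : Space d => f ζ * ((((1 + ‖ζ‖) ^ (m + d + 1))⁻¹ : ℝ) : ℂ) := by
    fun_prop
  have hnear : IntegrableOn (fun ζ => f ζ * ((((1 + ‖ζ‖) ^ (m + d + 1))⁻¹ : ℝ) : ℂ)) Sᶜ := by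
    have hb : IntegrableOn f (Metric.closedBall 0 (R + 1)) :=
      hfl.integrableOn_isCompact (isCompact_closedBall _ _)
    have hsub : Sᶜ ⊆ Metric.closedBall (0 : Space d) (R + 1) := by
      intro ζ hζ
      rw [mem_closedBall_zero_iff]
      exact (not_le.1 (show ¬ R + 1 ≤ ‖ζ‖ from hζ)).le
    refine Integrable.mono (hb.mono_set hsub) hmeasC.aestronglyMeasurable
      (Eventually.of_forall fun ζ => ?_)
    rw [norm_mul]
    refine mul_le_of_le_one_right (norm_nonneg _) ?_
    rw [Complex.norm_real, Real.norm_of_nonneg (by positivity)]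
    exact inv_le_one_of_one_le₀ (one_le_pow₀ (by linarith [norm_nonneg ζ]))
  have hfar' : IntegrableOn (fun ζ => f ζ * ((((1 + ‖ζ‖) ^ (m + d + 1))⁻¹ : ℝ) : ℂ)) S := by
    have hsq : IntegrableOn (fun ζ : Space d =>
        ‖f ζ‖ ^ 2 * (((1 + R) * (1 + ‖ζ‖)) ^ (2 * m))⁻¹) S := by
      refine ⟨(by fun_prop : Measurable _).aestronglyMeasurable, ?_⟩
      refine lt_of_le_of_lt (lintegral_mono fun ζ => ?_) hfar
      rw [Real.enorm_eq_ofReal (by positivity), ENNReal.ofReal_mul (by positivity),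
        ENNReal.ofReal_pow (norm_nonneg _), ofReal_norm]
    have hdec : Integrable (fun ζ : Space d => (1 + ‖ζ‖) ^ (-((d : ℝ) + 1))) :=
      integrable_one_add_norm (by simp)
    -- With A = |f|(1 + |ζ|)^{-m} and B = (1 + |ζ|)^{-(d+1)} ≤ 1, the integrand has modulus AB ≤ A²
    -- + B. The energy controls A², and B is integrable since d + 1 > d.
    refine Integrable.mono' ((hsq.const_mul ((1 + R) ^ (2 * m))).add hdec.integrableOn)
      hmeasC.aestronglyMeasurable (Eventually.of_forall fun ζ => ?_)
    have hpos : (0 : ℝ) < 1 + ‖ζ‖ := by positivity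
    have hone : (1 : ℝ) ≤ 1 + ‖ζ‖ := by linarith [norm_nonneg ζ]
    have e1 : (1 + R) ^ (2 * m) * (‖f ζ‖ ^ 2 * (((1 + R) * (1 + ‖ζ‖)) ^ (2 * m))⁻¹) =
        (‖f ζ‖ * ((1 + ‖ζ‖) ^ m)⁻¹) ^ 2 := by
      rw [mul_pow (1 + R), mul_inv, mul_pow, inv_pow, ← pow_mul, mul_comm m 2]
      have : (1 + R) ^ (2 * m) ≠ 0 := by positivity
      field_simp
    have e2 : (1 + ‖ζ‖) ^ (-((d : ℝ) + 1)) = ((1 + ‖ζ‖) ^ (d + 1))⁻¹ := by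
      rw [Real.rpow_neg hpos.le, ← Nat.cast_succ, Real.rpow_natCast]
    rw [Pi.add_apply, e1, e2, norm_mul, Complex.norm_real, Real.norm_of_nonneg (by positivity),
      add_assoc m, pow_add, mul_inv, ← mul_assoc]
    have hb0 : 0 ≤ ((1 + ‖ζ‖) ^ (d + 1))⁻¹ := by positivity
    have hb1 : ((1 + ‖ζ‖) ^ (d + 1))⁻¹ ≤ 1 := inv_le_one_of_one_le₀ (one_le_pow₀ hone)
    nlinarith [sq_nonneg (‖f ζ‖ * ((1 + ‖ζ‖) ^ m)⁻¹ - ((1 + ‖ζ‖) ^ (d + 1))⁻¹),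
      sq_nonneg (‖f ζ‖ * ((1 + ‖ζ‖) ^ m)⁻¹)]
  exact integrableOn_univ.1 (Set.union_compl_self S ▸ hfar'.union hnear)

/-- The energy of a pair of functions on the Fourier side. -/
def energyIntegral (γ : ℝ) (f g : Space d → ℂ) : ℝ≥0∞ :=
  ∫⁻ p : Space d × Space d,
    ‖f p.1‖ₑ ^ 2 * ‖g p.2‖ₑ ^ 2 * ENNReal.ofReal (‖p.1 - p.2‖ ^ γ)

theorem measurable_energy_integrand {f g : Space d → ℂ} (hf : Measurable f) (hg : Measurable g)
    (γ : ℝ) : Measurable fun p : Space d × Space d =>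
      ‖f p.1‖ₑ ^ 2 * ‖g p.2‖ₑ ^ 2 * ENNReal.ofReal (‖p.1 - p.2‖ ^ γ) := by
  fun_prop

/-- Separate polynomial growth of the two factors of finite energy. -/
theorem integrable_div_of_energyIntegral_lt_top {f g : Space d → ℂ} (hf : Measurable f)
    (hg : Measurable g) (hfl : LocallyIntegrable f volume) (hgl : LocallyIntegrable g volume)
    (hf0 : ¬ f =ᵐ[volume] 0) (hg0 : ¬ g =ᵐ[volume] 0)
    {γ : ℝ} {m : ℕ} (hm : |γ| ≤ 2 * m) (hE : energyIntegral γ f g < ∞) :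
    (Integrable fun ζ => f ζ * ((((1 + ‖ζ‖) ^ (m + d + 1))⁻¹ : ℝ) : ℂ)) ∧
    Integrable fun ζ => g ζ * ((((1 + ‖ζ‖) ^ (m + d + 1))⁻¹ : ℝ) : ℂ) := by
  have hmeas := measurable_energy_integrand hf hg γ
  have hv : (volume : Measure (Space d × Space d)) = volume.prod volume := rfl
  constructor
  · refine integrable_div_of_lintegral_lt_top hf hg hfl hg0 hm ?_
    rwa [energyIntegral, hv, lintegral_prod _ hmeas.aemeasurable] at hE
  · refine integrable_div_of_lintegral_lt_top hg hf hgl hf0 hm ?_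
    rw [energyIntegral, hv, lintegral_prod_symm' _ hmeas] at hE
    refine lt_of_eq_of_lt (lintegral_congr fun η => lintegral_congr fun ζ => ?_) hE
    rw [mul_comm (‖g η‖ₑ ^ 2), norm_sub_rev]

/-- The weight `((1 + |ζ|) (1 + |η|))^N`. -/
def pairWeight (N : ℕ) (p : Space d × Space d) : ℝ := ((1 + ‖p.1‖) * (1 + ‖p.2‖)) ^ N

theorem pairWeight_pos (N : ℕ) (p : Space d × Space d) : 0 < pairWeight N p := by
  unfold pairWeight
  positivity

theorem continuous_pairWeight (N : ℕ) : Continuous (pairWeight (d := d) N) := by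
  unfold pairWeight
  fun_prop

/-- The energy controls the growth of a factor only if the other one is nonzero. If one vanishes, so
does the product, however fast the other grows. -/
theorem exists_integrable_mul_div_pairWeight {f g : Space d → ℂ} (hf : Measurable f)
    (hg : Measurable g) (hfl : LocallyIntegrable f volume) (hgl : LocallyIntegrable g volume)
    {γ : ℝ} (hE : energyIntegral γ f g < ∞) :
    ∃ N : ℕ, Integrable fun p : Space d × Space d =>
      f p.1 * g p.2 * (((pairWeight N p)⁻¹ : ℝ) : ℂ) := by
  by_cases hf0 : f =ᵐ[volume] 0
  · refine ⟨0, (integrable_zero _ _ _).congr ?_⟩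
    have := Measure.quasiMeasurePreserving_fst (μ := (volume : Measure (Space d)))
      (ν := (volume : Measure (Space d))).ae_eq hf0
    filter_upwards [this] with p hp
    simp only [Function.comp_apply, Pi.zero_apply] at hp
    simp [hp]
  by_cases hg0 : g =ᵐ[volume] 0
  · refine ⟨0, (integrable_zero _ _ _).congr ?_⟩
    have := Measure.quasiMeasurePreserving_snd (μ := (volume : Measure (Space d)))
      (ν := (volume : Measure (Space d))).ae_eq hg0
    filter_upwards [this] with p hp
    simp only [Function.comp_apply, Pi.zero_apply] at hp
    simp [hp]
  obtain ⟨m, hm⟩ := exists_nat_ge |γ|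
  have hm' : |γ| ≤ 2 * m := by linarith [(Nat.cast_nonneg m : (0 : ℝ) ≤ m)]
  obtain ⟨h1, h2⟩ := integrable_div_of_energyIntegral_lt_top hf hg hfl hgl hf0 hg0 hm' hE
  refine ⟨m + d + 1, (h1.mul_prod h2).congr (Eventually.of_forall fun p => ?_)⟩
  simp only [pairWeight, mul_pow, mul_inv]
  push_cast
  ring

end Growth

/-! ### Functions integrable against a polynomial weight as distributions -/

section FunctionsOfTemperedGrowth

variable {V : Type*} [NormedAddCommGroup V] [InnerProductSpace ℝ V] [FiniteDimensional ℝ V]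
  [MeasurableSpace V] [BorelSpace V]

theorem exists_one_add_norm_pow_mul_le (V : Type*) [NormedAddCommGroup V] [InnerProductSpace ℝ V]
    (N : ℕ) :
    ∃ (s : Finset (ℕ × ℕ)) (C : ℝ), 0 ≤ C ∧ ∀ (φ : 𝓢(V, ℂ)) (x : V),
      (1 + ‖x‖) ^ N * ‖φ x‖ ≤ C * s.sup (schwartzSeminormFamily ℂ V ℂ) φ := by
  refine ⟨Finset.Iic (N, 0), 2 ^ N, by positivity, fun φ x => ?_⟩
  have := SchwartzMap.one_add_le_sup_seminorm_apply (𝕜 := ℂ) (m := (N, 0)) le_rfl le_rfl φ x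
  rw [norm_iteratedFDeriv_zero] at this
  exact this

theorem integrable_schwartz_mul {G : V → ℂ} {N : ℕ}
    (hG : Integrable fun z => G z * ((((1 + ‖z‖) ^ N)⁻¹ : ℝ) : ℂ)) (φ : 𝓢(V, ℂ)) :
    Integrable fun z => φ z * G z := by
  obtain ⟨s, C, hC, h⟩ := exists_one_add_norm_pow_mul_le V N
  have hc : Continuous fun z : V => φ z * (((1 + ‖z‖) ^ N : ℝ) : ℂ) := by fun_prop
  refine (hG.bdd_mul hc.aestronglyMeasurable (c := C * s.sup (schwartzSeminormFamily ℂ V ℂ) φ)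
    (Eventually.of_forall fun z => ?_)).congr (Eventually.of_forall fun z => ?_)
  · rw [norm_mul, mul_comm, Complex.norm_real, Real.norm_of_nonneg (by positivity)]
    exact h φ z
  · have : (((1 + ‖z‖) ^ N : ℝ) : ℂ) ≠ 0 := by
      exact_mod_cast (by positivity : (1 + ‖z‖) ^ N ≠ 0)
    push_cast at this ⊢
    field_simp

theorem exists_distribution_of_integrable_div {G : V → ℂ} {N : ℕ}
    (hG : Integrable fun z => G z * ((((1 + ‖z‖) ^ N)⁻¹ : ℝ) : ℂ)) :
    ∃ S : 𝓢'(V, ℂ), ∀ φ : 𝓢(V, ℂ), S φ = ∫ z, φ z * G z := by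
  refine ⟨ContinuousLinearMap.toPointwiseConvergenceCLM _ _ _ _ (SchwartzMap.mkCLMtoNormedSpace (σ := RingHom.id ℂ)
    (fun φ : 𝓢(V, ℂ) => ∫ z, φ z * G z) (fun φ ψ => ?_) (fun a φ => ?_) ?_), fun φ => rfl⟩
  · rw [← integral_add (integrable_schwartz_mul hG φ) (integrable_schwartz_mul hG ψ)]
    congr 1
    funext z
    rw [_root_.add_apply, add_mul]
  · rw [RingHom.id_apply, smul_eq_mul, ← integral_const_mul]
    congr 1
    funext z
    rw [_root_.smul_apply, smul_eq_mul, mul_assoc]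
  · obtain ⟨s, C, hC, h⟩ := exists_one_add_norm_pow_mul_le V N
    refine ⟨s, C * ∫ z, ‖G z * ((((1 + ‖z‖) ^ N)⁻¹ : ℝ) : ℂ)‖, by positivity, fun φ => ?_⟩
    rw [mul_right_comm, ← integral_const_mul]
    refine norm_integral_le_of_norm_le (hG.norm.const_mul _) (Eventually.of_forall fun z => ?_)
    rw [norm_mul, norm_mul, Complex.norm_real, Real.norm_of_nonneg (by positivity)]
    have h1 := h φ z
    have h2 : (0 : ℝ) < (1 + ‖z‖) ^ N := by positivity
    calc ‖φ z‖ * ‖G z‖ = ((1 + ‖z‖) ^ N * ‖φ z‖) * (‖G z‖ * ((1 + ‖z‖) ^ N)⁻¹) := by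
          field_simp
      _ ≤ _ := by gcongr

theorem locallyIntegrable_of_integrable_div {G : V → ℂ} {N : ℕ}
    (hG : Integrable fun z => G z * ((((1 + ‖z‖) ^ N)⁻¹ : ℝ) : ℂ)) :
    LocallyIntegrable G volume := by
  have hc : Continuous fun z : V => (((1 + ‖z‖) ^ N : ℝ) : ℂ) := by fun_prop
  have h : LocallyIntegrable (fun z => (((1 + ‖z‖) ^ N : ℝ) : ℂ) *
      (G z * ((((1 + ‖z‖) ^ N)⁻¹ : ℝ) : ℂ))) volume := by
    have := hG.locallyIntegrable.locallyIntegrableOn Set.univ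
    exact locallyIntegrableOn_univ.1
      (this.continuousOn_mul hc.continuousOn isOpen_univ.isLocallyClosed)
  refine h.congr (Eventually.of_forall fun z => ?_)
  have : (((1 + ‖z‖) ^ N : ℝ) : ℂ) ≠ 0 := by
    exact_mod_cast (by positivity : (1 + ‖z‖) ^ N ≠ 0)
  push_cast at this ⊢
  field_simp

end FunctionsOfTemperedGrowth

/-! ### The space-time Fourier transform of the product -/

section Product

variable {d : ℕ}

/-- The output frequency is at least |ζ|² + |η|² in norm, so decay in it gives decay in both
frequencies, in all directions of ℝ^{2d}. -/
theorem pairWeight_le (N : ℕ) (p : Space d × Space d) :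
    pairWeight N p ≤ 2 ^ N * (1 + ‖outputFrequency p‖) ^ N := by
  rw [pairWeight, ← mul_pow]
  have h1 : ‖p.1‖ ^ 2 + ‖p.2‖ ^ 2 ≤ ‖outputFrequency p‖ := by
    have h := WithLp.prod_norm_sq_eq_of_L2 (outputFrequency p)
    have h2 : ‖(outputFrequency p).fst‖ = ‖p.1‖ ^ 2 + ‖p.2‖ ^ 2 := by
      change ‖-(‖p.1‖ ^ 2 + ‖p.2‖ ^ 2)‖ = _
      rw [norm_neg, Real.norm_of_nonneg (by positivity)]
    rw [h2] at h
    refine le_of_sq_le_sq ?_ (norm_nonneg _)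
    rw [h]
    exact le_add_of_nonneg_right (by positivity)
  refine pow_le_pow_left₀ (by positivity) ?_ N
  nlinarith [sq_nonneg (‖p.1‖ - 1), sq_nonneg (‖p.2‖ - 1), sq_nonneg (‖p.1‖ - ‖p.2‖)]

/-- The integral of `f(ζ) g(η)` over the pairs `(ζ, η)` with given output frequency. -/
def fiberIntegral (f g : Space d → ℂ) (z : SpaceTime d) : ℂ :=
  ∫ θ, f (pairMap (z, θ)).1 * g (pairMap (z, θ)).2 ∂surface d

/-- The space-time Fourier transform of the product. -/
def outputDensity (f g : Space d → ℂ) (z : SpaceTime d) : ℂ :=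
  (((2 * Real.pi) ^ (1 - (d : ℤ)) * ((2⁻¹ : ℝ) ^ d * radialDensity z) : ℝ) : ℂ) *
    fiberIntegral f g z

theorem measurable_prod_mul {f g : Space d → ℂ} (hf : Measurable f) (hg : Measurable g) :
    Measurable fun p : Space d × Space d => f p.1 * g p.2 := by
  fun_prop

theorem stronglyMeasurable_fiberIntegral {f g : Space d → ℂ} (hf : Measurable f)
    (hg : Measurable g) : StronglyMeasurable (fiberIntegral f g) := by
  have h : StronglyMeasurable fun q : SpaceTime d × UnitSphere d =>
      f (pairMap q).1 * g (pairMap q).2 :=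
    ((measurable_prod_mul hf hg).comp continuous_pairMap.measurable).stronglyMeasurable
  exact h.integral_prod_right

theorem measurable_outputDensity {f g : Space d → ℂ} (hf : Measurable f) (hg : Measurable g) :
    Measurable (outputDensity f g) := by
  unfold outputDensity
  exact (Complex.measurable_ofReal.comp
    ((measurable_radialDensity.const_mul _).const_mul _)).mul
      (stronglyMeasurable_fiberIntegral hf hg).measurable

theorem integral_phaseMeasure (h : SpaceTime d → ℂ) :
    ∫ z, h z ∂phaseMeasure d = ∫ z, (((2⁻¹ : ℝ) ^ d * radialDensity z : ℝ) : ℂ) * h z := by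
  have hm : Measurable fun z : SpaceTime d =>
      Real.toNNReal ((2⁻¹ : ℝ) ^ d * radialDensity z) :=
    (measurable_radialDensity.const_mul _).real_toNNReal
  have := integral_withDensity_eq_integral_smul (μ := (volume : Measure (SpaceTime d))) hm h
  rw [phaseMeasure]
  refine this.trans (integral_congr_ae (Eventually.of_forall fun z => ?_))
  simp only [NNReal.smul_def, Complex.real_smul]
  rw [Real.coe_toNNReal _ (mul_nonneg (by positivity) (radialDensity_nonneg z))]

/-- A function of the output frequency is constant on each sphere and leaves the inner integral;
this is why the transform of the product is a density in z. -/
theorem integral_eq_integral_fiber (hd : 2 ≤ d) {f g : Space d → ℂ} (k : SpaceTime d → ℂ)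
    (hint : Integrable fun p : Space d × Space d => k (outputFrequency p) * (f p.1 * g p.2)) :
    (((2 * Real.pi) ^ (1 - (d : ℤ)) : ℝ) : ℂ) *
      ∫ p : Space d × Space d, k (outputFrequency p) * (f p.1 * g p.2) =
      ∫ z, k z * outputDensity f g z := by
  have hmp := measurePreserving_pairMap hd
  have h1 : ∫ p : Space d × Space d, k (outputFrequency p) * (f p.1 * g p.2) =
      ∫ q, k (outputFrequency (pairMap q)) * (f (pairMap q).1 * g (pairMap q).2)
        ∂((phaseMeasure d).prod (surface d)) := by
    conv_lhs => rw [← hmp.map_eq]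
    rw [integral_map hmp.measurable.aemeasurable (by rw [hmp.map_eq]; exact hint.1)]
  have hint2 : Integrable (fun q => k (outputFrequency (pairMap q)) *
      (f (pairMap q).1 * g (pairMap q).2)) ((phaseMeasure d).prod (surface d)) :=
    hmp.integrable_comp_of_integrable hint
  rw [h1, integral_prod _ hint2]
  have h2 : ∫ z, ∫ θ, k (outputFrequency (pairMap (z, θ))) *
      (f (pairMap (z, θ)).1 * g (pairMap (z, θ)).2) ∂surface d ∂phaseMeasure d =
      ∫ z, k z * fiberIntegral f g z ∂phaseMeasure d := by
    refine integral_congr_ae ?_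
    filter_upwards [ae_radius_pos] with z hz
    have h3 : ∀ θ : UnitSphere d, outputFrequency (pairMap (z, θ)) = z := fun θ =>
      outputFrequency_pairMap (p := (z, θ)) hz
    simp only [h3, fiberIntegral]
    rw [integral_const_mul]
  rw [h2, integral_phaseMeasure, ← integral_const_mul]
  refine integral_congr_ae (Eventually.of_forall fun z => ?_)
  simp only [outputDensity]
  push_cast
  ring

/-- Temperedness of f ⊗ g passes to the sphere integrals by the triangle inequality, since the
weight in z dominates the weight in the pair. -/
theorem integrable_outputDensity_div (hd : 2 ≤ d) {f g : Space d → ℂ} (hf : Measurable f)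
    (hg : Measurable g) {N : ℕ}
    (hN : Integrable fun p : Space d × Space d => f p.1 * g p.2 * (((pairWeight N p)⁻¹ : ℝ) : ℂ)) :
    Integrable fun z => outputDensity f g z * ((((1 + ‖z‖) ^ N)⁻¹ : ℝ) : ℂ) := by
  refine ⟨((measurable_outputDensity hf hg).mul (by fun_prop)).aestronglyMeasurable, ?_⟩
  have hden : Measurable fun z : SpaceTime d =>
      ENNReal.ofReal ((2⁻¹ : ℝ) ^ d * radialDensity z) :=
    (measurable_radialDensity.const_mul _).ennreal_ofReal
  have hk : Measurable fun z : SpaceTime d => ENNReal.ofReal (((1 + ‖z‖) ^ N)⁻¹) := by fun_prop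
  have hK : Measurable fun p : Space d × Space d => ‖f p.1 * g p.2‖ₑ := by fun_prop
  have hint : Measurable fun z : SpaceTime d =>
      (∫⁻ θ, ‖f (pairMap (z, θ)).1 * g (pairMap (z, θ)).2‖ₑ ∂surface d) *
        ENNReal.ofReal (((1 + ‖z‖) ^ N)⁻¹) :=
    (Measurable.lintegral_prod_right' (f := fun q : SpaceTime d × UnitSphere d =>
      ‖f (pairMap q).1 * g (pairMap q).2‖ₑ) (hK.comp continuous_pairMap.measurable)).mul hk
  have h1 := lintegral_eq_lintegral_fiber hd _ hK _ hk
  rw [phaseMeasure, lintegral_withDensity_eq_lintegral_mul _ hden hint] at h1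
  have h2 : ∫⁻ p : Space d × Space d, ‖f p.1 * g p.2‖ₑ *
      ENNReal.ofReal (((1 + ‖outputFrequency p‖) ^ N)⁻¹) < ∞ := by
    have h3 := hN.2
    rw [HasFiniteIntegral] at h3
    refine lt_of_le_of_lt ?_ (ENNReal.mul_lt_top (ENNReal.ofReal_lt_top (r := 2 ^ N)) h3)
    rw [← lintegral_const_mul' _ _ ENNReal.ofReal_ne_top]
    refine lintegral_mono fun p => ?_
    rw [enorm_mul (f p.1 * g p.2), mul_left_comm]
    gcongr
    rw [← ofReal_norm, ← ENNReal.ofReal_mul (by positivity), Complex.norm_real,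
      Real.norm_of_nonneg (inv_nonneg.2 (pairWeight_pos N p).le)]
    refine ENNReal.ofReal_le_ofReal ?_
    have h4 := pairWeight_le N p
    have h5 := pairWeight_pos N p
    have h6 : (0 : ℝ) < (1 + ‖outputFrequency p‖) ^ N := by positivity
    rw [← div_eq_mul_inv, le_div_iff₀ h5, inv_mul_le_iff₀ h6, mul_comm]
    exact h4
  rw [h1] at h2
  rw [HasFiniteIntegral]
  refine lt_of_le_of_lt ?_ (ENNReal.mul_lt_top
    (ENNReal.ofReal_lt_top (r := (2 * Real.pi) ^ (1 - (d : ℤ)))) h2)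
  rw [← lintegral_const_mul' _ _ ENNReal.ofReal_ne_top]
  refine lintegral_mono fun z => ?_
  have hρ := radialDensity_nonneg z
  rw [outputDensity, enorm_mul, enorm_mul, ← ofReal_norm, ← ofReal_norm (((_ : ℝ) : ℂ)),
    Complex.norm_real, Complex.norm_real, Real.norm_of_nonneg (by positivity),
    Real.norm_of_nonneg (by positivity), ENNReal.ofReal_mul (by positivity), Pi.mul_apply,
    ← mul_assoc, ← mul_assoc]
  gcongr
  exact enorm_integral_le_lintegral_enorm _

end Product

/-! ### Existence and uniqueness of the product, and its dispersive norm -/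

section Cutoff

variable {d : ℕ}

theorem inner_outputFrequency (p : Space d × Space d) (z : SpaceTime d) :
    (inner ℝ (-outputFrequency p) z : ℝ) =
      -((inner ℝ z.snd p.1 - z.fst * ‖p.1‖ ^ 2) + (inner ℝ z.snd p.2 - z.fst * ‖p.2‖ ^ 2)) := by
  rw [inner_neg_left, WithLp.prod_inner_apply]
  change -((inner ℝ (-(‖p.1‖ ^ 2 + ‖p.2‖ ^ 2)) z.fst : ℝ) + inner ℝ (p.1 + p.2) z.snd) = _
  rw [inner_add_left, real_inner_comm, real_inner_comm z.snd, real_inner_comm z.snd]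
  simp only [RCLike.inner_apply, conj_trivial]
  ring

theorem cutoffSolution_mul (f g : Space d → ℂ) (R : ℝ) (z : SpaceTime d) :
    cutoffSolution f R z * cutoffSolution g R z =
      ((((2 * Real.pi) ^ d : ℝ) : ℂ)⁻¹) ^ 2 *
        ∫ p in Metric.ball (0 : Space d × Space d) R,
          Complex.exp (-(Complex.I * ((inner ℝ (-outputFrequency p) z : ℝ) : ℂ))) *
            (f p.1 * g p.2) := by
  have h := integral_prod_mul (μ := (volume : Measure (Space d)).restrict (Metric.ball 0 R))
    (ν := (volume : Measure (Space d)).restrict (Metric.ball 0 R))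
    (fun ξ => Complex.exp (Complex.I * ((inner ℝ z.snd ξ - z.fst * ‖ξ‖ ^ 2 : ℝ) : ℂ)) * f ξ)
    (fun ξ => Complex.exp (Complex.I * ((inner ℝ z.snd ξ - z.fst * ‖ξ‖ ^ 2 : ℝ) : ℂ)) * g ξ)
  -- In the sup norm on pairs, the product of two balls of radius R is a ball of radius R.
  rw [Measure.prod_restrict, ball_prod_same] at h
  rw [cutoffSolution, cutoffSolution, mul_mul_mul_comm, ← h, ← sq]
  congr 1
  refine integral_congr_ae (Eventually.of_forall fun p => ?_)
  simp only [inner_outputFrequency]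
  rw [mul_mul_mul_comm, ← Complex.exp_add]
  congr 2
  push_cast
  ring

theorem integrableOn_ball_prod_mul {f g : Space d → ℂ} (hf : LocallyIntegrable f volume)
    (hg : LocallyIntegrable g volume) (R : ℝ) :
    IntegrableOn (fun p : Space d × Space d => f p.1 * g p.2) (Metric.ball 0 R) := by
  have hb : ∀ {h : Space d → ℂ}, LocallyIntegrable h volume →
      Integrable h (volume.restrict (Metric.ball (0 : Space d) R)) := fun hh =>
    (hh.integrableOn_isCompact (isCompact_closedBall 0 R)).mono_set Metric.ball_subset_closedBall
  have h := (hb hf).mul_prod (hb hg)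
  rwa [Measure.prod_restrict, ball_prod_same] at h

/-- The product of the two waves of frequencies ζ and η is a plane wave at the output frequency, and
Fubini applies because of the cutoff. -/
theorem integral_mul_cutoffSolution_mul {f g : Space d → ℂ} (hf : LocallyIntegrable f volume)
    (hg : LocallyIntegrable g volume) (R : ℝ) (φ : 𝓢(SpaceTime d, ℂ)) :
    ∫ z, φ z * (cutoffSolution f R z * cutoffSolution g R z) =
      ((((2 * Real.pi) ^ d : ℝ) : ℂ)⁻¹) ^ 2 *
        ∫ p in Metric.ball (0 : Space d × Space d) R,
          schwartzHat φ (-outputFrequency p) * (f p.1 * g p.2) := by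
  have hint : Integrable (fun q : SpaceTime d × (Space d × Space d) =>
      Complex.exp (-(Complex.I * ((inner ℝ (-outputFrequency q.2) q.1 : ℝ) : ℂ))) *
        (φ q.1 * (f q.2.1 * g q.2.2)))
      (volume.prod (volume.restrict (Metric.ball (0 : Space d × Space d) R))) := by
    refine (φ.integrable.mul_prod (integrableOn_ball_prod_mul hf hg R)).bdd_mul (c := 1) ?_ ?_
    · refine Continuous.aestronglyMeasurable ?_
      have : Continuous fun q : SpaceTime d × (Space d × Space d) =>
          (inner ℝ (-outputFrequency q.2) q.1 : ℝ) :=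
        (continuous_outputFrequency.comp continuous_snd).neg.inner continuous_fst
      fun_prop
    · refine Eventually.of_forall fun q => ?_
      rw [← mul_neg, ← Complex.ofReal_neg, mul_comm, Complex.norm_exp_ofReal_mul_I]
  have h1 : ∀ z, φ z * (cutoffSolution f R z * cutoffSolution g R z) =
      ((((2 * Real.pi) ^ d : ℝ) : ℂ)⁻¹) ^ 2 *
        ∫ p in Metric.ball (0 : Space d × Space d) R,
          Complex.exp (-(Complex.I * ((inner ℝ (-outputFrequency p) z : ℝ) : ℂ))) *
            (φ z * (f p.1 * g p.2)) := by
    intro z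
    rw [cutoffSolution_mul, mul_left_comm, ← integral_const_mul]
    congr 2
    funext p
    ring
  simp_rw [h1]
  rw [integral_const_mul, integral_integral_swap hint]
  congr 1
  refine integral_congr_ae (Eventually.of_forall fun p => ?_)
  simp only
  rw [schwartzHat_apply, ← integral_mul_const]
  congr 1
  funext z
  ring

theorem integrable_mul_prod_mul {f g : Space d → ℂ} {N : ℕ}
    (hN : Integrable fun p : Space d × Space d => f p.1 * g p.2 * (((pairWeight N p)⁻¹ : ℝ) : ℂ))
    {k : SpaceTime d → ℂ} (hk : Continuous k) {C : ℝ} (hC : ∀ z, (1 + ‖z‖) ^ N * ‖k z‖ ≤ C) :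
    Integrable fun p : Space d × Space d => k (outputFrequency p) * (f p.1 * g p.2) := by
  have hc : Continuous fun p : Space d × Space d =>
      k (outputFrequency p) * ((pairWeight N p : ℝ) : ℂ) :=
    (hk.comp continuous_outputFrequency).mul
      (Complex.continuous_ofReal.comp (continuous_pairWeight N))
  refine (hN.bdd_mul hc.aestronglyMeasurable (c := 2 ^ N * C)
    (Eventually.of_forall fun p => ?_)).congr (Eventually.of_forall fun p => ?_)
  · rw [norm_mul, Complex.norm_real, Real.norm_of_nonneg (pairWeight_pos N p).le, mul_comm]
    calc pairWeight N p * ‖k (outputFrequency p)‖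
        ≤ (2 ^ N * (1 + ‖outputFrequency p‖) ^ N) * ‖k (outputFrequency p)‖ := by
          gcongr
          exact pairWeight_le N p
      _ ≤ 2 ^ N * C := by
          rw [mul_assoc]
          gcongr
          exact hC _
  · have : ((pairWeight N p : ℝ) : ℂ) ≠ 0 := by
      exact_mod_cast (pairWeight_pos N p).ne'
    push_cast
    field_simp

theorem finrank_spaceTime : Module.finrank ℝ (SpaceTime d) = d + 1 := by
  rw [(WithLp.linearEquiv 2 ℝ (ℝ × Space d)).finrank_eq, Module.finrank_prod,
    Module.finrank_self, finrank_euclideanSpace_fin, add_comm]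

/-- The cutoff products converge, tested against a Fourier transform. -/
theorem tendsto_integral_cutoffSolution (hd : 2 ≤ d) {f g : Space d → ℂ}
    (hf : LocallyIntegrable f volume) (hg : LocallyIntegrable g volume) {N : ℕ}
    (hN : Integrable fun p : Space d × Space d => f p.1 * g p.2 * (((pairWeight N p)⁻¹ : ℝ) : ℂ))
    (ψ : 𝓢(SpaceTime d, ℂ)) :
    Tendsto (fun R : ℝ => ∫ z, schwartzHat ψ z * (cutoffSolution f R z * cutoffSolution g R z))
      atTop (𝓝 (∫ z, ψ z * outputDensity f g z)) := by
  have hψ : ∀ p : Space d × Space d, schwartzHat (schwartzHat ψ) (-outputFrequency p) =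
      (((2 * Real.pi) ^ (d + 1) : ℝ) : ℂ) * ψ (outputFrequency p) := by
    intro p
    rw [schwartzHat_schwartzHat, neg_neg, finrank_spaceTime]
  obtain ⟨s, C, -, hC⟩ := exists_one_add_norm_pow_mul_le (SpaceTime d) N
  have hint := integrable_mul_prod_mul hN ψ.continuous (hC ψ)
  have hcov : AECover (volume : Measure (Space d × Space d)) atTop
      (fun R : ℝ => Metric.ball (0 : Space d × Space d) R) := aecover_ball tendsto_id
  have hlim := (hcov.integral_tendsto_of_countably_generated hint).const_mul
    (((2 * Real.pi) ^ (1 - (d : ℤ)) : ℝ) : ℂ)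
  rw [integral_eq_integral_fiber hd ψ hint] at hlim
  refine hlim.congr fun R => ?_
  rw [integral_mul_cutoffSolution_mul hf hg]
  simp only [hψ, mul_assoc]
  rw [integral_const_mul, ← mul_assoc]
  -- The constants: (2π)^{-2d} from the two solutions and (2π)^{d+1} from Fourier inversion on
  -- space-time give (2π)^{1-d}.
  congr 1
  rw [← Complex.ofReal_inv, ← Complex.ofReal_pow, ← Complex.ofReal_mul]
  congr 1
  have hpi : (2 * Real.pi) ≠ 0 := by positivity
  rw [inv_pow, ← pow_mul, ← zpow_natCast, ← zpow_natCast, ← zpow_neg, ← zpow_add₀ hpi]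
  congr 1
  push_cast
  ring

theorem schwartzHat_surjective (φ : 𝓢(SpaceTime d, ℂ)) : ∃ ψ, schwartzHat ψ = φ :=
  ⟨_, schwartzHat_fourierInv_dilation φ⟩

theorem cutoffSolution_congr {f g : Space d → ℂ} (h : f =ᵐ[volume] g) :
    cutoffSolution f = cutoffSolution g := by
  funext R z
  rw [cutoffSolution, cutoffSolution]
  congr 1
  refine integral_congr_ae (ae_restrict_of_ae ?_)
  filter_upwards [h] with ξ hξ
  rw [hξ]

/-- The product of the two waves exists, and its Fourier transform is `outputDensity`. -/
theorem exists_isProduct (hd : 2 ≤ d) {u₀ v₀ : 𝓢'(Space d, ℂ)} {f g : Space d → ℂ}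
    (hf : IsFun (hat u₀) f) (hg : IsFun (hat v₀) g) (hfm : Measurable f) (hgm : Measurable g)
    {N : ℕ}
    (hN : Integrable fun p : Space d × Space d =>
      f p.1 * g p.2 * (((pairWeight N p)⁻¹ : ℝ) : ℂ)) :
    ∃ w, IsProduct u₀ v₀ w ∧ IsFun (hat w) (outputDensity f g) := by
  have hG := integrable_outputDensity_div hd hfm hgm hN
  obtain ⟨S, hS⟩ := exists_distribution_of_integrable_div hG
  obtain ⟨w, rfl⟩ := hat_surjective S
  refine ⟨w, ⟨f, g, hf, hg, fun φ => ?_⟩, locallyIntegrable_of_integrable_div hG,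
    fun φ _ => hS φ⟩
  obtain ⟨ψ, rfl⟩ := schwartzHat_surjective φ
  rw [← hat_apply, hS]
  exact tendsto_integral_cutoffSolution hd hf.1 hg.1 hN ψ

/-- The functions that witness a product agree almost everywhere with f and g, so they have the same
cutoffs and the limit is forced. -/
theorem IsProduct.isFun_hat (hd : 2 ≤ d) {u₀ v₀ : 𝓢'(Space d, ℂ)} {f g : Space d → ℂ}
    (hf : IsFun (hat u₀) f) (hg : IsFun (hat v₀) g) (hfm : Measurable f) (hgm : Measurable g)
    {N : ℕ}
    (hN : Integrable fun p : Space d × Space d => f p.1 * g p.2 * (((pairWeight N p)⁻¹ : ℝ) : ℂ))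
    {w : 𝓢'(SpaceTime d, ℂ)} (hw : IsProduct u₀ v₀ w) :
    IsFun (hat w) (outputDensity f g) := by
  obtain ⟨f', g', hf', hg', h⟩ := hw
  rw [cutoffSolution_congr (hf'.ae_eq hf), cutoffSolution_congr (hg'.ae_eq hg)] at h
  refine ⟨locallyIntegrable_of_integrable_div (integrable_outputDensity_div hd hfm hgm hN),
    fun φ _ => ?_⟩
  rw [hat_apply]
  exact tendsto_nhds_unique (h _) (tendsto_integral_cutoffSolution hd hf.1 hg.1 hN φ)

/-- The Fourier transform of `|𝔇|^β` of the product. -/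
def dispersiveDensity (β : ℝ) (f g : Space d → ℂ) (z : SpaceTime d) : ℂ :=
  ((|z.fst + ‖z.snd‖ ^ 2 / 2| ^ β : ℝ) : ℂ) * outputDensity f g z

theorem measurable_dispersiveDensity (β : ℝ) {f g : Space d → ℂ} (hf : Measurable f)
    (hg : Measurable g) : Measurable (dispersiveDensity β f g) := by
  have h : Measurable fun z : SpaceTime d => |z.fst + ‖z.snd‖ ^ 2 / 2| ^ β := by
    have h1 := continuous_fst' (d := d)
    have h2 := continuous_snd' (d := d)
    have h3 : Continuous fun z : SpaceTime d => |z.fst + ‖z.snd‖ ^ 2 / 2| :=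
      (h1.add ((h2.norm.pow 2).div_const 2)).abs
    exact h3.measurable.pow_const β
  exact (Complex.measurable_ofReal.comp h).mul (measurable_outputDensity hf hg)

/-- Plancherel's theorem expresses the dispersive norm by the density of the product. -/
theorem dispersiveNormSq_eq (hd : 2 ≤ d) (β : ℝ) {u₀ v₀ : 𝓢'(Space d, ℂ)} {f g : Space d → ℂ}
    (hf : IsFun (hat u₀) f) (hg : IsFun (hat v₀) g) (hfm : Measurable f) (hgm : Measurable g)
    {N : ℕ}
    (hN : Integrable fun p : Space d × Space d => f p.1 * g p.2 * (((pairWeight N p)⁻¹ : ℝ) : ℂ))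
    (hfin : ∫⁻ z, ‖dispersiveDensity β f g z‖ₑ ^ 2 < ∞) :
    dispersiveNormSq β u₀ v₀ = ENNReal.ofReal (((2 * Real.pi) ^ (d + 1))⁻¹) *
      ∫⁻ z, ‖dispersiveDensity β f g z‖ₑ ^ 2 := by
  have key : ∀ {F : Lp ℂ 2 (volume : Measure (SpaceTime d))},
      IsFun (hat (Lp.toTemperedDistribution F)) (dispersiveDensity β f g) →
      ‖F‖ₑ ^ 2 = ENNReal.ofReal (((2 * Real.pi) ^ (d + 1))⁻¹) *
        ∫⁻ z, ‖dispersiveDensity β f g z‖ₑ ^ 2 := by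
    intro F hF
    rw [enorm_sq_of_isFun_hat hF, finrank_spaceTime]
  apply le_antisymm
  · obtain ⟨w, hw, hwG⟩ := exists_isProduct hd hf hg hfm hgm hN
    have hmem : MemLp (dispersiveDensity β f g) 2 volume := by
      refine ⟨(measurable_dispersiveDensity β hfm hgm).aestronglyMeasurable, ?_⟩
      rw [eLpNorm_lt_top_iff_lintegral_rpow_enorm_lt_top two_ne_zero ENNReal.ofNat_ne_top]
      simpa using hfin
    obtain ⟨F, hF⟩ := exists_isFun_hat_of_memLp hmem
    rw [← key hF]
    exact iInf₂_le_of_le w F (iInf_le_of_le ⟨hw, outputDensity f g, hwG, hF⟩ le_rfl)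
  -- Every admissible w has the same transform, so every admissible F has the same norm.
  · refine le_iInf₂ fun w F => le_iInf fun h => ?_
    obtain ⟨hw, G, hG, hF⟩ := h
    rw [key]
    refine hF.congr ?_
    filter_upwards [hG.ae_eq (IsProduct.isFun_hat hd hf hg hfm hgm hN hw)] with z hz
    rw [hz, dispersiveDensity]

theorem energy_eq (β : ℝ) {u₀ v₀ : 𝓢'(Space d, ℂ)} {f g : Space d → ℂ}
    (hf : IsFun (hat u₀) f) (hg : IsFun (hat v₀) g) :
    energy β u₀ v₀ = energyIntegral (4 * β + d - 2) f g := by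
  apply le_antisymm
  · exact iInf₂_le_of_le f g (iInf_le_of_le ⟨hf, hg⟩ le_rfl)
  · refine le_iInf₂ fun f' g' => le_iInf fun h => le_of_eq ?_
    refine lintegral_congr_ae ?_
    have h1 := Measure.quasiMeasurePreserving_fst (μ := (volume : Measure (Space d)))
      (ν := (volume : Measure (Space d))).ae_eq (hf.ae_eq h.1)
    have h2 := Measure.quasiMeasurePreserving_snd (μ := (volume : Measure (Space d)))
      (ν := (volume : Measure (Space d))).ae_eq (hg.ae_eq h.2)
    filter_upwards [h1, h2] with p hp1 hp2
    simp only [Function.comp_apply] at hp1 hp2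
    rw [hp1, hp2]

theorem exists_isFun_of_mem_Upsilon {β : ℝ} {u₀ v₀ : 𝓢'(Space d, ℂ)}
    (h : (u₀, v₀) ∈ Upsilon d β) :
    ∃ f g : Space d → ℂ, IsFun (hat u₀) f ∧ IsFun (hat v₀) g ∧ Measurable f ∧ Measurable g := by
  have h' : energy β u₀ v₀ < ∞ := h
  simp only [energy, iInf_lt_iff] at h'
  obtain ⟨f, g, ⟨hf, hg⟩, -⟩ := h'
  obtain ⟨f', hfm, -, hf'⟩ := hf.exists_stronglyMeasurable
  obtain ⟨g', hgm, -, hg'⟩ := hg.exists_stronglyMeasurable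
  exact ⟨f', g', hf', hg', hfm.measurable, hgm.measurable⟩

end Cutoff

/-! ### Cauchy-Schwarz on the spheres, with its defect -/

section CauchySchwarz

/-- The variance identity, which is the Cauchy-Schwarz inequality with its defect. -/
theorem integral_norm_sq_sub_average {α : Type*} [MeasurableSpace α] (μ : Measure α)
    [IsFiniteMeasure μ] {s : ℝ} (hs : μ.real Set.univ = s) (hs0 : 0 < s) {h : α → ℂ}
    (hh : MemLp h 2 μ) :
    s * ∫ x, ‖h x‖ ^ 2 ∂μ =
      ‖∫ x, h x ∂μ‖ ^ 2 + s * ∫ x, ‖h x - (s : ℂ)⁻¹ * ∫ y, h y ∂μ‖ ^ 2 ∂μ := by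
  set I : ℂ := ∫ x, h x ∂μ with hI
  set m : ℂ := (s : ℂ)⁻¹ * I with hm
  have hint : Integrable h μ := hh.integrable one_le_two
  have hsq : Integrable (fun x => ‖h x‖ ^ 2) μ := (memLp_two_iff_integrable_sq_norm hh.1).1 hh
  have hcross : Integrable (fun x => (starRingEnd ℂ m * h x).re) μ := (hint.const_mul _).re
  have e1 : ∀ x, ‖h x - m‖ ^ 2 = ‖h x‖ ^ 2 - 2 * (starRingEnd ℂ m * h x).re + ‖m‖ ^ 2 := by
    intro x
    simp only [Complex.sq_norm, Complex.normSq_apply, Complex.mul_re, Complex.conj_re,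
      Complex.conj_im, Complex.sub_re, Complex.sub_im]
    ring
  have e2 : ∫ x, (starRingEnd ℂ m * h x).re ∂μ = (starRingEnd ℂ m * I).re := by
    rw [hI, ← integral_const_mul]
    exact integral_re (hint.const_mul _)
  have e3 : (starRingEnd ℂ m * I).re = s⁻¹ * ‖I‖ ^ 2 := by
    rw [hm, map_mul, map_inv₀, Complex.conj_ofReal, mul_assoc, ← Complex.ofReal_inv,
      Complex.re_ofReal_mul, Complex.sq_norm, mul_comm (starRingEnd ℂ I), Complex.mul_conj,
      Complex.ofReal_re]
  have e4 : ‖m‖ ^ 2 = s⁻¹ ^ 2 * ‖I‖ ^ 2 := by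
    rw [hm, norm_mul, mul_pow, norm_inv, Complex.norm_real, Real.norm_of_nonneg hs0.le]
  have hc2 : Integrable (fun x => 2 * (starRingEnd ℂ m * h x).re) μ := hcross.const_mul 2
  have hd2 : Integrable (fun x => ‖h x‖ ^ 2 - 2 * (starRingEnd ℂ m * h x).re) μ := hsq.sub hc2
  simp_rw [e1]
  rw [integral_add hd2 (integrable_const _), integral_sub hsq hc2, integral_const_mul, e2, e3, integral_const, hs, e4,
    smul_eq_mul]
  field_simp
  ring

theorem lintegral_enorm_sq_eq_ofReal {α : Type*} [MeasurableSpace α] {μ : Measure α} {h : α → ℂ}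
    (hh : MemLp h 2 μ) : ∫⁻ x, ‖h x‖ₑ ^ 2 ∂μ = ENNReal.ofReal (∫ x, ‖h x‖ ^ 2 ∂μ) := by
  rw [ofReal_integral_eq_lintegral_ofReal ((memLp_two_iff_integrable_sq_norm hh.1).1 hh)
    (Eventually.of_forall fun x => by positivity)]
  refine lintegral_congr fun x => ?_
  rw [ENNReal.ofReal_pow (norm_nonneg _), ofReal_norm]

theorem lintegral_enorm_sq_sub_average {α : Type*} [MeasurableSpace α] (μ : Measure α)
    [IsFiniteMeasure μ] {s : ℝ} (hs : μ.real Set.univ = s) (hs0 : 0 < s) {h : α → ℂ}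
    (hm : AEStronglyMeasurable h μ) (hh : ∫⁻ x, ‖h x‖ₑ ^ 2 ∂μ < ∞) :
    ENNReal.ofReal s * ∫⁻ x, ‖h x‖ₑ ^ 2 ∂μ =
      ‖∫ x, h x ∂μ‖ₑ ^ 2 +
        ENNReal.ofReal s * ∫⁻ x, ‖h x - (s : ℂ)⁻¹ * ∫ y, h y ∂μ‖ₑ ^ 2 ∂μ := by
  have hL : MemLp h 2 μ := by
    refine ⟨hm, ?_⟩
    rw [eLpNorm_lt_top_iff_lintegral_rpow_enorm_lt_top two_ne_zero ENNReal.ofNat_ne_top]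
    simpa using hh
  have hL2 : MemLp (fun x => h x - (s : ℂ)⁻¹ * ∫ y, h y ∂μ) 2 μ := hL.sub (memLp_const _)
  rw [lintegral_enorm_sq_eq_ofReal hL, lintegral_enorm_sq_eq_ofReal hL2, ← ofReal_norm,
    ← ENNReal.ofReal_pow (norm_nonneg _), ← ENNReal.ofReal_mul hs0.le,
    ← ENNReal.ofReal_mul hs0.le,
    ← ENNReal.ofReal_add (by positivity) (mul_nonneg hs0.le (integral_nonneg fun x => by positivity)),
    integral_norm_sq_sub_average μ hs hs0 hL]

variable {d : ℕ}

/-- The area of the unit sphere. -/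
def sphereArea (d : ℕ) : ℝ := (surface d).real Set.univ

theorem sphereArea_eq (hd : 2 ≤ d) :
    sphereArea d = 2 * Real.pi ^ ((d : ℝ) / 2) / Real.Gamma ((d : ℝ) / 2) := by
  have hd0 : (0 : ℝ) < d := by positivity
  have : Nonempty (Fin d) := ⟨⟨0, by omega⟩⟩
  have hG := Real.Gamma_pos_of_pos (show 0 < (d : ℝ) / 2 by positivity)
  rw [sphereArea, Measure.toSphere_real_apply_univ, finrank_euclideanSpace_fin, Measure.real,
    EuclideanSpace.volume_ball, Fintype.card_fin, ENNReal.ofReal_one, one_pow, one_mul,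
    Real.Gamma_add_one (by positivity), ENNReal.toReal_ofReal (by positivity),
    Real.sqrt_eq_rpow, ← Real.rpow_natCast, ← Real.rpow_mul Real.pi_pos.le,
    show 1 / 2 * (d : ℝ) = (d : ℝ) / 2 by ring]
  field_simp

theorem sphereArea_pos (hd : 2 ≤ d) : 0 < sphereArea d := by
  rw [sphereArea_eq hd]
  have hG := Real.Gamma_pos_of_pos (show 0 < (d : ℝ) / 2 by positivity)
  positivity

/-- The origin of the constant: (2π)^{-(d+1)} from Plancherel, 2^{-2β} from the symbol r²/2, the
square of (2π)^{1-d} from the density of the product, one Jacobian 2^{-d}, and the area of the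
sphere from Cauchy-Schwarz. -/
theorem sharpConst_eq (hd : 2 ≤ d) (β : ℝ) :
    sharpConst d β = ENNReal.ofReal (((2 * Real.pi) ^ (d + 1))⁻¹) *
      (ENNReal.ofReal ((2 : ℝ) ^ (-2 * β) * ((2 * Real.pi) ^ (1 - (d : ℤ))) ^ 2 * (2⁻¹ : ℝ) ^ d) *
        ENNReal.ofReal (sphereArea d)) := by
  have hA := (sphereArea_pos hd).le
  rw [← ENNReal.ofReal_mul (by positivity), ← ENNReal.ofReal_mul (by positivity), sharpConst,
    carneiroConst, sphereArea_eq hd]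
  congr 1
  have h2 : ((2 : ℝ)) ^ (2 - 4 * (d : ℝ)) = ((2 : ℝ) ^ (d + 1))⁻¹ *
      (((2 : ℝ) ^ (1 - (d : ℤ))) ^ 2 * (2⁻¹ : ℝ) ^ d * (2 : ℝ) ^ (1 : ℝ)) := by
    rw [← Real.rpow_intCast, ← Real.rpow_natCast, ← Real.rpow_natCast, ← Real.rpow_natCast,
      Real.inv_rpow zero_le_two, ← Real.rpow_neg zero_le_two, ← Real.rpow_neg zero_le_two,
      ← Real.rpow_mul zero_le_two]
    rw [← Real.rpow_add two_pos, ← Real.rpow_add two_pos, ← Real.rpow_add two_pos]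
    congr 1
    push_cast
    ring
  have hp : Real.pi ^ ((2 - 5 * (d : ℝ)) / 2) = (Real.pi ^ (d + 1))⁻¹ *
      ((Real.pi ^ (1 - (d : ℤ))) ^ 2 * Real.pi ^ ((d : ℝ) / 2)) := by
    have hpi := Real.pi_pos
    rw [← Real.rpow_intCast, ← Real.rpow_natCast, ← Real.rpow_natCast,
      ← Real.rpow_neg hpi.le, ← Real.rpow_mul hpi.le, ← Real.rpow_add hpi, ← Real.rpow_add hpi]
    congr 1
    push_cast
    ring
  rw [h2, hp, Real.rpow_one]
  simp only [mul_zpow, mul_pow, mul_inv]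
  ring

theorem radius_outputFrequency (p : Space d × Space d) :
    radius (outputFrequency p) = ‖p.1 - p.2‖ := by
  change √(-2 * -(‖p.1‖ ^ 2 + ‖p.2‖ ^ 2) - ‖p.1 + p.2‖ ^ 2) = _
  have h := parallelogram_law_with_norm ℝ p.1 p.2
  rw [show -2 * -(‖p.1‖ ^ 2 + ‖p.2‖ ^ 2) - ‖p.1 + p.2‖ ^ 2 = ‖p.1 - p.2‖ ^ 2 by nlinarith,
    Real.sqrt_sq (norm_nonneg _)]

theorem measurable_radius_rpow (γ : ℝ) :
    Measurable fun z : SpaceTime d => ENNReal.ofReal (radius z ^ γ) :=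
  (continuous_radius.measurable.pow_const γ).ennreal_ofReal

theorem energyIntegral_eq_fiber (hd : 2 ≤ d) {f g : Space d → ℂ} (hf : Measurable f)
    (hg : Measurable g) (γ : ℝ) :
    energyIntegral γ f g = ∫⁻ z, (∫⁻ θ, ‖f (pairMap (z, θ)).1 * g (pairMap (z, θ)).2‖ₑ ^ 2
      ∂surface d) * ENNReal.ofReal (radius z ^ γ) ∂phaseMeasure d := by
  rw [← lintegral_eq_lintegral_fiber hd (fun p => ‖f p.1 * g p.2‖ₑ ^ 2) (by fun_prop) _
    (measurable_radius_rpow γ)]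
  refine lintegral_congr fun p => ?_
  rw [radius_outputFrequency, enorm_mul, mul_pow]

/-- The squared symbol gives 2^{-2β} r^{4β}. Of the two factors 2^{-d} r^{d-2}, one is the density
of `phaseMeasure` and the other completes the exponent to 4β + d - 2, the exponent of the energy. -/
theorem enorm_sq_dispersiveDensity (hd : 2 ≤ d) (β : ℝ) (f g : Space d → ℂ) (z : SpaceTime d) :
    ‖dispersiveDensity β f g z‖ₑ ^ 2 = ENNReal.ofReal ((2⁻¹ : ℝ) ^ d * radialDensity z) *
      (ENNReal.ofReal ((2 : ℝ) ^ (-2 * β) * ((2 * Real.pi) ^ (1 - (d : ℤ))) ^ 2 * (2⁻¹ : ℝ) ^ d) *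
        (‖fiberIntegral f g z‖ₑ ^ 2 * ENNReal.ofReal (radius z ^ (4 * β + d - 2)))) := by
  have hρ := radialDensity_nonneg z
  rw [dispersiveDensity, outputDensity, ← mul_assoc, ← Complex.ofReal_mul, enorm_mul, mul_pow,
    ← ofReal_norm, Complex.norm_real, Real.norm_of_nonneg (by positivity),
    ← ENNReal.ofReal_pow (by positivity)]
  have hrad := Real.rpow_nonneg (radius_nonneg z) (4 * β + d - 2)
  rw [mul_comm (‖fiberIntegral f g z‖ₑ ^ 2), ← mul_assoc (ENNReal.ofReal _) (ENNReal.ofReal _),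
    ← mul_assoc, ← ENNReal.ofReal_mul (by positivity),
    ← mul_assoc (ENNReal.ofReal _) (ENNReal.ofReal _), ← ENNReal.ofReal_mul (by positivity)]
  congr 2
  by_cases hz : 0 < radius z
  · have h1 : |z.fst + ‖z.snd‖ ^ 2 / 2| = 2⁻¹ * radius z ^ 2 := by
      rw [abs_of_neg, radius_sq hz]
      · ring
      · have := radius_sq hz
        nlinarith [pow_pos hz 2]
    have h2 : (|z.fst + ‖z.snd‖ ^ 2 / 2| ^ β) ^ 2 = (2 : ℝ) ^ (-2 * β) * radius z ^ (4 * β) := by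
      rw [h1, Real.mul_rpow (by positivity) (by positivity), mul_pow, Real.inv_rpow zero_le_two,
        ← Real.rpow_neg zero_le_two, ← Real.rpow_natCast, ← Real.rpow_natCast,
        ← Real.rpow_natCast, ← Real.rpow_mul zero_le_two, ← Real.rpow_mul hz.le,
        ← Real.rpow_mul hz.le]
      congr 2 <;> push_cast <;> ring
    have h3 : radius z ^ (4 * β + d - 2) = radius z ^ (4 * β) * radius z ^ (d - 2) := by
      rw [← Real.rpow_natCast, Nat.cast_sub hd, ← Real.rpow_add hz]
      congr 1
      push_cast
      ring
    rw [mul_pow, mul_pow, h2, h3, radialDensity, if_pos hz]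
    ring
  · rw [radialDensity, if_neg hz]
    ring

theorem lintegral_dispersiveDensity (hd : 2 ≤ d) (β : ℝ) {f g : Space d → ℂ} (hf : Measurable f)
    (hg : Measurable g) :
    ∫⁻ z, ‖dispersiveDensity β f g z‖ₑ ^ 2 =
      ENNReal.ofReal ((2 : ℝ) ^ (-2 * β) * ((2 * Real.pi) ^ (1 - (d : ℤ))) ^ 2 * (2⁻¹ : ℝ) ^ d) *
        ∫⁻ z, ‖fiberIntegral f g z‖ₑ ^ 2 * ENNReal.ofReal (radius z ^ (4 * β + d - 2))
          ∂phaseMeasure d := by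
  have hden : Measurable fun z : SpaceTime d =>
      ENNReal.ofReal ((2⁻¹ : ℝ) ^ d * radialDensity z) :=
    (measurable_radialDensity.const_mul _).ennreal_ofReal
  have hm : Measurable fun z : SpaceTime d =>
      ‖fiberIntegral f g z‖ₑ ^ 2 * ENNReal.ofReal (radius z ^ (4 * β + d - 2)) :=
    ((stronglyMeasurable_fiberIntegral hf hg).measurable.enorm.pow_const 2).mul
      (measurable_radius_rpow _)
  rw [← lintegral_const_mul _ hm, phaseMeasure,
    lintegral_withDensity_eq_lintegral_mul _ hden (hm.const_mul _)]
  exact lintegral_congr fun z => enorm_sq_dispersiveDensity hd β f g z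

/-- The mean of `f(ζ) g(η)` over the pairs with given output frequency. -/
def fiberMean (f g : Space d → ℂ) (z : SpaceTime d) : ℂ :=
  (sphereArea d : ℂ)⁻¹ * fiberIntegral f g z

/-- The oscillation of `f(ζ) g(η)` along the pairs with the same output frequency. -/
def fiberOscillation (γ : ℝ) (f g : Space d → ℂ) : ℝ≥0∞ :=
  ∫⁻ z, (∫⁻ θ, ‖f (pairMap (z, θ)).1 * g (pairMap (z, θ)).2 - fiberMean f g z‖ₑ ^ 2 ∂surface d) *
    ENNReal.ofReal (radius z ^ γ) ∂phaseMeasure d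

theorem measurable_fiber {f g : Space d → ℂ} (hf : Measurable f) (hg : Measurable g) :
    Measurable fun q : SpaceTime d × UnitSphere d => f (pairMap q).1 * g (pairMap q).2 :=
  (measurable_prod_mul hf hg).comp continuous_pairMap.measurable

theorem measurable_fiberMean {f g : Space d → ℂ} (hf : Measurable f) (hg : Measurable g) :
    Measurable (fiberMean f g) :=
  (stronglyMeasurable_fiberIntegral hf hg).measurable.const_mul _

theorem ae_rpow_radius_ne_zero (γ : ℝ) :
    ∀ᵐ z ∂phaseMeasure d, ENNReal.ofReal (radius z ^ γ) ≠ 0 := by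
  filter_upwards [ae_radius_pos] with z hz
  exact (ENNReal.ofReal_pos.2 (Real.rpow_pos_of_pos hz γ)).ne'

/-- The variance identity on each sphere, integrated in z; finite energy makes f ⊗ g square
integrable on almost every sphere. -/
theorem sphereArea_mul_energyIntegral (hd : 2 ≤ d) {γ : ℝ} {f g : Space d → ℂ} (hf : Measurable f)
    (hg : Measurable g) (hE : energyIntegral γ f g < ∞) :
    ENNReal.ofReal (sphereArea d) * energyIntegral γ f g =
      (∫⁻ z, ‖fiberIntegral f g z‖ₑ ^ 2 * ENNReal.ofReal (radius z ^ γ) ∂phaseMeasure d) +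
        ENNReal.ofReal (sphereArea d) * fiberOscillation γ f g := by
  have hF := measurable_fiber hf hg
  have hk := measurable_radius_rpow (d := d) γ
  have hm1 : Measurable fun z : SpaceTime d =>
      ∫⁻ θ, ‖f (pairMap (z, θ)).1 * g (pairMap (z, θ)).2‖ₑ ^ 2 ∂surface d :=
    (hF.enorm.pow_const 2).lintegral_prod_right'
  have hm2 : Measurable fun z : SpaceTime d =>
      ‖fiberIntegral f g z‖ₑ ^ 2 * ENNReal.ofReal (radius z ^ γ) :=
    ((stronglyMeasurable_fiberIntegral hf hg).measurable.enorm.pow_const 2).mul hk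
  have hm3 : Measurable fun z : SpaceTime d =>
      ∫⁻ θ, ‖f (pairMap (z, θ)).1 * g (pairMap (z, θ)).2 - fiberMean f g z‖ₑ ^ 2 ∂surface d :=
    ((hF.sub ((measurable_fiberMean hf hg).comp measurable_fst)).enorm.pow_const
      2).lintegral_prod_right'
  have hm1k : Measurable fun z : SpaceTime d =>
      (∫⁻ θ, ‖f (pairMap (z, θ)).1 * g (pairMap (z, θ)).2‖ₑ ^ 2 ∂surface d) *
        ENNReal.ofReal (radius z ^ γ) := hm1.mul hk
  have hm3k : Measurable fun z : SpaceTime d =>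
      (∫⁻ θ, ‖f (pairMap (z, θ)).1 * g (pairMap (z, θ)).2 - fiberMean f g z‖ₑ ^ 2 ∂surface d) *
        ENNReal.ofReal (radius z ^ γ) := hm3.mul hk
  rw [energyIntegral_eq_fiber hd hf hg] at hE ⊢
  rw [fiberOscillation, ← lintegral_const_mul _ hm1k, ← lintegral_const_mul _ hm3k,
    ← lintegral_add_left hm2]
  refine lintegral_congr_ae ?_
  filter_upwards [ae_lt_top hm1k hE.ne, ae_rpow_radius_ne_zero γ] with z hz hz0
  have hfin : ∫⁻ θ, ‖f (pairMap (z, θ)).1 * g (pairMap (z, θ)).2‖ₑ ^ 2 ∂surface d < ∞ :=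
    ENNReal.lt_top_of_mul_ne_top_left hz.ne hz0
  have hmz : Measurable fun θ : UnitSphere d => f (pairMap (z, θ)).1 * g (pairMap (z, θ)).2 :=
    hF.comp measurable_prodMk_left
  have := lintegral_enorm_sq_sub_average (surface d) (s := sphereArea d) rfl (sphereArea_pos hd)
    hmz.aestronglyMeasurable hfin
  rw [← mul_assoc, this, add_mul, mul_assoc]
  rfl

/-- The weight r^γ is positive almost everywhere, so the exponent plays no role in the case of
equality. -/
theorem fiberOscillation_eq_zero_iff (hd : 2 ≤ d) (γ : ℝ) {f g : Space d → ℂ} (hf : Measurable f)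
    (hg : Measurable g) :
    fiberOscillation γ f g = 0 ↔
      ∀ᵐ p : Space d × Space d, f p.1 * g p.2 = fiberMean f g (outputFrequency p) := by
  have hF := measurable_fiber hf hg
  have hk := measurable_radius_rpow (d := d) γ
  have hdiff : Measurable fun q : SpaceTime d × UnitSphere d =>
      ‖f (pairMap q).1 * g (pairMap q).2 - fiberMean f g q.1‖ₑ ^ 2 :=
    (hF.sub ((measurable_fiberMean hf hg).comp measurable_fst)).enorm.pow_const 2
  have hm3 : Measurable fun z : SpaceTime d =>
      ∫⁻ θ, ‖f (pairMap (z, θ)).1 * g (pairMap (z, θ)).2 - fiberMean f g z‖ₑ ^ 2 ∂surface d :=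
    hdiff.lintegral_prod_right'
  have hmp := measurePreserving_pairMap hd
  have hset : MeasurableSet {p : Space d × Space d |
      f p.1 * g p.2 = fiberMean f g (outputFrequency p)} :=
    measurableSet_eq_fun (measurable_prod_mul hf hg)
      ((measurable_fiberMean hf hg).comp continuous_outputFrequency.measurable)
  have h1 : (∀ᵐ p : Space d × Space d, f p.1 * g p.2 = fiberMean f g (outputFrequency p)) ↔
      ∀ᵐ q ∂((phaseMeasure d).prod (surface d)),
        ‖f (pairMap q).1 * g (pairMap q).2 - fiberMean f g q.1‖ₑ ^ 2 = 0 := by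
    rw [← hmp.map_eq, ae_map_iff hmp.measurable.aemeasurable hset]
    have hpos : ∀ᵐ q ∂((phaseMeasure d).prod (surface d)), 0 < radius q.1 :=
      Measure.quasiMeasurePreserving_fst.ae ae_radius_pos
    refine eventually_congr ?_
    filter_upwards [hpos] with q hq
    rw [outputFrequency_pairMap hq]
    simp [sub_eq_zero]
  have h2 := lintegral_eq_zero_iff (μ := (phaseMeasure d).prod (surface d)) hdiff
  rw [h1]
  refine Iff.trans ?_ h2
  have hm3k : Measurable fun z : SpaceTime d =>
      (∫⁻ θ, ‖f (pairMap (z, θ)).1 * g (pairMap (z, θ)).2 - fiberMean f g z‖ₑ ^ 2 ∂surface d) *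
        ENNReal.ofReal (radius z ^ γ) := hm3.mul hk
  rw [lintegral_prod _ hdiff.aemeasurable, lintegral_eq_zero_iff hm3, fiberOscillation,
    lintegral_eq_zero_iff hm3k]
  refine eventually_congr ?_
  filter_upwards [ae_rpow_radius_ne_zero γ] with z hz
  simp only [Pi.zero_apply, mul_eq_zero, hz, or_false]

/-- The bilinear estimate with its defect. -/
theorem sharpConst_mul_energy (hd : 2 ≤ d) (β : ℝ) {u₀ v₀ : 𝓢'(Space d, ℂ)} {f g : Space d → ℂ}
    (hf : IsFun (hat u₀) f) (hg : IsFun (hat v₀) g) (hfm : Measurable f) (hgm : Measurable g)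
    (hE : energyIntegral (4 * β + d - 2) f g < ∞) :
    sharpConst d β * energy β u₀ v₀ =
      dispersiveNormSq β u₀ v₀ + sharpConst d β * fiberOscillation (4 * β + d - 2) f g := by
  obtain ⟨N, hN⟩ := exists_integrable_mul_div_pairWeight hfm hgm hf.1 hg.1 hE
  have h1 := sphereArea_mul_energyIntegral hd hfm hgm hE
  have h2 := lintegral_dispersiveDensity hd β hfm hgm
  have hfin : ∫⁻ z, ‖dispersiveDensity β f g z‖ₑ ^ 2 < ∞ := by
    rw [h2]
    refine ENNReal.mul_lt_top ENNReal.ofReal_lt_top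
      (lt_of_le_of_lt (le_self_add.trans h1.ge) (ENNReal.mul_lt_top ENNReal.ofReal_lt_top hE))
  rw [dispersiveNormSq_eq hd β hf hg hfm hgm hN hfin, energy_eq β hf hg, h2, sharpConst_eq hd,
    mul_assoc, mul_assoc, h1]
  ring

theorem sharpConst_ne_top (d : ℕ) (β : ℝ) : sharpConst d β ≠ ∞ := ENNReal.ofReal_ne_top

theorem sharpConst_ne_zero (hd : 2 ≤ d) (β : ℝ) : sharpConst d β ≠ 0 := by
  have hA := sphereArea_pos hd
  rw [sharpConst_eq hd]
  refine mul_ne_zero ?_ (mul_ne_zero ?_ ?_) <;>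
  · refine (ENNReal.ofReal_pos.2 ?_).ne'
    positivity

/-- Equality holds exactly when `f(ζ) g(η)` is a function of the output frequency. -/
theorem dispersiveNormSq_eq_iff (hd : 2 ≤ d) (β : ℝ) {u₀ v₀ : 𝓢'(Space d, ℂ)}
    {f g : Space d → ℂ} (hf : IsFun (hat u₀) f) (hg : IsFun (hat v₀) g) (hfm : Measurable f)
    (hgm : Measurable g) (hE : energyIntegral (4 * β + d - 2) f g < ∞) :
    dispersiveNormSq β u₀ v₀ = sharpConst d β * energy β u₀ v₀ ↔
      ∀ᵐ p : Space d × Space d, f p.1 * g p.2 = fiberMean f g (outputFrequency p) := by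
  have h := sharpConst_mul_energy hd β hf hg hfm hgm hE
  have hfin : dispersiveNormSq β u₀ v₀ ≠ ∞ := by
    refine ne_top_of_le_ne_top (ENNReal.mul_ne_top (sharpConst_ne_top d β) ?_)
      (le_self_add.trans h.ge)
    rw [energy_eq β hf hg]
    exact hE.ne
  rw [← fiberOscillation_eq_zero_iff hd (4 * β + d - 2) hfm hgm, h]
  constructor
  · intro h1
    have h2 : sharpConst d β * fiberOscillation (4 * β + d - 2) f g = 0 :=
      (ENNReal.add_right_inj hfin).1 (by rw [add_zero]; exact h1.symm)
    exact (mul_eq_zero.1 h2).resolve_left (sharpConst_ne_zero hd β)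
  · intro h1
    rw [h1, mul_zero, add_zero]

end CauchySchwarz

/-! ### Continuous solutions of the Maxwell-Boltzmann functional equation -/

section FunctionalEquation

/-- A continuous additive function on the half-line is linear. -/
theorem eq_mul_of_additive_nonneg {h : ℝ → ℂ} (hc : Continuous h)
    (hadd : ∀ s t, 0 ≤ s → 0 ≤ t → h (s + t) = h s + h t) {s : ℝ} (hs : 0 ≤ s) :
    h s = s * h 1 := by
  have h0 : h 0 = 0 := by
    have := hadd 0 0 le_rfl le_rfl
    rw [add_zero] at this
    exact left_eq_add.1 this
  -- The odd extension of h to the line, written with positive and negative parts, is additive and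
  -- continuous, hence real linear.
  let H : ℝ →+ ℂ :=
    { toFun := fun s => h (max s 0) - h (max (-s) 0)
      map_zero' := by simp
      map_add' := fun s t => by
        have p : ∀ r : ℝ, (0 : ℝ) ≤ max r 0 := fun r => le_max_right _ _
        have q : ∀ r : ℝ, max r 0 = r + max (-r) 0 := fun r => by
          rcases le_total r 0 with hr | hr
          · rw [max_eq_right hr, max_eq_left (by linarith)]; ring
          · rw [max_eq_left hr, max_eq_right (by linarith)]; ring
        have e := hadd (max (s + t) 0) (max (-s) 0 + max (-t) 0) (p _) (add_nonneg (p _) (p _))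
        rw [hadd _ _ (p (-s)) (p (-t)), show max (s + t) 0 + (max (-s) 0 + max (-t) 0) =
          max (-(s + t)) 0 + (max s 0 + max t 0) by rw [q (s + t), q s, q t]; ring,
          hadd _ _ (p _) (add_nonneg (p s) (p t)), hadd _ _ (p s) (p t)] at e
        linear_combination -e }
  have hH : Continuous H :=
    (hc.comp (continuous_id.max continuous_const)).sub
      (hc.comp (continuous_neg.max continuous_const))
  have key : ∀ r, 0 ≤ r → H r = h r := fun r hr => by
    change h (max r 0) - h (max (-r) 0) = h r
    rw [max_eq_left hr, max_eq_right (by linarith), h0, sub_zero]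
  have := map_real_smul H hH s 1
  rw [smul_eq_mul, mul_one, key s hs, key 1 zero_le_one, Complex.real_smul] at this
  exact this

variable {d : ℕ}

/-- In dimension at least two a line has a nonzero orthogonal complement; the functional equation
has content only because of this. -/
theorem exists_orthogonal_norm_eq (hd : 2 ≤ d) (x : Space d) :
    ∃ y : Space d, inner ℝ x y = 0 ∧ ‖y‖ = ‖x‖ := by
  have h1 := (Submodule.span ℝ {x}).finrank_add_finrank_orthogonal
  rw [finrank_euclideanSpace_fin] at h1
  have h2 : Module.finrank ℝ (Submodule.span ℝ {x}) ≤ 1 := by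
    simpa using finrank_span_le_card (R := ℝ) ({x} : Set (Space d))
  have : Nontrivial (Submodule.span ℝ {x})ᗮ :=
    Module.nontrivial_of_finrank_pos (R := ℝ) (by omega)
  obtain ⟨y, hy⟩ := exists_ne (0 : (Submodule.span ℝ {x})ᗮ)
  have hy0 : ‖(y : Space d)‖ ≠ 0 := by simpa using hy
  refine ⟨(‖x‖ / ‖(y : Space d)‖) • (y : Space d), ?_, ?_⟩
  · rw [real_inner_smul_right, Submodule.mem_orthogonal_singleton_iff_inner_right.1 y.2, mul_zero]
  · rw [norm_smul, Real.norm_of_nonneg (by positivity), div_mul_cancel₀ _ hy0]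

/-- If |x| = |y|, then x and y are the sum and the difference of the orthogonal vectors (x + y)/2
and (x - y)/2, so evenness makes P radial. By Pythagoras a radial P is additive as a function of
|x|². -/
theorem eq_norm_sq_mul_of_orthogonal_additive_even (hd : 2 ≤ d) {P : Space d → ℂ}
    (hc : Continuous P) (hadd : ∀ x y, inner ℝ x y = 0 → P (x + y) = P x + P y)
    (heven : ∀ x, P (-x) = P x) : ∃ a : ℂ, ∀ x, P x = a * ((‖x‖ ^ 2 : ℝ) : ℂ) := by
  have hrad : ∀ x y : Space d, ‖x‖ = ‖y‖ → P x = P y := by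
    intro x y hxy
    have horth : inner ℝ ((2⁻¹ : ℝ) • (x + y)) ((2⁻¹ : ℝ) • (x - y)) = 0 := by
      rw [real_inner_smul_left, real_inner_smul_right,
        (real_inner_add_sub_eq_zero_iff x y).2 hxy, mul_zero, mul_zero]
    have e1 := hadd _ _ horth
    have e2 := hadd ((2⁻¹ : ℝ) • (x + y)) (-((2⁻¹ : ℝ) • (x - y))) (by
      rw [inner_neg_right, horth, neg_zero])
    rw [heven, ← e1] at e2
    have hx : (2⁻¹ : ℝ) • (x + y) + (2⁻¹ : ℝ) • (x - y) = x := by module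
    have hy : (2⁻¹ : ℝ) • (x + y) + -((2⁻¹ : ℝ) • (x - y)) = y := by module
    rw [hx, hy] at e2
    exact e2.symm
  let e : Space d := EuclideanSpace.single ⟨0, by omega⟩ 1
  have he : ‖e‖ = 1 := by simp [e]
  obtain ⟨e', horth, he'⟩ := exists_orthogonal_norm_eq hd e
  rw [he] at he'
  have hsq : ∀ s : ℝ, 0 ≤ s → ∀ u : Space d, ‖u‖ = 1 → ‖√s • u‖ ^ 2 = s := by
    intro s hs u hu
    rw [norm_smul, hu, mul_one, Real.norm_of_nonneg (Real.sqrt_nonneg s), Real.sq_sqrt hs]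
  have hlin := @eq_mul_of_additive_nonneg (fun s => P (√s • e))
    (hc.comp (Real.continuous_sqrt.smul continuous_const)) (by
      intro s t hs ht
      have ho : inner ℝ (√s • e) (√t • e') = 0 := by
        rw [real_inner_smul_left, real_inner_smul_right, horth, mul_zero, mul_zero]
      have hn : ‖√(s + t) • e‖ = ‖√s • e + √t • e'‖ := by
        rw [← sq_eq_sq₀ (norm_nonneg _) (norm_nonneg _), hsq _ (add_nonneg hs ht) e he, sq,
          norm_add_sq_eq_norm_sq_add_norm_sq_real ho, ← sq, ← sq, hsq s hs e he, hsq t ht e' he']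
      have hn' : ‖√t • e‖ = ‖√t • e'‖ := by rw [norm_smul, norm_smul, he, he']
      change P (√(s + t) • e) = P (√s • e) + P (√t • e)
      rw [hrad _ _ hn, hadd _ _ ho, hrad _ _ hn'])
  refine ⟨P (√1 • e), fun x => ?_⟩
  have := hlin (s := ‖x‖ ^ 2) (by positivity)
  rw [mul_comm, ← this]
  apply hrad
  rw [Real.sqrt_sq (norm_nonneg _), norm_smul, he, mul_one, norm_norm]

/-- For y orthogonal to x with |y| = |x|, the vectors sx + √(st) y and tx - √(st) y are orthogonal
and sum to (s + t)x; oddness cancels the y terms, so O is linear on rays. -/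
theorem exists_linearMap_of_orthogonal_additive_odd (hd : 2 ≤ d) {O : Space d → ℂ}
    (hc : Continuous O) (hadd : ∀ x y, inner ℝ x y = 0 → O (x + y) = O x + O y)
    (hodd : ∀ x, O (-x) = -O x) : ∃ B : Space d →ₗ[ℝ] ℂ, ∀ x, O x = B x := by
  have hray : ∀ (x : Space d) (s t : ℝ), 0 ≤ s → 0 ≤ t → O ((s + t) • x) = O (s • x) + O (t • x) := by
    intro x s t hs ht
    obtain ⟨y, hxy, hy⟩ := exists_orthogonal_norm_eq hd x
    have hyx : inner ℝ y x = 0 := by rw [real_inner_comm, hxy]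
    have ho : inner ℝ (s • x + √(s * t) • y) (t • x + -(√(s * t) • y)) = 0 := by
      simp only [inner_add_left, inner_add_right, inner_neg_right, real_inner_smul_left,
        real_inner_smul_right, hxy, hyx, real_inner_self_eq_norm_sq, norm_smul, hy, mul_pow,
        Real.norm_eq_abs, sq_abs]
      have := Real.mul_self_sqrt (mul_nonneg hs ht)
      linear_combination -‖x‖ ^ 2 * this
    have e := hadd _ _ ho
    rw [hadd (s • x) _ (by rw [real_inner_smul_left, real_inner_smul_right, hxy]; ring),
      hadd (t • x) _ (by rw [inner_neg_right, real_inner_smul_left, real_inner_smul_right, hxy];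
                         ring), hodd] at e
    rw [show (s + t) • x = s • x + √(s * t) • y + (t • x + -(√(s * t) • y)) by module, e]
    ring
  have hpos : ∀ (x : Space d) (s : ℝ), 0 ≤ s → O (s • x) = s * O x := by
    intro x s hs
    have := @eq_mul_of_additive_nonneg (fun s => O (s • x)) (by fun_prop) (hray x) s hs
    simpa using this
  have hsmul : ∀ (s : ℝ) (x : Space d), O (s • x) = s * O x := by
    intro s x
    rcases le_total 0 s with hs | hs
    · exact hpos x s hs
    · have := hpos x (-s) (by linarith)
      rw [neg_smul, hodd] at this
      push_cast at this
      linear_combination -this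
  refine ⟨⟨⟨O, fun x y => ?_⟩, fun s x => ?_⟩, fun x => rfl⟩
  · rcases eq_or_ne x 0 with rfl | hx
    · have h0 : O 0 = 0 := by simpa using hsmul 0 0
      rw [zero_add, h0, zero_add]
    -- The vector cx is the projection of y on the line of x; both x + y and y are split along this
    -- line and its complement.
    · set c : ℝ := inner ℝ x y / ‖x‖ ^ 2 with hcdef
      have hw : inner ℝ x (y - c • x) = 0 := by
        rw [inner_sub_right, real_inner_smul_right, real_inner_self_eq_norm_sq, hcdef,
          div_mul_cancel₀ _ (by positivity), sub_self]
      have e1 := hadd ((1 + c) • x) (y - c • x) (by rw [real_inner_smul_left, hw, mul_zero])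
      have e2 := hadd (c • x) (y - c • x) (by rw [real_inner_smul_left, hw, mul_zero])
      rw [show (1 + c) • x + (y - c • x) = x + y by module, hsmul] at e1
      rw [show c • x + (y - c • x) = y by module, hsmul] at e2
      rw [e1, e2]
      push_cast
      ring
  · simpa using hsmul s x

theorem exists_quadratic_of_orthogonal_additive (hd : 2 ≤ d) {ℓ : Space d → ℂ}
    (hc : Continuous ℓ) (hadd : ∀ x y, inner ℝ x y = 0 → ℓ (x + y) = ℓ x + ℓ y) :
    ∃ (a : ℂ) (B : Space d →ₗ[ℝ] ℂ), ∀ x, ℓ x = a * ((‖x‖ ^ 2 : ℝ) : ℂ) + B x := by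
  have hneg : ∀ x y : Space d, inner ℝ x y = 0 → ℓ (-(x + y)) = ℓ (-x) + ℓ (-y) := by
    intro x y h
    rw [neg_add, hadd _ _ (by rw [inner_neg_neg, h])]
  obtain ⟨a, ha⟩ := eq_norm_sq_mul_of_orthogonal_additive_even hd
    (P := fun x => 2⁻¹ * (ℓ x + ℓ (-x))) (by fun_prop)
    (fun x y h => by simp only [hadd x y h, hneg x y h]; ring)
    (fun x => by simp only [neg_neg]; ring)
  obtain ⟨B, hB⟩ := exists_linearMap_of_orthogonal_additive_odd hd
    (O := fun x => 2⁻¹ * (ℓ x - ℓ (-x))) (by fun_prop)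
    (fun x y h => by simp only [hadd x y h, hneg x y h]; ring)
    (fun x => by simp only [neg_neg]; ring)
  refine ⟨a, B, fun x => ?_⟩
  rw [← ha, ← hB]
  ring

/-- `E ⊗ E` is a function of momentum and energy. -/
def IsRectangular (E : Space d → ℂ) : Prop :=
  ∀ x y x' y' : Space d, x + y = x' + y' → ‖x‖ ^ 2 + ‖y‖ ^ 2 = ‖x'‖ ^ 2 + ‖y'‖ ^ 2 →
    E x * E y = E x' * E y'

/-- Let z be a zero and p a point with E(p) ≠ 0. In a square with diagonal from z to p, the equation
makes E vanish at one of the other two corners, which is closer to p by the factor 1/√2. Iterating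
gives zeros that converge to p, against continuity. -/
theorem IsRectangular.ne_zero (hd : 2 ≤ d) {E : Space d → ℂ} (hc : Continuous E)
    (hE : IsRectangular E) (h0 : ∃ p, E p ≠ 0) (x : Space d) : E x ≠ 0 := by
  obtain ⟨p, hp⟩ := h0
  intro hx
  have step : ∀ z : Space d, E z = 0 → ∃ w : Space d, E w = 0 ∧ ‖w - p‖ ^ 2 = 2⁻¹ * ‖z - p‖ ^ 2 := by
    intro z hz
    obtain ⟨e, he, hen⟩ := exists_orthogonal_norm_eq hd (z - p)
    have hnorm : ∀ σ : ℝ, ‖(2⁻¹ : ℝ) • (z - p) + (σ * 2⁻¹) • e‖ ^ 2 =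
        (2⁻¹ ^ 2 + (σ * 2⁻¹) ^ 2) * ‖z - p‖ ^ 2 := by
      intro σ
      rw [norm_add_sq_real, real_inner_smul_left, real_inner_smul_right, he, norm_smul, norm_smul,
        hen, mul_pow, mul_pow, Real.norm_eq_abs, Real.norm_eq_abs, sq_abs, sq_abs]
      ring
    have hkey := hE z p (p + ((2⁻¹ : ℝ) • (z - p) + (1 * 2⁻¹ : ℝ) • e))
      (p + ((2⁻¹ : ℝ) • (z - p) + (-1 * 2⁻¹ : ℝ) • e)) (by module) (by
        rw [norm_add_sq_real p, norm_add_sq_real p, hnorm, hnorm, inner_add_right,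
          inner_add_right, real_inner_smul_right, real_inner_smul_right, real_inner_smul_right]
        have hz2 : ‖z‖ ^ 2 = ‖p‖ ^ 2 + 2 * inner ℝ p (z - p) + ‖z - p‖ ^ 2 := by
          rw [← norm_add_sq_real, add_sub_cancel]
        rw [hz2]
        ring)
    rw [hz, zero_mul] at hkey
    rcases mul_eq_zero.1 hkey.symm with h | h
    · refine ⟨_, h, ?_⟩
      rw [add_sub_cancel_left, hnorm]
      ring
    · refine ⟨_, h, ?_⟩
      rw [add_sub_cancel_left, hnorm]
      ring
  have hseq : ∀ n : ℕ, ∃ w : Space d, E w = 0 ∧ ‖w - p‖ ^ 2 = 2⁻¹ ^ n * ‖x - p‖ ^ 2 := by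
    intro n
    induction n with
    | zero => exact ⟨x, hx, by simp⟩
    | succ n ih =>
      obtain ⟨w, hw, hwn⟩ := ih
      obtain ⟨w', hw', hwn'⟩ := step w hw
      exact ⟨w', hw', by rw [hwn', hwn, pow_succ]; ring⟩
  choose w hw hwn using hseq
  have hlim : Tendsto w atTop (𝓝 p) := by
    rw [tendsto_iff_norm_sub_tendsto_zero]
    have h2 : Tendsto (fun n => ‖w n - p‖ ^ 2) atTop (𝓝 0) := by
      simp_rw [hwn]
      have := (tendsto_pow_atTop_nhds_zero_of_lt_one (r := (2⁻¹ : ℝ)) (by norm_num)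
        (by norm_num)).mul_const (‖x - p‖ ^ 2)
      simpa using this
    have h3 := (Real.continuous_sqrt.tendsto 0).comp h2
    rw [Real.sqrt_zero] at h3
    refine h3.congr fun n => ?_
    exact Real.sqrt_sq (norm_nonneg _)
  have := (hc.tendsto p).comp hlim
  have h0 : Tendsto (E ∘ w) atTop (𝓝 0) := by
    refine tendsto_const_nhds.congr fun n => ?_
    exact (hw n).symm
  exact hp (tendsto_nhds_unique this h0)

/-- A continuous function on the line with values in `2πiℤ` is constant. -/
theorem eq_of_forall_exp_eq_one {g : ℝ → ℂ} (hc : Continuous g)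
    (h : ∀ t, Complex.exp (g t) = 1) (s t : ℝ) : g s = g t := by
  have hcount : (Set.range g).Countable := by
    refine (Set.countable_range fun n : ℤ => (n : ℂ) * (2 * Real.pi * Complex.I)).mono ?_
    rintro _ ⟨t, rfl⟩
    obtain ⟨n, hn⟩ := Complex.exp_eq_one_iff.1 (h t)
    exact ⟨n, hn.symm⟩
  exact hcount.isTotallyDisconnected _ subset_rfl (isPreconnected_range hc) ⟨s, rfl⟩ ⟨t, rfl⟩

/-- The continuous solutions of the Maxwell-Boltzmann functional equation. -/
theorem IsRectangular.exists_eq_exp (hd : 2 ≤ d) {E : Space d → ℂ} (hc : Continuous E)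
    (hE : IsRectangular E) (h0 : ∃ p, E p ≠ 0) :
    ∃ (a c : ℂ) (B : Space d →ₗ[ℝ] ℂ),
      ∀ x, E x = Complex.exp (a * ((‖x‖ ^ 2 : ℝ) : ℂ) + B x + c) := by
  have hne := hE.ne_zero hd hc h0
  have hsc : IsSimplyConnected (Set.univ : Set (Space d)) := by
    have := convex_univ.contractibleSpace (Set.univ_nonempty (α := Space d))
    exact SimplyConnectedSpace.ofContractible _
  obtain ⟨L, hLc, hL⟩ := Complex.exists_continuousOn_eqOn_exp_comp hsc isOpen_univ
    hc.continuousOn (by rintro ⟨x, -, hx⟩; exact hne x hx)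
  rw [continuousOn_univ] at hLc
  replace hL : ∀ x, Complex.exp (L x) = E x := fun x => hL (Set.mem_univ x)
  obtain ⟨a, B, hab⟩ := exists_quadratic_of_orthogonal_additive hd (ℓ := fun x => L x - L 0)
    (by fun_prop) (by
      intro x y hxy
      -- The points tx + ty, 0 and tx, ty are opposite corners of a rectangle, so this combination
      -- of logarithms lies in 2πiℤ. Being continuous in t and zero at t = 0, it vanishes.
      have hcont : Continuous fun t : ℝ => L (t • x + t • y) + L 0 - L (t • x) - L (t • y) := by
        fun_prop
      have h1 := eq_of_forall_exp_eq_one hcont (fun t => by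
        have := hE (t • x + t • y) 0 (t • x) (t • y) (by simp) (by
          rw [norm_add_sq_real, real_inner_smul_left, real_inner_smul_right, hxy]
          simp)
        rw [sub_sub, Complex.exp_sub, Complex.exp_add, Complex.exp_add, hL, hL, hL, hL, this]
        exact div_self (mul_ne_zero (hne _) (hne _))) 1 0
      simp only [one_smul, zero_smul, add_zero] at h1
      linear_combination h1)
  refine ⟨a, L 0, B, fun x => ?_⟩
  rw [← hab, ← hL]
  ring_nf

end FunctionalEquation

/-! ### Gaussians: Fourier transform and energy -/

section Gaussian

open scoped FourierTransform

variable {d : ℕ}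

/-- The function `exp(a |η|² + b · η + c)`. -/
def gaussianFun (a : ℂ) (b : Fin d → ℂ) (c : ℂ) (η : Space d) : ℂ :=
  Complex.exp (a * ((‖η‖ ^ 2 : ℝ) : ℂ) + ∑ j, b j * ((η j : ℝ) : ℂ) + c)

theorem mem_gaussians {f : Space d → ℂ} :
    f ∈ gaussians d ↔ ∃ (a c : ℂ) (b : Fin d → ℂ), a.re < 0 ∧ f = gaussianFun a b c := Iff.rfl

theorem continuous_gaussianFun (a : ℂ) (b : Fin d → ℂ) (c : ℂ) :
    Continuous (gaussianFun a b c) := by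
  unfold gaussianFun
  fun_prop

theorem gaussianFun_ne_zero (a : ℂ) (b : Fin d → ℂ) (c : ℂ) (η : Space d) :
    gaussianFun a b c η ≠ 0 := Complex.exp_ne_zero _

theorem lintegral_enorm_gaussianFun_ne_zero (a : ℂ) (b : Fin d → ℂ) (c : ℂ) :
    ∫⁻ ξ, ‖gaussianFun a b c ξ‖ₑ ≠ 0 := by
  intro h
  rw [lintegral_eq_zero_iff (continuous_gaussianFun a b c).measurable.enorm] at h
  obtain ⟨ξ, hξ⟩ := h.exists
  exact gaussianFun_ne_zero a b c ξ (by simpa using hξ)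

theorem gaussianFun_toLp (a : ℂ) (b : Fin d → ℂ) (c : ℂ) (v : Fin d → ℝ) :
    gaussianFun a b c (WithLp.toLp 2 v) =
      Complex.exp (- -a * ∑ i, (v i : ℂ) ^ 2 + ∑ i, b i * v i) * Complex.exp c := by
  rw [gaussianFun, ← Complex.exp_add, EuclideanSpace.norm_sq_eq]
  simp

theorem integrable_gaussianFun {a : ℂ} (ha : a.re < 0) (b : Fin d → ℂ) (c : ℂ) :
    Integrable (gaussianFun a b c) := by
  rw [← (PiLp.volume_preserving_toLp (Fin d)).integrable_comp_emb
    (MeasurableEquiv.toLp 2 _).measurableEmbedding]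
  refine ((GaussianFourier.integrable_cexp_neg_mul_sum_add (b := -a) (by simpa) b).mul_const
    (Complex.exp c)).congr (Eventually.of_forall fun v => ?_)
  exact (gaussianFun_toLp a b c v).symm

theorem integral_gaussianFun {a : ℂ} (ha : a.re < 0) (b : Fin d → ℂ) (c : ℂ) :
    ∫ η, gaussianFun a b c η =
      (Real.pi / -a) ^ (d / 2 : ℂ) * Complex.exp ((∑ i, b i ^ 2) / (4 * -a)) * Complex.exp c := by
  rw [← (PiLp.volume_preserving_toLp (Fin d)).integral_comp
    (MeasurableEquiv.toLp 2 _).measurableEmbedding]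
  simp_rw [gaussianFun_toLp]
  rw [integral_mul_const, GaussianFourier.integral_cexp_neg_mul_sum_add (by simpa),
    Fintype.card_fin]

theorem fourier_gaussianFun {a : ℂ} (ha : a.re < 0) (b : Fin d → ℂ) (c : ℂ) (w : Space d) :
    𝓕 (gaussianFun a b c) w = (Real.pi / -a) ^ (d / 2 : ℂ) *
      Complex.exp ((∑ i, (b i - 2 * Real.pi * Complex.I * (w i : ℝ)) ^ 2) / (4 * -a)) *
        Complex.exp c := by
  rw [Real.fourier_eq', ← integral_gaussianFun ha]
  refine integral_congr_ae (Eventually.of_forall fun v => ?_)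
  simp only [gaussianFun, smul_eq_mul]
  rw [← Complex.exp_add]
  congr 1
  have : ((inner ℝ v w : ℝ) : ℂ) = ∑ j, ((w j : ℝ) : ℂ) * ((v j : ℝ) : ℂ) := by
    simp [PiLp.inner_apply]
  push_cast
  rw [this]
  simp only [sub_mul, Finset.sum_sub_distrib, Finset.mul_sum, Finset.sum_mul]
  have e : ∑ j, 2 * (Real.pi : ℂ) * Complex.I * (w j : ℝ) * (v j : ℝ) =
      -∑ j, -2 * (Real.pi : ℂ) * ((w j : ℝ) * (v j : ℝ)) * Complex.I := by
    rw [← Finset.sum_neg_distrib]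
    exact Finset.sum_congr rfl fun j _ => by ring
  rw [e]
  ring

/-- Each gaussian is the Fourier transform of a gaussian. -/
theorem exists_fourier_gaussianFun_eq {a : ℂ} (ha : a.re < 0) (b : Fin d → ℂ) (c : ℂ) :
    ∃ (a' c' : ℂ) (b' : Fin d → ℂ), a'.re < 0 ∧ 𝓕 (gaussianFun a' b' c') = gaussianFun a b c := by
  have ha0 : a ≠ 0 := by rintro rfl; simp at ha
  have hpi : (Real.pi : ℂ) ≠ 0 := by exact_mod_cast Real.pi_ne_zero
  -- The transform of exp(a'|η|² + b'·η) is K exp(∑ⱼ (b'ⱼ - 2πi wⱼ)² / (-4a')). The w² terms give a'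
  -- = π²/a, the linear terms give b', and the new constant absorbs the rest through log K.
  set a' : ℂ := Real.pi ^ 2 / a with ha'
  have ha'0 : a' ≠ 0 := div_ne_zero (pow_ne_zero 2 hpi) ha0
  have hre : a'.re < 0 := by
    have : a' = ((Real.pi ^ 2 : ℝ) : ℂ) * a⁻¹ := by rw [ha', div_eq_mul_inv]; push_cast; ring
    rw [this, Complex.re_ofReal_mul, Complex.inv_re]
    exact mul_neg_of_pos_of_neg (by positivity)
      (div_neg_of_neg_of_pos ha (Complex.normSq_pos.2 ha0))
  let b' : Fin d → ℂ := fun j => -Complex.I * a' * b j / Real.pi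
  set K : ℂ := (Real.pi / -a') ^ (d / 2 : ℂ) with hK
  have hK0 : K ≠ 0 := by
    rw [hK, Ne, Complex.cpow_eq_zero_iff, not_and_or]
    exact Or.inl (div_ne_zero hpi (neg_ne_zero.2 ha'0))
  refine ⟨a', c - Complex.log K - (∑ i, b' i ^ 2) / (4 * -a'), b', hre, ?_⟩
  funext w
  rw [fourier_gaussianFun hre, ← hK, gaussianFun]
  conv_lhs => rw [← Complex.exp_log hK0]
  rw [← Complex.exp_add, ← Complex.exp_add, Complex.exp_log hK0]
  congr 1
  have hw : ((‖w‖ ^ 2 : ℝ) : ℂ) = ∑ j, ((w j : ℝ) : ℂ) ^ 2 := by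
    rw [EuclideanSpace.norm_sq_eq]
    simp
  have hb : ∀ j, b j * ((w j : ℝ) : ℂ) =
      (-(4 * Real.pi * Complex.I) * b' j * (w j : ℝ)) / (4 * -a') := by
    intro j
    simp only [b']
    field_simp
    rw [Complex.I_sq]
    ring
  rw [hw, Finset.sum_congr rfl fun j _ => hb j]
  have haa : a = -(4 * Real.pi ^ 2) / (4 * -a') := by
    rw [ha']
    field_simp
  rw [haa, ← Finset.sum_div, div_mul_eq_mul_div, Finset.mul_sum]
  have e : ∑ i, (b' i - 2 * Real.pi * Complex.I * (w i : ℝ)) ^ 2 = (∑ i, b' i ^ 2) +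
      (∑ i, -(4 * Real.pi * Complex.I) * b' i * (w i : ℝ)) +
        ∑ i, -(4 * (Real.pi : ℂ) ^ 2) * ((w i : ℝ) : ℂ) ^ 2 := by
    rw [← Finset.sum_add_distrib, ← Finset.sum_add_distrib]
    refine Finset.sum_congr rfl fun j _ => ?_
    linear_combination 4 * (Real.pi : ℂ) ^ 2 * ((w j : ℝ) : ℂ) ^ 2 * Complex.I_sq
  rw [e]
  ring

/-- A gaussian tensor square is a function of the output frequency. -/
theorem gaussianFun_mul (a : ℂ) (b : Fin d → ℂ) (c : ℂ) (p : Space d × Space d) :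
    gaussianFun a b c p.1 * gaussianFun a b c p.2 =
      Complex.exp (-a * (((outputFrequency p).fst : ℝ) : ℂ) +
        ∑ j, b j * (((outputFrequency p).snd j : ℝ) : ℂ) + 2 * c) := by
  change _ = Complex.exp (-a * ((-(‖p.1‖ ^ 2 + ‖p.2‖ ^ 2) : ℝ) : ℂ) +
    ∑ j, b j * (((p.1 + p.2) j : ℝ) : ℂ) + 2 * c)
  rw [gaussianFun, gaussianFun, ← Complex.exp_add]
  congr 1
  simp only [PiLp.add_apply, Complex.ofReal_add, mul_add, Finset.sum_add_distrib]
  push_cast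
  ring

/-- In sum and difference coordinates the quadratic part splits and the linear part sees only the
sum, so the energy of a gaussian pair is a product of two integrals. -/
theorem enorm_sq_gaussianFun_mul (a : ℂ) (b : Fin d → ℂ) (c : ℂ) (ξ ω : Space d) :
    ‖gaussianFun a b c ((2⁻¹ : ℝ) • (ξ + ω))‖ₑ ^ 2 *
        ‖gaussianFun a b c ((2⁻¹ : ℝ) • (ξ - ω))‖ₑ ^ 2 =
      ‖gaussianFun a (fun j => 2 * b j) (4 * c) ξ‖ₑ *
        ENNReal.ofReal (Real.exp (a.re * ‖ω‖ ^ 2)) := by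
  have h : ENNReal.ofReal (Real.exp (a.re * ‖ω‖ ^ 2)) =
      ‖Complex.exp (a * ((‖ω‖ ^ 2 : ℝ) : ℂ))‖ₑ := by
    rw [← ofReal_norm, Complex.norm_exp, Complex.re_mul_ofReal]
  rw [h, ← mul_pow, ← enorm_mul, ← enorm_mul, ← enorm_pow]
  congr 1
  rw [gaussianFun, gaussianFun, gaussianFun, ← Complex.exp_add, ← Complex.exp_add,
    ← Complex.exp_nat_mul]
  congr 1
  have hn : ((‖(2⁻¹ : ℝ) • (ξ + ω)‖ ^ 2 : ℝ) : ℂ) + ((‖(2⁻¹ : ℝ) • (ξ - ω)‖ ^ 2 : ℝ) : ℂ) =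
      2⁻¹ * (((‖ξ‖ ^ 2 : ℝ) : ℂ) + ((‖ω‖ ^ 2 : ℝ) : ℂ)) := by
    rw [← Complex.ofReal_add, ← Complex.ofReal_add,
      show (2⁻¹ : ℂ) = ((2⁻¹ : ℝ) : ℂ) by push_cast; rfl, ← Complex.ofReal_mul]
    congr 1
    rw [norm_smul, norm_smul, mul_pow, mul_pow, Real.norm_eq_abs, sq_abs]
    have := parallelogram_law_with_norm ℝ ξ ω
    linear_combination 2⁻¹ ^ 2 * this
  have hs : (∑ j, b j * ((((2⁻¹ : ℝ) • (ξ + ω)) j : ℝ) : ℂ)) +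
      (∑ j, b j * ((((2⁻¹ : ℝ) • (ξ - ω)) j : ℝ) : ℂ)) =
        2⁻¹ * ∑ j, 2 * b j * ((ξ j : ℝ) : ℂ) := by
    rw [← Finset.sum_add_distrib, Finset.mul_sum]
    refine Finset.sum_congr rfl fun j _ => ?_
    simp only [PiLp.smul_apply, PiLp.add_apply, PiLp.sub_apply, smul_eq_mul]
    push_cast
    ring
  push_cast at hn ⊢
  linear_combination 2 * a * hn + 2 * hs

theorem energyIntegral_gaussianFun (γ : ℝ) (a : ℂ) (b : Fin d → ℂ) (c : ℂ) :
    energyIntegral γ (gaussianFun a b c) (gaussianFun a b c) = ENNReal.ofReal ((2⁻¹ : ℝ) ^ d) *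
      ((∫⁻ ξ, ‖gaussianFun a (fun j => 2 * b j) (4 * c) ξ‖ₑ) *
        ∫⁻ ω : Space d, ENNReal.ofReal (Real.exp (a.re * ‖ω‖ ^ 2) * ‖ω‖ ^ γ)) := by
  have hm := (continuous_gaussianFun a b c).measurable
  rw [energyIntegral, lintegral_sum_diff _ (measurable_energy_integrand hm hm γ)]
  have hm1 : Measurable fun ω : Space d =>
      ENNReal.ofReal (Real.exp (a.re * ‖ω‖ ^ 2) * ‖ω‖ ^ γ) := by fun_prop
  have hm2 := (continuous_gaussianFun a (fun j => 2 * b j) (4 * c)).measurable.enorm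
  congr 1
  rw [← lintegral_mul_const _ hm2]
  refine lintegral_congr fun ξ => ?_
  rw [← lintegral_const_mul _ hm1]
  refine lintegral_congr fun ω => ?_
  dsimp only
  rw [enorm_sq_gaussianFun_mul, mul_assoc, ← ENNReal.ofReal_mul (Real.exp_pos _).le]
  congr 5
  module

/-- In polar coordinates the integrand is y^{d-1+γ} e^{κy²}. The condition γ > -d is integrability
at 0 when κ < 0; if κ ≥ 0 the integrand dominates a pure power, which is never integrable on the
whole half-line. -/
theorem integrable_exp_mul_rpow_norm_iff (hd : 2 ≤ d) {κ γ : ℝ} (hγ : -(d : ℝ) < γ) :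
    Integrable (fun ω : Space d => Real.exp (κ * ‖ω‖ ^ 2) * ‖ω‖ ^ γ) ↔ κ < 0 := by
  have : Nonempty (Fin d) := ⟨⟨0, by omega⟩⟩
  have e : ∀ y ∈ Set.Ioi (0 : ℝ), y ^ (Module.finrank ℝ (Space d) - 1) •
      (Real.exp (κ * y ^ 2) * y ^ γ) = y ^ ((d : ℝ) - 1 + γ) * Real.exp (κ * y ^ 2) := by
    intro y hy
    rw [finrank_euclideanSpace_fin, smul_eq_mul, ← Real.rpow_natCast, Nat.cast_sub (by omega),
      Real.rpow_add hy, Nat.cast_one]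
    ring
  rw [integrable_fun_norm_addHaar volume (f := fun r => Real.exp (κ * r ^ 2) * r ^ γ),
    integrableOn_congr_fun e measurableSet_Ioi]
  constructor
  · intro h
    by_contra! hκ
    refine not_integrableOn_Ioi_rpow ((d : ℝ) - 1 + γ) (h.mono' ?_ ?_)
    · exact (measurable_id.pow_const _).aestronglyMeasurable
    · filter_upwards [ae_restrict_mem measurableSet_Ioi] with y hy
      have hy0 : 0 ≤ y ^ ((d : ℝ) - 1 + γ) := Real.rpow_nonneg (le_of_lt hy) _
      rw [Real.norm_of_nonneg hy0]
      exact le_mul_of_one_le_right hy0 (Real.one_le_exp (by positivity))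
  · intro hκ
    have := integrableOn_rpow_mul_exp_neg_mul_sq (neg_pos.2 hκ) (s := (d : ℝ) - 1 + γ)
      (by linarith)
    simpa using this

/-- The gaussians of finite energy. -/
theorem energyIntegral_gaussianFun_lt_top_iff (hd : 2 ≤ d) {γ : ℝ} (hγ : -(d : ℝ) < γ) (a : ℂ)
    (b : Fin d → ℂ) (c : ℂ) :
    energyIntegral γ (gaussianFun a b c) (gaussianFun a b c) < ∞ ↔ a.re < 0 := by
  have hpos := lintegral_enorm_gaussianFun_ne_zero a (fun j => 2 * b j) (4 * c)
  have hm1 : AEStronglyMeasurable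
      (fun ω : Space d => Real.exp (a.re * ‖ω‖ ^ 2) * ‖ω‖ ^ γ) volume := by
    have : Measurable fun ω : Space d => Real.exp (a.re * ‖ω‖ ^ 2) * ‖ω‖ ^ γ := by fun_prop
    exact this.aestronglyMeasurable
  have hint := lintegral_ofReal_ne_top_iff_integrable hm1
    (Eventually.of_forall fun ω => by positivity)
  rw [energyIntegral_gaussianFun, ← integrable_exp_mul_rpow_norm_iff hd hγ, ← hint]
  have h2 : ENNReal.ofReal ((2⁻¹ : ℝ) ^ d) ≠ 0 := (ENNReal.ofReal_pos.2 (by positivity)).ne'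
  constructor
  · intro h h'
    rw [h', ENNReal.mul_top hpos, ENNReal.mul_top h2] at h
    exact lt_irrefl _ h
  · intro h
    have ha := (integrable_exp_mul_rpow_norm_iff hd hγ).1 (hint.1 h)
    exact ENNReal.mul_lt_top ENNReal.ofReal_lt_top
      (ENNReal.mul_lt_top (integrable_gaussianFun ha _ _).2 (lt_top_iff_ne_top.2 h))

theorem energyIntegral_gaussianFun_ne_zero (hd : 2 ≤ d) (γ : ℝ) (a : ℂ)
    (b : Fin d → ℂ) (c : ℂ) :
    energyIntegral γ (gaussianFun a b c) (gaussianFun a b c) ≠ 0 := by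
  have h1 : ∫⁻ ω : Space d, ENNReal.ofReal (Real.exp (a.re * ‖ω‖ ^ 2) * ‖ω‖ ^ γ) ≠ 0 := by
    have : Nontrivial (Space d) := by
      have : Nonempty (Fin d) := ⟨⟨0, by omega⟩⟩
      infer_instance
    intro h
    rw [lintegral_eq_zero_iff (by fun_prop)] at h
    obtain ⟨ω, hω, hω0⟩ := (h.and (volume.ae_ne (0 : Space d))).exists
    have hpos : 0 < Real.exp (a.re * ‖ω‖ ^ 2) * ‖ω‖ ^ γ :=
      mul_pos (Real.exp_pos _) (Real.rpow_pos_of_pos (norm_pos_iff.2 hω0) γ)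
    exact (ENNReal.ofReal_pos.2 hpos).ne' hω
  rw [energyIntegral_gaussianFun]
  exact mul_ne_zero (ENNReal.ofReal_pos.2 (by positivity)).ne'
    (mul_ne_zero (lintegral_enorm_gaussianFun_ne_zero _ _ _) h1)

end Gaussian

/-! ### The data for which equality holds -/

section Extremizer

open scoped FourierTransform

/-- By duality, 𝓕 k determines the integrals of k against Schwartz functions. -/
theorem ae_eq_of_fourier_eq {V : Type*} [NormedAddCommGroup V] [InnerProductSpace ℝ V]
    [FiniteDimensional ℝ V] [MeasurableSpace V] [BorelSpace V] {f g : V → ℂ} (hf : Integrable f)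
    (hg : Integrable g) (h : 𝓕 f = 𝓕 g) : f =ᵐ[volume] g := by
  have key : ∀ (k : V → ℂ), Integrable k → ∀ φ : 𝓢(V, ℂ), ∫ x, φ x * k x =
      ∫ x, (𝓕⁻ φ : 𝓢(V, ℂ)) x * 𝓕 k x := by
    intro k hk φ
    have := VectorFourier.integral_fourierIntegral_smul_eq_flip (L := innerₗ V)
      Real.continuous_fourierChar continuous_inner (𝓕⁻ φ : 𝓢(V, ℂ)).integrable (μ := volume) hk
    have h1 : VectorFourier.fourierIntegral Real.fourierChar volume (innerₗ V) (⇑(𝓕⁻ φ : 𝓢(V, ℂ))) = φ := by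
      change 𝓕 (⇑(𝓕⁻ φ : 𝓢(V, ℂ))) = φ
      rw [← SchwartzMap.fourier_coe, FourierTransform.fourier_fourierInv_eq]
    rw [h1, flip_innerₗ] at this
    exact this
  refine ae_eq_of_integral_contDiff_smul_eq hf.locallyIntegrable hg.locallyIntegrable
    fun χ hχ hs => ?_
  have hs' : HasCompactSupport (fun x => ((χ x : ℝ) : ℂ)) :=
    hs.comp_left (g := fun y : ℝ => (y : ℂ)) Complex.ofReal_zero
  have hc : ContDiff ℝ ((⊤ : ℕ∞) : WithTop ℕ∞) (fun x => ((χ x : ℝ) : ℂ)) :=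
    Complex.ofRealCLM.contDiff.comp hχ
  have h1 := key f hf (hs'.toSchwartzMap hc)
  rw [h, ← key g hg] at h1
  simpa using h1

theorem continuous_fourier_of_integrable {V : Type*} [NormedAddCommGroup V]
    [InnerProductSpace ℝ V] [FiniteDimensional ℝ V] [MeasurableSpace V] [BorelSpace V] {f : V → ℂ}
    (hf : Integrable f) : Continuous (𝓕 f) :=
  VectorFourier.fourierIntegral_continuous (L := innerₗ V) Real.continuous_fourierChar
    continuous_inner hf

variable {d : ℕ}

/-- The map turning the difference of two frequencies by `R`. -/
def turn (R : Space d →ₗ[ℝ] Space d) : Space d × Space d →ₗ[ℝ] Space d × Space d :=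
  LinearMap.prod
    ((2⁻¹ : ℝ) • (LinearMap.fst ℝ _ _ + LinearMap.snd ℝ _ _ +
      R ∘ₗ (LinearMap.fst ℝ _ _ - LinearMap.snd ℝ _ _)))
    ((2⁻¹ : ℝ) • (LinearMap.fst ℝ _ _ + LinearMap.snd ℝ _ _ -
      R ∘ₗ (LinearMap.fst ℝ _ _ - LinearMap.snd ℝ _ _)))

theorem turn_apply (R : Space d →ₗ[ℝ] Space d) (p : Space d × Space d) :
    turn R p = ((2⁻¹ : ℝ) • (p.1 + p.2 + R (p.1 - p.2)), (2⁻¹ : ℝ) • (p.1 + p.2 - R (p.1 - p.2))) :=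
  rfl

theorem turn_fst_add_snd (R : Space d →ₗ[ℝ] Space d) (p : Space d × Space d) :
    (turn R p).1 + (turn R p).2 = p.1 + p.2 := by
  rw [turn_apply]
  module

theorem turn_fst_sub_snd (R : Space d →ₗ[ℝ] Space d) (p : Space d × Space d) :
    (turn R p).1 - (turn R p).2 = R (p.1 - p.2) := by
  rw [turn_apply]
  module

theorem turn_turn {R : Space d →ₗ[ℝ] Space d} (hR : ∀ x, R (R x) = x) (p : Space d × Space d) :
    turn R (turn R p) = p := by
  rw [turn_apply R (turn R p), turn_fst_add_snd, turn_fst_sub_snd, hR]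
  ext1 <;> dsimp only <;> module

theorem outputFrequency_turn {R : Space d →ₗ[ℝ] Space d} (hR : ∀ x, ‖R x‖ = ‖x‖)
    (p : Space d × Space d) : outputFrequency (turn R p) = outputFrequency p := by
  have h1 := parallelogram_law_with_norm ℝ (turn R p).1 (turn R p).2
  have h2 := parallelogram_law_with_norm ℝ p.1 p.2
  rw [turn_fst_add_snd, turn_fst_sub_snd, hR, h2] at h1
  rw [outputFrequency, outputFrequency, turn_fst_add_snd]
  congr 3
  linarith

/-- A linear involution has determinant ±1. -/
theorem measurePreserving_turn {R : Space d →ₗ[ℝ] Space d} (hR : ∀ x, R (R x) = x) :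
    MeasurePreserving (turn R) := by
  have hdet : LinearMap.det (turn R) * LinearMap.det (turn R) = 1 := by
    rw [← LinearMap.det_comp, show turn R ∘ₗ turn R = LinearMap.id from
      LinearMap.ext (turn_turn hR), LinearMap.det_id]
  have h0 : LinearMap.det (turn R) ≠ 0 := left_ne_zero_of_mul_eq_one hdet
  refine ⟨(LinearMap.continuous_of_finiteDimensional _).measurable, ?_⟩
  have : (volume : Measure (Space d × Space d)).IsAddHaarMeasure :=
    inferInstanceAs (((volume : Measure (Space d)).prod volume).IsAddHaarMeasure)
  rw [Measure.map_linearMap_addHaar_eq_smul_addHaar _ h0]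
  have habs : |LinearMap.det (turn R)| = 1 := by
    rw [← abs_mul_abs_self] at hdet
    exact (mul_self_eq_one_iff.1 hdet).resolve_right (by linarith [abs_nonneg (LinearMap.det (turn R))])
  rw [abs_inv, habs, inv_one, ENNReal.ofReal_one, one_smul]

theorem fourier_mul_fourier (f : Space d → ℂ) (x y : Space d) :
    𝓕 f x * 𝓕 f y = ∫ p : Space d × Space d,
      Complex.exp (((-2 * Real.pi * (inner ℝ p.1 x + inner ℝ p.2 y) : ℝ) : ℂ) * Complex.I) *
        (f p.1 * f p.2) := by
  rw [Real.fourier_eq', Real.fourier_eq', ← integral_prod_mul]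
  refine integral_congr_ae (Eventually.of_forall fun p => ?_)
  simp only [smul_eq_mul, mul_add, Complex.ofReal_add, add_mul, Complex.exp_add]
  ring

/-- If `f ⊗ f` is a function of the output frequency, then so is its Fourier transform. -/
theorem isRectangular_fourier {f : Space d → ℂ} {k : SpaceTime d → ℂ}
    (hk : ∀ᵐ p : Space d × Space d, f p.1 * f p.2 = k (outputFrequency p)) :
    IsRectangular (𝓕 f) := by
  intro x y x' y' hsum hsq
  have hnorm : ‖x - y‖ = ‖x' - y'‖ := by
    have h1 := parallelogram_law_with_norm ℝ x y
    have h2 := parallelogram_law_with_norm ℝ x' y'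
    rw [hsum] at h1
    rw [← sq_eq_sq₀ (norm_nonneg _) (norm_nonneg _)]
    linarith
  -- Since |x - y| = |x' - y'|, a reflection carries one difference to the other. Turning (ζ, η) by
  -- it keeps the output frequency, hence f ⊗ f almost everywhere, and carries the character of (x',
  -- y') to that of (x, y).
  set ρ := (ℝ ∙ ((x - y) - (x' - y')))ᗮ.reflection with hρ
  have hρ1 : ρ (x - y) = x' - y' := Submodule.reflection_sub hnorm
  let R : Space d →ₗ[ℝ] Space d := ρ.toLinearEquiv.toLinearMap
  have hRR : ∀ v, R (R v) = v := fun v => Submodule.reflection_reflection _ v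
  have hRn : ∀ v, ‖R v‖ = ‖v‖ := fun v => ρ.norm_map v
  have hmp := measurePreserving_turn hRR
  let e := MeasurableEquiv.ofInvolutive (turn R) (turn_turn hRR) hmp.measurable
  have hpair : ∀ p : Space d × Space d, inner ℝ (turn R p).1 x' + inner ℝ (turn R p).2 y' =
      inner ℝ p.1 x + inner ℝ p.2 y := by
    intro p
    have polar : ∀ u v w z : Space d, inner ℝ u w + inner ℝ v z =
        (2⁻¹ : ℝ) * (inner ℝ (u + v) (w + z) + inner ℝ (u - v) (w - z)) := by
      intro u v w z
      simp only [inner_add_left, inner_add_right, inner_sub_left, inner_sub_right]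
      ring
    rw [polar, polar p.1, turn_fst_add_snd, turn_fst_sub_snd, ← hρ1, hsum]
    congr 2
    exact ρ.inner_map_map _ _
  rw [fourier_mul_fourier, fourier_mul_fourier f x',
    ← MeasurePreserving.integral_comp' (f := e) hmp fun p => Complex.exp
      (((-2 * Real.pi * (inner ℝ p.1 x' + inner ℝ p.2 y') : ℝ) : ℂ) * Complex.I) *
        (f p.1 * f p.2)]
  refine integral_congr_ae ?_
  filter_upwards [hk, hmp.quasiMeasurePreserving.ae hk] with p h1 h2
  change _ = Complex.exp (((-2 * Real.pi * (inner ℝ (turn R p).1 x' + inner ℝ (turn R p).2 y') : ℝ) :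
    ℂ) * Complex.I) * (f (turn R p).1 * f (turn R p).2)
  rw [h2, hpair, outputFrequency_turn hRn, h1]

/-- The exponential of a quadratic function that tends to zero at infinity is a gaussian. -/
theorem re_neg_of_tendsto_zero (hd : 2 ≤ d) {a c : ℂ} {B : Space d →ₗ[ℝ] ℂ}
    (h : Tendsto (fun x : Space d => Complex.exp (a * ((‖x‖ ^ 2 : ℝ) : ℂ) + B x + c))
      (cocompact (Space d)) (𝓝 0)) : a.re < 0 := by
  by_contra! ha
  have : Nonempty (Fin d) := ⟨⟨0, by omega⟩⟩
  have hneg : Tendsto (fun x : Space d => -x) (cocompact (Space d)) (cocompact (Space d)) :=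
    (Homeomorph.neg (Space d)).isClosedEmbedding.tendsto_cocompact
  -- Multiplying the values at x and -x removes the linear part; if Re a ≥ 0, the product stays at
  -- least exp(2 Re c) in modulus.
  have h1 := (h.mul (h.comp hneg)).norm
  simp only [Function.comp_apply, norm_neg, map_neg, ← Complex.exp_add, mul_zero, norm_zero] at h1
  have h2 : ∀ x : Space d, Real.exp (2 * c.re) ≤
      ‖Complex.exp (a * ((‖x‖ ^ 2 : ℝ) : ℂ) + B x + c + (a * ((‖x‖ ^ 2 : ℝ) : ℂ) + -B x + c))‖ := by
    intro x
    rw [Complex.norm_exp, Real.exp_le_exp]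
    simp only [Complex.add_re, Complex.neg_re, Complex.re_mul_ofReal]
    nlinarith [mul_nonneg ha (sq_nonneg ‖x‖)]
  have h3 := ge_of_tendsto h1 (Eventually.of_forall h2)
  exact absurd h3 (not_le.2 (Real.exp_pos _))

/-- An integrable function whose tensor square depends only on the output frequency is a
gaussian. -/
theorem ae_eq_gaussianFun_of_integrable (hd : 2 ≤ d) {f : Space d → ℂ} (hf : Integrable f)
    (hf0 : ¬ f =ᵐ[volume] 0) {k : SpaceTime d → ℂ}
    (hk : ∀ᵐ p : Space d × Space d, f p.1 * f p.2 = k (outputFrequency p)) :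
    ∃ (a c : ℂ) (b : Fin d → ℂ), f =ᵐ[volume] gaussianFun a b c := by
  have h0 : ∃ p, 𝓕 f p ≠ 0 := by
    by_contra! h
    refine hf0 (ae_eq_of_fourier_eq hf (integrable_zero _ _ _) ?_)
    funext w
    rw [h w, Real.fourier_eq']
    simp
  obtain ⟨a, c, B, hE⟩ := (isRectangular_fourier hk).exists_eq_exp hd
    (continuous_fourier_of_integrable hf) h0
  -- By the Riemann-Lebesgue lemma the transform tends to zero at infinity.
  have ha : a.re < 0 := by
    refine re_neg_of_tendsto_zero hd (c := c) (B := B) ?_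
    simp_rw [← hE]
    exact tendsto_integral_exp_inner_smul_cocompact f
  let b : Fin d → ℂ := fun j => B (EuclideanSpace.single j 1)
  have hB : ∀ x, B x = ∑ j, b j * ((x j : ℝ) : ℂ) := by
    intro x
    have hx : x = ∑ j, x j • EuclideanSpace.single j (1 : ℝ) := by
      have := (EuclideanSpace.basisFun (Fin d) ℝ).sum_repr x
      simpa using this.symm
    conv_lhs => rw [hx]
    rw [map_sum]
    refine Finset.sum_congr rfl fun j _ => ?_
    rw [map_smul, Complex.real_smul, mul_comm]
  obtain ⟨a', c', b', ha', hG⟩ := exists_fourier_gaussianFun_eq ha b c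
  refine ⟨a', c', b', ae_eq_of_fourier_eq hf (integrable_gaussianFun ha' _ _) ?_⟩
  rw [hG]
  funext w
  rw [hE, hB, gaussianFun]

/-- The gaussian factor provides integrability without spoiling the functional equation, because its
own tensor square is a function of the output frequency. -/
theorem integrable_mul_gaussian {f : Space d → ℂ} {N : ℕ}
    (hf : Integrable fun ζ => f ζ * ((((1 + ‖ζ‖) ^ N)⁻¹ : ℝ) : ℂ)) :
    Integrable fun ζ => f ζ * ((Real.exp (-‖ζ‖ ^ 2) : ℝ) : ℂ) := by
  have hc : Continuous fun ζ : Space d => (((1 + ‖ζ‖) ^ N * Real.exp (-‖ζ‖ ^ 2) : ℝ) : ℂ) := by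
    fun_prop
  -- The bound comes from (1 + r)^N ≤ N! e^{1+r} and 1 + r - r² ≤ 2.
  have hb : ∀ ζ : Space d, ‖(((1 + ‖ζ‖) ^ N * Real.exp (-‖ζ‖ ^ 2) : ℝ) : ℂ)‖ ≤
      N.factorial * Real.exp 2 := by
    intro ζ
    have h0 : 0 ≤ ‖ζ‖ := norm_nonneg ζ
    rw [Complex.norm_real, Real.norm_of_nonneg (by positivity)]
    have h1 := Real.pow_div_factorial_le_exp (1 + ‖ζ‖) (by positivity) N
    rw [div_le_iff₀ (by positivity)] at h1
    calc (1 + ‖ζ‖) ^ N * Real.exp (-‖ζ‖ ^ 2)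
        ≤ (Real.exp (1 + ‖ζ‖) * N.factorial) * Real.exp (-‖ζ‖ ^ 2) := by gcongr
      _ = N.factorial * Real.exp (1 + ‖ζ‖ - ‖ζ‖ ^ 2) := by
          rw [sub_eq_add_neg, Real.exp_add (1 + ‖ζ‖)]; ring_nf
      _ ≤ N.factorial * Real.exp 2 := by
          gcongr
          nlinarith [sq_nonneg (‖ζ‖ - 1)]
  refine (hf.mul_bdd hc.aestronglyMeasurable (Eventually.of_forall hb)).congr
    (Eventually.of_forall fun ζ => ?_)
  have : (((1 + ‖ζ‖) ^ N : ℝ) : ℂ) ≠ 0 := by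
    exact_mod_cast (by positivity : (1 + ‖ζ‖) ^ N ≠ 0)
  push_cast at this ⊢
  field_simp

theorem energyIntegral_const_mul (γ : ℝ) {f g : Space d → ℂ} (hf : Measurable f)
    (hg : Measurable g) (s : ℂ) :
    energyIntegral γ f (fun x => s * g x) = ‖s‖ₑ ^ 2 * energyIntegral γ f g := by
  rw [energyIntegral, energyIntegral, ← lintegral_const_mul _ (measurable_energy_integrand hf hg γ)]
  refine lintegral_congr fun p => ?_
  rw [enorm_mul, mul_pow]
  ring

/-- The output frequency is symmetric, so f(ζ)g(η) = f(η)g(ζ) almost everywhere; it remains to fix a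
generic ζ with f(ζ) ≠ 0. -/
theorem exists_ae_eq_mul_of_swap {f g : Space d → ℂ} (hf0 : ¬ f =ᵐ[volume] 0)
    {k : SpaceTime d → ℂ}
    (hk : ∀ᵐ p : Space d × Space d, f p.1 * g p.2 = k (outputFrequency p)) :
    ∃ c : ℂ, g =ᵐ[volume] fun x => c * f x := by
  have hswap : MeasurePreserving (Prod.swap : Space d × Space d → Space d × Space d) :=
    Measure.measurePreserving_swap
  have h1 : ∀ᵐ p : Space d × Space d, f p.1 * g p.2 = f p.2 * g p.1 := by
    filter_upwards [hk, hswap.quasiMeasurePreserving.ae hk] with p hp hp'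
    have : outputFrequency p.swap = outputFrequency p := by
      simp [outputFrequency, add_comm]
    rw [this, ← hp] at hp'
    exact hp'.symm
  have h2 := Measure.ae_ae_of_ae_prod h1
  have h3 : ∃ᶠ x in ae (volume : Measure (Space d)), f x ≠ 0 := by
    intro h
    exact hf0 (h.mono fun x hx => not_not.1 hx)
  obtain ⟨ζ, hζ0, hζ⟩ := (h3.and_eventually h2).exists
  refine ⟨g ζ / f ζ, ?_⟩
  filter_upwards [hζ] with η hη
  field_simp
  linear_combination hη

/-- The extremizers of the bilinear estimate, on the Fourier side. -/
theorem ae_eq_gaussianFun_of_energyIntegral_lt_top (hd : 2 ≤ d) {γ : ℝ} (hγ : -(d : ℝ) < γ)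
    {f g : Space d → ℂ} (hfm : Measurable f) (hgm : Measurable g)
    (hfl : LocallyIntegrable f volume) (hgl : LocallyIntegrable g volume)
    (hf0 : ¬ f =ᵐ[volume] 0) (hg0 : ¬ g =ᵐ[volume] 0) (hE : energyIntegral γ f g < ∞)
    {k : SpaceTime d → ℂ}
    (hk : ∀ᵐ p : Space d × Space d, f p.1 * g p.2 = k (outputFrequency p)) :
    ∃ (a c : ℂ) (b : Fin d → ℂ) (s : ℂ), a.re < 0 ∧ f =ᵐ[volume] gaussianFun a b c ∧
      g =ᵐ[volume] fun x => s * f x := by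
  obtain ⟨s, hs⟩ := exists_ae_eq_mul_of_swap hf0 hk
  have hs0 : s ≠ 0 := by
    rintro rfl
    simp only [zero_mul] at hs
    exact hg0 hs
  obtain ⟨m, hm⟩ := exists_nat_ge (|γ| / 2)
  have hm' : |γ| ≤ 2 * m := by linarith
  have hint := integrable_mul_gaussian
    (integrable_div_of_energyIntegral_lt_top hfm hgm hfl hgl hf0 hg0 hm' hE).1
  have hs2 := Measure.quasiMeasurePreserving_snd (μ := (volume : Measure (Space d)))
    (ν := (volume : Measure (Space d))).ae_eq hs
  have hexp : ∀ x : Space d, ((Real.exp (-‖x‖ ^ 2) : ℝ) : ℂ) ≠ 0 := fun x => by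
    exact_mod_cast (Real.exp_pos _).ne'
  -- The tensor square of exp(-|·|²) is e^τ; this and g = s f explain the new function k.
  obtain ⟨a, c, b, hab⟩ := ae_eq_gaussianFun_of_integrable hd hint (by
      intro h
      refine hf0 ?_
      filter_upwards [h] with x hx
      exact (mul_eq_zero.1 hx).resolve_right (hexp x))
    (k := fun z => s⁻¹ * k z * ((Real.exp z.fst : ℝ) : ℂ)) (by
      filter_upwards [hk, hs2] with p hp hp2
      simp only [Function.comp_apply] at hp2
      rw [← hp, hp2]
      change _ = s⁻¹ * (f p.1 * (s * f p.2)) * ((Real.exp (-(‖p.1‖ ^ 2 + ‖p.2‖ ^ 2)) : ℝ) : ℂ)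
      rw [neg_add, Real.exp_add, Complex.ofReal_mul]
      field_simp)
  have hfG : f =ᵐ[volume] gaussianFun (a + 1) b c := by
    filter_upwards [hab] with x hx
    have h1 : gaussianFun (a + 1) b c x = gaussianFun a b c x * Complex.exp ((‖x‖ ^ 2 : ℝ) : ℂ) := by
      rw [gaussianFun, gaussianFun, ← Complex.exp_add]
      congr 1
      ring
    rw [h1, ← hx, mul_assoc, Complex.ofReal_exp, ← Complex.exp_add]
    push_cast
    rw [neg_add_cancel, Complex.exp_zero, mul_one]
  refine ⟨a + 1, c, b, s, ?_, hfG, hs⟩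
  -- Removing the gaussian factor has shifted a by 1, so the sign of the real part has to be
  -- recovered from the finite energy.
  rw [← energyIntegral_gaussianFun_lt_top_iff hd hγ (a + 1) b c]
  have h1 := Measure.quasiMeasurePreserving_fst (μ := (volume : Measure (Space d)))
    (ν := (volume : Measure (Space d))).ae_eq hfG
  have h2 := Measure.quasiMeasurePreserving_snd (μ := (volume : Measure (Space d)))
    (ν := (volume : Measure (Space d))).ae_eq hfG
  have hEs : energyIntegral γ f g = ‖s‖ₑ ^ 2 *
      energyIntegral γ (gaussianFun (a + 1) b c) (gaussianFun (a + 1) b c) := by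
    have hm := (continuous_gaussianFun (a + 1) b c).measurable
    rw [← energyIntegral_const_mul γ hm hm]
    refine lintegral_congr_ae ?_
    filter_upwards [h1, h2, hs2] with p hp1 hp2 hp3
    simp only [Function.comp_apply] at hp1 hp2 hp3
    rw [hp3, hp1, hp2]
  rw [hEs] at hE
  exact ENNReal.lt_top_of_mul_ne_top_right hE.ne (by simpa using hs0)

end Extremizer

/-! ### Gaussians attain equality -/

section Sharpness

variable {d : ℕ}

/-- A function of the output frequency is constant on each sphere, hence equal to its mean there;
the degenerate spheres of radius zero form a null set. -/
theorem ae_eq_fiberMean (hd : 2 ≤ d) {f g : Space d → ℂ} {h : SpaceTime d → ℂ}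
    (hfg : ∀ p : Space d × Space d, f p.1 * g p.2 = h (outputFrequency p)) :
    ∀ᵐ p : Space d × Space d, f p.1 * g p.2 = fiberMean f g (outputFrequency p) := by
  have hmp := measurePreserving_pairMap hd
  have hrad : ∀ᵐ p : Space d × Space d, 0 < radius (outputFrequency p) := by
    have hset : MeasurableSet {p : Space d × Space d | 0 < radius (outputFrequency p)} :=
      measurableSet_lt measurable_const
        (continuous_radius.comp continuous_outputFrequency).measurable
    rw [← hmp.map_eq, ae_map_iff hmp.measurable.aemeasurable hset]
    filter_upwards [Measure.quasiMeasurePreserving_fst.ae ae_radius_pos] with q hq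
    rwa [outputFrequency_pairMap hq]
  filter_upwards [hrad] with p hp
  have hA : (sphereArea d : ℂ) ≠ 0 := by exact_mod_cast (sphereArea_pos hd).ne'
  rw [fiberMean, fiberIntegral, hfg]
  simp_rw [hfg]
  have : ∀ θ : UnitSphere d, outputFrequency (pairMap (outputFrequency p, θ)) = outputFrequency p :=
    fun θ => outputFrequency_pairMap (p := (outputFrequency p, θ)) hp
  simp_rw [this]
  rw [integral_const, Complex.real_smul]
  exact (inv_mul_cancel_left₀ hA _).symm

theorem isFun_zero : IsFun (0 : 𝓢'(Space d, ℂ)) 0 :=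
  ⟨locallyIntegrable_zero, fun φ _ => by simp⟩

theorem IsFun.not_ae_eq_zero {u : 𝓢'(Space d, ℂ)} (hu : u ≠ 0) {f : Space d → ℂ}
    (hf : IsFun (hat u) f) : ¬ f =ᵐ[volume] 0 := by
  intro h
  have h0 : hat (0 : 𝓢'(Space d, ℂ)) = 0 := rfl
  exact hu (hat_injective (((hf.congr h).ext isFun_zero).trans h0.symm))

theorem energy_gaussian (β : ℝ) {u₀ : 𝓢'(Space d, ℂ)} {a c : ℂ} {b : Fin d → ℂ}
    (hu : IsFun (hat u₀) (gaussianFun a b c)) (s : ℂ) :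
    energy β u₀ (s • u₀) = ‖s‖ₑ ^ 2 *
      energyIntegral (4 * β + d - 2) (gaussianFun a b c) (gaussianFun a b c) := by
  have hm := (continuous_gaussianFun a b c).measurable
  have hv : IsFun (hat (s • u₀)) (fun x => s * gaussianFun a b c x) := by
    rw [hat_smul]
    exact hu.const_smul s
  rw [energy_eq β hu hv, energyIntegral_const_mul _ hm hm]

theorem mem_Upsilon_gaussian (hd : 2 ≤ d) {β : ℝ} (hβ : (1 - (d : ℝ)) / 2 < β)
    {u₀ : 𝓢'(Space d, ℂ)} {a c : ℂ} {b : Fin d → ℂ} (ha : a.re < 0)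
    (hu : IsFun (hat u₀) (gaussianFun a b c)) (s : ℂ) : (u₀, s • u₀) ∈ Upsilon d β := by
  change energy β u₀ (s • u₀) < ∞
  rw [energy_gaussian β hu]
  refine ENNReal.mul_lt_top (by simp) ?_
  -- The hypothesis on β is exactly 4β + d - 2 > -d.
  exact (energyIntegral_gaussianFun_lt_top_iff hd (by linarith) a b c).2 ha

theorem dispersiveNormSq_gaussian (hd : 2 ≤ d) {β : ℝ} (hβ : (1 - (d : ℝ)) / 2 < β)
    {u₀ : 𝓢'(Space d, ℂ)} {a c : ℂ} {b : Fin d → ℂ} (ha : a.re < 0)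
    (hu : IsFun (hat u₀) (gaussianFun a b c)) (s : ℂ) :
    dispersiveNormSq β u₀ (s • u₀) = sharpConst d β * energy β u₀ (s • u₀) := by
  have hm := (continuous_gaussianFun a b c).measurable
  have hv : IsFun (hat (s • u₀)) (fun x => s * gaussianFun a b c x) := by
    rw [hat_smul]
    exact hu.const_smul s
  have hE : energy β u₀ (s • u₀) < ∞ := mem_Upsilon_gaussian hd hβ ha hu s
  rw [energy_eq β hu hv] at hE
  rw [dispersiveNormSq_eq_iff hd β hu hv hm (hm.const_mul s) hE]
  refine ae_eq_fiberMean hd (f := gaussianFun a b c) (g := fun x => s * gaussianFun a b c x) (h := fun z => s * Complex.exp (-a * ((z.fst : ℝ) : ℂ) +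
    ∑ j, b j * ((z.snd j : ℝ) : ℂ) + 2 * c)) fun p => ?_
  rw [← gaussianFun_mul]
  ring

theorem exists_isFun_hat_gaussianFun {a : ℂ} (ha : a.re < 0) (b : Fin d → ℂ) (c : ℂ) :
    ∃ u₀ : 𝓢'(Space d, ℂ), IsFun (hat u₀) (gaussianFun a b c) := by
  have hint := integrable_gaussianFun ha b c
  obtain ⟨S, hS⟩ := exists_distribution_of_integrable_div (N := 0) (G := gaussianFun a b c)
    (by simpa using hint)
  obtain ⟨u₀, rfl⟩ := hat_surjective S
  exact ⟨u₀, hint.locallyIntegrable, fun φ _ => hS φ⟩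

theorem exists_gaussian_of_dispersiveNormSq_eq (hd : 2 ≤ d) {β : ℝ}
    (hβ : (1 - (d : ℝ)) / 2 < β) {u₀ v₀ : 𝓢'(Space d, ℂ)} (hu : u₀ ≠ 0) (hv : v₀ ≠ 0)
    (hU : (u₀, v₀) ∈ Upsilon d β)
    (heq : dispersiveNormSq β u₀ v₀ = sharpConst d β * energy β u₀ v₀) :
    (∃ f ∈ gaussians d, IsFun (hat u₀) f) ∧ ∃ c : ℂ, v₀ = c • u₀ := by
  obtain ⟨f, g, hf, hg, hfm, hgm⟩ := exists_isFun_of_mem_Upsilon hU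
  have hE : energy β u₀ v₀ < ∞ := hU
  rw [energy_eq β hf hg] at hE
  have hk := (dispersiveNormSq_eq_iff hd β hf hg hfm hgm hE).1 heq
  obtain ⟨a, c, b, s, ha, hfG, hgs⟩ := ae_eq_gaussianFun_of_energyIntegral_lt_top hd
    (by linarith) hfm hgm hf.1 hg.1 (hf.not_ae_eq_zero hu) (hg.not_ae_eq_zero hv) hE hk
  refine ⟨⟨gaussianFun a b c, mem_gaussians.2 ⟨a, c, b, ha, rfl⟩, hf.congr hfG⟩, s, ?_⟩
  apply hat_injective
  rw [hat_smul]
  exact (hg.congr hgs).ext (hf.const_smul s)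

end Sharpness

end BilinearSchrodinger

end

open BilinearSchrodinger in
theorem theorem1p4 (d : ℕ) (hd : 2 ≤ d) (β : ℝ) (hβ : (1 - (d : ℝ)) / 2 < β) :
    -- the estimate
    (∀ u₀ v₀ : 𝓢'(Space d, ℂ), (u₀, v₀) ∈ Upsilon d β →
      dispersiveNormSq β u₀ v₀ ≤ sharpConst d β * energy β u₀ v₀) ∧
    -- the constant is optimal
    (∀ K : ℝ≥0∞,
      (∀ u₀ v₀ : 𝓢'(Space d, ℂ), (u₀, v₀) ∈ Upsilon d β →
        dispersiveNormSq β u₀ v₀ ≤ K * energy β u₀ v₀) →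
      sharpConst d β ≤ K) ∧
    -- the (nonzero) pairs of data for which it is attained
    (∀ u₀ v₀ : 𝓢'(Space d, ℂ), u₀ ≠ 0 → v₀ ≠ 0 →
      (((u₀, v₀) ∈ Upsilon d β ∧
          dispersiveNormSq β u₀ v₀ = sharpConst d β * energy β u₀ v₀) ↔
        ((∃ f ∈ gaussians d, IsFun (hat u₀) f) ∧ ∃ c : ℂ, v₀ = c • u₀))) := by
  refine ⟨fun u₀ v₀ h => ?_, fun K hK => ?_, fun u₀ v₀ hu hv => ⟨fun h => ?_, ?_⟩⟩
  · obtain ⟨f, g, hf, hg, hfm, hgm⟩ := exists_isFun_of_mem_Upsilon h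
    have hE : energy β u₀ v₀ < ∞ := h
    rw [energy_eq β hf hg] at hE
    rw [sharpConst_mul_energy hd β hf hg hfm hgm hE]
    exact le_self_add
  -- The gaussian exp(-|η|²), paired with itself, attains equality; its energy is finite and nonzero
  -- and can be cancelled.
  · have ha : (-1 : ℂ).re < 0 := by simp
    obtain ⟨u₀, hu⟩ := exists_isFun_hat_gaussianFun (d := d) ha 0 0
    have hU := mem_Upsilon_gaussian hd hβ ha hu 1
    have h := hK _ _ hU
    rw [dispersiveNormSq_gaussian hd hβ ha hu] at h
    refine (ENNReal.mul_le_mul_iff_left ?_ (ne_of_lt hU)).1 h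
    rw [energy_gaussian β hu, enorm_one, one_pow, one_mul]
    exact energyIntegral_gaussianFun_ne_zero hd _ _ _ _
  · exact exists_gaussian_of_dispersiveNormSq_eq hd hβ hu hv h.1 h.2
  · rintro ⟨⟨f, hf, hfu⟩, s, rfl⟩
    obtain ⟨a, c, b, ha, rfl⟩ := mem_gaussians.1 hf
    exact ⟨mem_Upsilon_gaussian hd hβ ha hfu s, dispersiveNormSq_gaussian hd hβ ha hfu s⟩
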